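/- **Setting.** Equip $\mathbb R\cup\{\infty\}$ with the $\sigma$-field generated by the Borel sets of $\mathbb R$ and $\{\infty\}$, and put $\infty+c=\infty$. Let $H$ be a set of functions $\mathbb R\to\mathbb R$ of period $1$ which is invariant under the shifts $\theta_c g(x)=g(x+c)$, equipped with its cylindrical $\sigma$-field, and let $\mathcal I$ be the set of compact non-degenerate intervals. An *intrinsic location functional* on $H$ is a map $L:H\times\mathcal I\to\mathbb R\cup\{\infty\}$ such that, for all $g\in H$, $c\in\mathbb R$ and $I,I_1,I_2\in\mathcal I$ with $I_2\subseteq I_1$: $L(\cdot,I)$ is measurable; $L(g,I)\in I\cup\{\infty\}$; $L(g,I)=L(\theta_cg,I-c)+c$; if $L(g,I_1)\in I_2$ then $L(g,I_2)=L(g,I_1)$; and if $L(g,I_2)\ne\infty$ then $L(g,I_1)\neq\infty$. It is *invariant* if it never takes the value $\infty$ and $L(g,[0,1])\equiv L(g,[a,a+1]) \pmod 1$ for all $g\in H$ and $a\in\mathbb R$. The *location of the path supremum* is $\tau(g,I)=\inf\{t\in I: g(t)=\sup_{s\in I}g(s)\}$. For $0<T\le 1$ let $I^1_T$ be the set of the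 laws of $L(\mathbf X,[0,T])$ over all such $H$, all invariant intrinsic location functionals $L$ on $H$, and all stationary processes $\mathbf X$ with paths in $H$ (hence of period $1$). Let $E^1_T$ be the set of probability distributions on $[0,T]\cup\{\infty\}$ with no mass at $\infty$ (point masses at $0$ and $T$ are allowed) which on $(0,T)$ are absolutely continuous with a càdlàg density $f$ that takes positive integer values at every point of $(0,T)$ and satisfies $$(TV)\qquad \mathrm{TV}_{(t_1,t_2)}(f)\le f(t_1)+f(t_2)\quad\text{for all }0<t_1<t_2<T,$$ where $\mathrm{TV}_{(t_1,t_2)}(f)$ is the total variation of $f$ on the open interval $(t_1,t_2)$. Let $C(E^1_T)$ be the convex hull generated by $E^1_T$ under the weak topology, that is, the closure of its convex hull for weak convergence of probability measures on $[0,T]\cup\{\infty\}$, where $\infty$ is an isolated point. **Theorem 4.2.** Let $0<T\le1$. 1. Every $F\in C(E^1_T)$ is the law of $L(\mathbf X,[0,T])$ for some invariant intrinsic location functional $L$ and some stationary process $\mathbf X$ of period $1$, and conversely; that is, $I^1_T=C(E^1_T)$. 2. The same equality holds if, in the definition of $I^1_T$, only processes $\mathbf X$ with continuous paths are allowed. 3.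 The location of the path supremum alone suffices: there is a shift-invariant set $H$ of upper semicontinuous functions of period $1$, each attaining its supremum at exactly one point of $[0,1)$, such that $\tau$ is an invariant intrinsic location functional on $H$ and the set of the laws of $\tau(\mathbf X,[0,T])$, over all stationary processes $\mathbf X$ with paths in $H$, is exactly $C(E^1_T)$. -/

import Mathlib

open Set Filter Topology MeasureTheory
open scoped NNReal ENNReal

/-- A compact non-degenerate interval `[lo, hi]` of the real line. -/
structure CompactInterval where
  lo : ℝ
  hi : ℝ
  lt : lo < hi

namespace CompactInterval

/-- The underlying set `[lo, hi]`. -/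
def toSet (I : CompactInterval) : Set ℝ := Set.Icc I.lo I.hi

/-- The interval `I - c`. -/
def shift (I : CompactInterval) (c : ℝ) : CompactInterval where
  lo := I.lo - c
  hi := I.hi - c
  lt := sub_lt_sub_right I.lt c

/-- The interval `[a, a + 1]`. -/
def unitFrom (a : ℝ) : CompactInterval where
  lo := a
  hi := a + 1
  lt := lt_add_one a

/-- The interval `[0, T]`. -/
def zeroTo (T : ℝ) (hT : 0 < T) : CompactInterval where
  lo := 0
  hi := T
  lt := hT

end CompactInterval

/-- The shift `θ_c g (x) = g (x + c)`. -/
def pathShift (c : ℝ) (g : ℝ → ℝ) : ℝ → ℝ := fun x => g (x + c)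

/-- A shift-invariant set of functions on the line with period `1`. -/
structure PathClass where
  carrier : Set (ℝ → ℝ)
  periodic : ∀ g ∈ carrier, Function.Periodic g 1
  shift_mem : ∀ g ∈ carrier, ∀ c : ℝ, pathShift c g ∈ carrier

namespace PathClass

/-- The paths in the class. As a subtype of `ℝ → ℝ` it carries the (trace of the) product
σ-algebra, that is, the cylindrical σ-field. -/
abbrev Path (H : PathClass) : Type := {g : ℝ → ℝ // g ∈ H.carrier}

/-- The shift `θ_c` as a map of the class into itself. -/
def shift (H : PathClass) (c : ℝ) (g : H.Path) : H.Path :=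
  ⟨pathShift c g.1, H.shift_mem g.1 g.2 c⟩

end PathClass

/-- An intrinsic location functional `L : H × 𝓘 → ℝ ∪ {∞}`. The space `ℝ ∪ {∞}` is `WithTop ℝ`;
its σ-field is generated by the Borel sets of `ℝ` and the set `{⊤}`, and `⊤ + c = ⊤`. -/
structure IsIntrinsicLocation (H : PathClass) (L : H.Path → CompactInterval → WithTop ℝ) :
    Prop where
  measurable : ∀ I : CompactInterval, Measurable (fun g : H.Path => L g I)
  mem : ∀ (g : H.Path) (I : CompactInterval),
    L g I = ⊤ ∨ ∃ t ∈ I.toSet, L g I = (t : WithTop ℝ)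
  shift_compat : ∀ (g : H.Path) (I : CompactInterval) (c : ℝ),
    L g I = L (H.shift c g) (I.shift c) + (c : WithTop ℝ)
  stable : ∀ (g : H.Path) (I₁ I₂ : CompactInterval), I₂.toSet ⊆ I₁.toSet →
    (∃ t ∈ I₂.toSet, L g I₁ = (t : WithTop ℝ)) → L g I₂ = L g I₁
  exists_mono : ∀ (g : H.Path) (I₁ I₂ : CompactInterval), I₂.toSet ⊆ I₁.toSet →
    L g I₂ ≠ ⊤ → L g I₁ ≠ ⊤

/-- An invariant intrinsic location functional: it never takes the value `∞`, and its values on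
`[0, 1]` and on `[a, a + 1]` agree modulo `1`. -/
structure IsInvariantLocation (H : PathClass) (L : H.Path → CompactInterval → WithTop ℝ) :
    Prop extends IsIntrinsicLocation H L where
  ne_top : ∀ (g : H.Path) (I : CompactInterval), L g I ≠ ⊤
  invariant : ∀ (g : H.Path) (a : ℝ), ∃ k : ℤ,
    L g (CompactInterval.unitFrom 0) = L g (CompactInterval.unitFrom a) + ((k : ℝ) : WithTop ℝ)

/-- The location of the path supremum, `inf {t ∈ I : g t = sup_{s ∈ I} g s}`, where
`inf ∅ = ∞`. -/
noncomputable def supLocation (H : PathClass) (g : H.Path) (I : CompactInterval) : WithTop ℝ :=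
  sInf ((fun t : ℝ => (t : WithTop ℝ)) '' {t | t ∈ I.toSet ∧ ∀ s ∈ I.toSet, g.1 s ≤ g.1 t})

/-- A stationary real-valued process on the line: for every `c`, the processes `X(· + c)` and `X`
have the same law on `ℝ → ℝ` with its cylindrical σ-field. -/
structure IsStationaryProcess {Ω : Type} [MeasurableSpace Ω] (P : Measure Ω) (X : ℝ → Ω → ℝ) :
    Prop where
  measurable : ∀ t : ℝ, Measurable (X t)
  stationary : ∀ c : ℝ,
    P.map (fun ω => fun t : ℝ => X (t + c) ω) = P.map (fun ω => fun t : ℝ => X t ω)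

/-- The set of laws of `L(X, [0, T])`, where `X` runs over the stationary processes with paths
in `H` (hence of period `1`) that also lie in the set `R` (a regularity requirement). -/
def locationLaws (H : PathClass) (L : H.Path → CompactInterval → WithTop ℝ)
    (R : Set (ℝ → ℝ)) (T : ℝ) (hT : 0 < T) : Set (ProbabilityMeasure (WithTop ℝ)) :=
  {F | ∃ (Ω : Type) (_ : MeasurableSpace Ω) (P : Measure Ω) (_ : IsProbabilityMeasure P)
      (X : ℝ → Ω → ℝ) (hX : ∀ ω, (fun t => X t ω) ∈ H.carrier),
      IsStationaryProcess P X ∧ (∀ ω, (fun t => X t ω) ∈ R) ∧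
      (F : Measure (WithTop ℝ)) =
        P.map (fun ω => L ⟨fun t => X t ω, hX ω⟩ (CompactInterval.zeroTo T hT))}

/-- The set of all laws on `[0, T]` of invariant intrinsic location functionals (on any class of
paths) of period-`1` stationary processes with paths in `R`. -/
def invariantLaws (R : Set (ℝ → ℝ)) (T : ℝ) (hT : 0 < T) :
    Set (ProbabilityMeasure (WithTop ℝ)) :=
  {F | ∃ (H : PathClass) (L : H.Path → CompactInterval → WithTop ℝ),
      IsInvariantLocation H L ∧ F ∈ locationLaws H L R T hT}

/-- `f` is càdlàg on the open interval `(0, T)`. -/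
def IsCadlagOn (f : ℝ → ℝ) (T : ℝ) : Prop :=
  ∀ t ∈ Ioo 0 T, ContinuousWithinAt f (Ici t) t ∧ ∃ l : ℝ, Tendsto f (𝓝[<] t) (𝓝 l)

/-- The variation constraint: the total variation of `f` on `(t₁, t₂)` is at most
`f t₁ + f t₂`, whenever `0 < t₁ < t₂ < T`. -/
def VariationConstraint (f : ℝ → ℝ) (T : ℝ) : Prop :=
  ∀ t₁ t₂ : ℝ, 0 < t₁ → t₁ < t₂ → t₂ < T →
    eVariationOn f (Ioo t₁ t₂) ≤ ENNReal.ofReal (f t₁ + f t₂)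

/-- The probability distributions on `[0, T] ∪ {∞}` with no mass at `∞` that are absolutely
continuous on `(0, T)`, with a càdlàg density there that takes positive integer values and
satisfies the variation constraint. Point masses at `0` and at `T` are allowed. -/
def positiveIntegerLaws (T : ℝ) : Set (ProbabilityMeasure (WithTop ℝ)) :=
  {F | (F : Measure (WithTop ℝ)) (((fun t : ℝ => (t : WithTop ℝ)) '' Icc 0 T) ∪ {⊤})ᶜ = 0 ∧
    (F : Measure (WithTop ℝ)) {⊤} = 0 ∧
    ∃ f : ℝ → ℝ, IsCadlagOn f T ∧
      (∀ B : Set ℝ, MeasurableSet B → B ⊆ Ioo 0 T →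
        (F : Measure (WithTop ℝ)) ((fun t : ℝ => (t : WithTop ℝ)) '' B) =
          ∫⁻ t in B, ENNReal.ofReal (f t)) ∧
      (∀ t ∈ Ioo 0 T, ∃ n : ℕ, 1 ≤ n ∧ f t = n) ∧
      VariationConstraint f T}

/-- The convex hull generated by a set of probability measures under the weak topology, i.e. the
closure of the convex hull for weak convergence of measures. It is taken among the finite measures with
the topology of weak convergence, where probability measures form a closed convex set. On
`[0, T] ∪ {⊤}` the topology of `WithTop ℝ` is the one in which `⊤` is an isolated point. -/
def weakConvexHull (A : Set (ProbabilityMeasure (WithTop ℝ))) :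
    Set (ProbabilityMeasure (WithTop ℝ)) :=
  {F | F.toFiniteMeasure ∈ closure
    (convexHull ℝ≥0 ((fun G : ProbabilityMeasure (WithTop ℝ) => G.toFiniteMeasure) '' A))}

/-! Laws lie in the hull. Fix a path and let the window `[c, c + T]` move to the right. The position
of the location inside the window falls at unit speed, except that it may jump up when the old
location is left behind (from near `0`) or when a new one enters (to near `T`); this is
`IsInvariantLocation.locationPosition_step`. Invariance supplies one point `x₀` per period that is
the location in every window having it in its interior, so once per period the position runs all the
way from `T` to `0`. The descents balance the upward jumps: occupation over a period is, up to atoms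
at `0` and `T`, the sum over the jumps of Lebesgue measure on the interval jumped over. Each of
these intervals reaches `0` or `T`, so the density is a decreasing plus an increasing integer
function, and this gives the variation constraint. Since the jumps must climb from `0` to `T`, the
density is at least one. There may be infinitely many jumps, so this is carried out approximately
along the grid of mesh `1 / n` (`exists_law_of_descent`, `exists_law_near_empirical`). By
stationarity the law of the location is the mean over the random path of these empirical measures,
and a mean of points close to a convex set is close to it (`mem_closure_convexHull_of_average`).

The hull consists of laws. The variation constraint bounds the positive variation of `f` up to `t`
by `f t`, so `f` is a decreasing plus an increasing function with natural values. Slicing both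
horizontally turns the law into a layering: lengths `b` of intervals at `0`, lengths `a` of
intervals at `T`, and a number `d` dividing the total mass between the two ends
(`exists_isLayering`). A layering is realized by a periodic path with its top at the integers and a
valley at `d`, with peaks at `d` minus the partial sums of `b` and at `d` plus those of `a`, higher
the farther from `d`. A window left of the valley selects its leftmost peak and one right of it its
rightmost peak, so a uniform phase produces exactly the prescribed law
(`map_sInf_maximizers_layerPath`).

Mixtures and limits come from compactness. Layerings form a compact space on which the law varies
continuously, so random layerings realize a compact convex set of laws; it contains the generators,
hence the hull (`weakConvexHull_subset_range_layerLaw`). To have one measurable functional for all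
layerings, every path carries in its gaps a real code of its layering and a cosine revealing its
phase. A path is then determined by its rational values, and measurability reduces to the Polish
parameter space. For continuous paths only code and cosine are kept, and the functional decodes them
and returns the location for the layer path. -/

open scoped BoundedContinuousFunction

/-! ### Finite sums of uniform laws touching an end of `[0, T]`. -/

section StepLaws

/-- The density of a sum of uniform laws with one endpoint at an end of the interval. -/
noncomputable def stepDensity (I J : Finset ℕ) (l r : ℕ → ℝ) (t : ℝ) : ℕ :=
  (I.filter fun i => t < l i).card + (J.filter fun j => r j ≤ t).card

lemma antitone_card_filter_lt (I : Finset ℕ) (l : ℕ → ℝ) :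
    Antitone fun t : ℝ => (I.filter fun i => t < l i).card := fun _ _ h =>
  Finset.card_le_card fun _ hi => by
    rw [Finset.mem_filter] at hi ⊢
    exact ⟨hi.1, h.trans_lt hi.2⟩

lemma monotone_card_filter_le (J : Finset ℕ) (r : ℕ → ℝ) :
    Monotone fun t : ℝ => (J.filter fun j => r j ≤ t).card := fun _ _ h =>
  Finset.card_le_card fun _ hi => by
    rw [Finset.mem_filter] at hi ⊢
    exact ⟨hi.1, hi.2.trans h⟩

lemma eventually_card_filter_lt (I : Finset ℕ) (l : ℕ → ℝ) (t : ℝ) :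
    ∀ᶠ s in 𝓝[≥] t, (I.filter fun i => s < l i).card = (I.filter fun i => t < l i).card := by
  have : ∀ᶠ s in 𝓝[≥] t, ∀ i ∈ I, (s < l i ↔ t < l i) := by
    rw [Finset.eventually_all]
    intro i _
    by_cases h : t < l i
    · filter_upwards [nhdsWithin_le_nhds (eventually_lt_nhds h)] with s hs
      simp [h, hs]
    · filter_upwards [self_mem_nhdsWithin] with s hs
      have : t ≤ s := hs
      exact iff_of_false (fun h' => h (this.trans_lt h')) h
  filter_upwards [this] with s hs
  rw [Finset.filter_congr hs]

lemma eventually_card_filter_le (J : Finset ℕ) (r : ℕ → ℝ) (t : ℝ) :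
    ∀ᶠ s in 𝓝[≥] t, (J.filter fun j => r j ≤ s).card = (J.filter fun j => r j ≤ t).card := by
  have : ∀ᶠ s in 𝓝[≥] t, ∀ j ∈ J, (r j ≤ s ↔ r j ≤ t) := by
    rw [Finset.eventually_all]
    intro j _
    by_cases h : r j ≤ t
    · filter_upwards [self_mem_nhdsWithin] with s hs
      have : t ≤ s := hs
      simp [h, h.trans this]
    · push Not at h
      filter_upwards [nhdsWithin_le_nhds (eventually_lt_nhds h)] with s hs
      exact iff_of_false (not_le.2 hs) (not_le.2 h)
  filter_upwards [this] with s hs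
  rw [Finset.filter_congr hs]

lemma isCadlagOn_stepDensity (I J : Finset ℕ) (l r : ℕ → ℝ) (T : ℝ) :
    IsCadlagOn (fun t => (stepDensity I J l r t : ℝ)) T := by
  intro t _
  constructor
  · refine (continuousWithinAt_const (b := (stepDensity I J l r t : ℝ))).congr_of_eventuallyEq
      ?_ rfl
    filter_upwards [eventually_card_filter_lt I l t, eventually_card_filter_le J r t] with s h1 h2
    simp [stepDensity, h1, h2]
  · have h1 : Antitone fun t : ℝ => ((I.filter fun i => t < l i).card : ℝ) :=
      fun a b h => Nat.cast_le.2 (antitone_card_filter_lt I l h)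
    have h2 : Monotone fun t : ℝ => ((J.filter fun j => r j ≤ t).card : ℝ) :=
      fun a b h => Nat.cast_le.2 (monotone_card_filter_le J r h)
    refine ⟨_, ((h1.tendsto_nhdsLT t).add (h2.tendsto_nhdsLT t)).congr fun s => ?_⟩
    simp [stepDensity]

/-- A sum of a nonnegative decreasing and a nonnegative increasing function satisfies the
variation constraint. -/
lemma variationConstraint_add {u v : ℝ → ℝ} (hu : Antitone u) (hv : Monotone v)
    (hu0 : ∀ t, 0 ≤ u t) (hv0 : ∀ t, 0 ≤ v t) (T : ℝ) :
    VariationConstraint (fun t => u t + v t) T := by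
  intro a b _ hab _
  -- The increments of `u + v` are dominated by those of the monotone function `v - u`, whose total
  -- increase telescopes to at most `u a + v b`.
  have key : ∀ x y, a ≤ x → x ≤ y → y ≤ b →
      edist (u y + v y) (u x + v x) ≤ ENNReal.ofReal ((v y - u y) - (v x - u x)) := by
    intro x y _ hxy _
    rw [edist_dist, Real.dist_eq]
    refine ENNReal.ofReal_le_ofReal (abs_le.2 ⟨?_, ?_⟩) <;> linarith [hu hxy, hv hxy]
  have hm : Monotone fun t => v t - u t := fun x y h => sub_le_sub (hv h) (hu h)
  refine iSup_le fun p => ?_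
  obtain ⟨n, s, hs, hmem⟩ := p
  calc ∑ i ∈ Finset.range n, edist (u (s (i + 1)) + v (s (i + 1))) (u (s i) + v (s i))
      ≤ ∑ i ∈ Finset.range n, ENNReal.ofReal
          ((v (s (i + 1)) - u (s (i + 1))) - (v (s i) - u (s i))) :=
        Finset.sum_le_sum fun i _ => key _ _ (hmem i).1.le (hs i.le_succ) (hmem (i + 1)).2.le
    _ = ENNReal.ofReal (∑ i ∈ Finset.range n,
          ((v (s (i + 1)) - u (s (i + 1))) - (v (s i) - u (s i)))) :=
        (ENNReal.ofReal_sum_of_nonneg fun i _ => sub_nonneg.2 (hm (hs i.le_succ))).symm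
    _ ≤ _ := by
        refine ENNReal.ofReal_le_ofReal ?_
        rw [Finset.sum_range_sub (fun i => v (s i) - u (s i))]
        have h1 := hm (hmem n).2.le
        have h2 := hm (hmem 0).1.le
        simp only at h1 h2
        linarith [hu0 b, hv0 a]

/-- The measure on the line belonging to `stepDensity`, with atoms at `0` and `T`. -/
noncomputable def stepMeasure (T : ℝ) (I J : Finset ℕ) (l r : ℕ → ℝ) (p q : ℝ) : Measure ℝ :=
  (∑ i ∈ I, volume.restrict (Ioo 0 (l i)) + ∑ j ∈ J, volume.restrict (Ioo (r j) T)) +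
    (ENNReal.ofReal p • Measure.dirac 0 + ENNReal.ofReal q • Measure.dirac T)

variable {T : ℝ} {I J : Finset ℕ} {l r : ℕ → ℝ} {p q : ℝ}

lemma stepMeasure_univ (hl : ∀ i ∈ I, 0 ≤ l i) (hr : ∀ j ∈ J, r j ≤ T) (hp : 0 ≤ p) (hq : 0 ≤ q) :
    stepMeasure T I J l r p q univ =
      ENNReal.ofReal (∑ i ∈ I, l i + ∑ j ∈ J, (T - r j) + p + q) := by
  have hT := Finset.sum_nonneg fun j hj => sub_nonneg.2 (hr j hj)
  have h0 := Finset.sum_nonneg hl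
  rw [ENNReal.ofReal_add (by positivity) hq, ENNReal.ofReal_add (by positivity) hp,
    ENNReal.ofReal_add h0 hT, ENNReal.ofReal_sum_of_nonneg hl,
    ENNReal.ofReal_sum_of_nonneg fun j hj => sub_nonneg.2 (hr j hj)]
  simp [stepMeasure, add_assoc]

lemma stepMeasure_compl_Icc (hT : 0 ≤ T) (hl : ∀ i ∈ I, l i ≤ T) (hr : ∀ j ∈ J, 0 ≤ r j) :
    stepMeasure T I J l r p q (Icc 0 T)ᶜ = 0 := by
  have h1 : ∀ i ∈ I, volume.restrict (Ioo 0 (l i)) (Icc 0 T)ᶜ = 0 := fun i hi => by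
    rw [Measure.restrict_apply measurableSet_Icc.compl]
    have : (Icc 0 T)ᶜ ∩ Ioo 0 (l i) = ∅ := by
      ext x
      simp only [mem_inter_iff, mem_compl_iff, mem_Icc, mem_Ioo, mem_empty_iff_false, iff_false]
      rintro ⟨h, h1, h2⟩
      exact h ⟨h1.le, h2.le.trans (hl i hi)⟩
    simp [this]
  have h2 : ∀ j ∈ J, volume.restrict (Ioo (r j) T) (Icc 0 T)ᶜ = 0 := fun j hj => by
    rw [Measure.restrict_apply measurableSet_Icc.compl]
    have : (Icc 0 T)ᶜ ∩ Ioo (r j) T = ∅ := by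
      ext x
      simp only [mem_inter_iff, mem_compl_iff, mem_Icc, mem_Ioo, mem_empty_iff_false, iff_false]
      rintro ⟨h, h1, h2⟩
      exact h ⟨(hr j hj).trans h1.le, h2.le⟩
    simp [this]
  simp only [stepMeasure, Measure.add_apply, Measure.smul_apply, Measure.finsetSum_apply]
  rw [Finset.sum_eq_zero h1, Finset.sum_eq_zero h2]
  simp [hT]

lemma stepMeasure_apply {B : Set ℝ} (hB : MeasurableSet B) (hBT : B ⊆ Ioo 0 T) :
    stepMeasure T I J l r p q B =
      ∫⁻ t in B, ENNReal.ofReal (stepDensity I J l r t : ℝ) := by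
  have e : ∀ t ∈ B, ENNReal.ofReal (stepDensity I J l r t : ℝ) =
      ∑ i ∈ I, (Ioo 0 (l i)).indicator 1 t + ∑ j ∈ J, (Ico (r j) T).indicator 1 t := by
    intro t ht
    have ht' := hBT ht
    rw [ENNReal.ofReal_natCast, stepDensity, Finset.card_filter, Finset.card_filter]
    push_cast
    congr 1 <;> refine Finset.sum_congr rfl fun i _ => ?_ <;>
      simp [indicator_apply, ht'.1, ht'.2]
  rw [setLIntegral_congr_fun hB e, lintegral_add_left, lintegral_finsetSum,
    lintegral_finsetSum]
  · have h0 : (0 : ℝ) ∉ B := fun h => (hBT h).1.false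
    have hT : T ∉ B := fun h => (hBT h).2.false
    simp only [stepMeasure, Measure.add_apply, Measure.smul_apply, Measure.finsetSum_apply,
      Measure.dirac_apply' _ hB, indicator_of_notMem h0, indicator_of_notMem hT, smul_zero,
      add_zero]
    congr 1
    · refine Finset.sum_congr rfl fun i _ => ?_
      rw [lintegral_indicator_one measurableSet_Ioo, Measure.restrict_apply measurableSet_Ioo,
        Measure.restrict_apply hB, inter_comm]
    · refine Finset.sum_congr rfl fun i _ => ?_
      rw [lintegral_indicator_one measurableSet_Ico, Measure.restrict_apply measurableSet_Ico,
        Measure.restrict_apply hB, inter_comm]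
      exact measure_congr ((Ioo_ae_eq_Ico).inter (ae_eq_refl _))
  · exact fun i _ => measurable_one.indicator measurableSet_Ico
  · exact fun i _ => measurable_one.indicator measurableSet_Ioo
  · exact Finset.measurable_sum _ fun i _ => measurable_one.indicator measurableSet_Ioo

lemma integral_stepMeasure (hl : ∀ i ∈ I, 0 ≤ l i) (hr : ∀ j ∈ J, r j ≤ T) (hp : 0 ≤ p)
    (hq : 0 ≤ q) {ψ : ℝ → ℝ} (hψ : Continuous ψ) :
    ∫ t, ψ t ∂(stepMeasure T I J l r p q) =
      (∑ i ∈ I, ∫ t in (0 : ℝ)..l i, ψ t) + (∑ j ∈ J, ∫ t in r j..T, ψ t) + (p * ψ 0 + q * ψ T) := by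
  have i1 : ∀ a b : ℝ, Integrable ψ (volume.restrict (Ioo a b)) := fun a b =>
    (hψ.integrableOn_Icc (a := a) (b := b)).mono_set Ioo_subset_Icc_self
  have i2 : ∀ a c : ℝ, Integrable ψ (ENNReal.ofReal c • Measure.dirac a) := fun a c =>
    (integrable_dirac (by simp)).smul_measure ENNReal.ofReal_ne_top
  have i3 : Integrable ψ (∑ i ∈ I, volume.restrict (Ioo 0 (l i))) :=
    integrable_finsetSum_measure.2 fun i _ => i1 _ _
  have i4 : Integrable ψ (∑ j ∈ J, volume.restrict (Ioo (r j) T)) :=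
    integrable_finsetSum_measure.2 fun i _ => i1 _ _
  rw [stepMeasure, integral_add_measure (i3.add_measure i4) ((i2 _ _).add_measure (i2 _ _)),
    integral_add_measure i3 i4, integral_add_measure (i2 _ _) (i2 _ _),
    integral_finsetSum_measure fun i _ => i1 _ _, integral_finsetSum_measure fun i _ => i1 _ _,
    integral_smul_measure, integral_smul_measure, integral_dirac, integral_dirac,
    ENNReal.toReal_ofReal hp, ENNReal.toReal_ofReal hq]
  simp only [smul_eq_mul]
  congr 2
  · refine Finset.sum_congr rfl fun i hi => ?_
    rw [intervalIntegral.integral_of_le (hl i hi), integral_Ioc_eq_integral_Ioo]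
  · refine Finset.sum_congr rfl fun i hi => ?_
    rw [intervalIntegral.integral_of_le (hr i hi), integral_Ioc_eq_integral_Ioo]

/-- Intervals starting at `0` contribute a decreasing and intervals ending at `T` an increasing step
function, which is all the variation constraint needs. The covering hypothesis `hcov` makes the
density at least one; the atoms `p` and `q` complete the mass to one. -/
lemma exists_mem_positiveIntegerLaws (hT : 0 ≤ T) (hl : ∀ i ∈ I, l i ∈ Icc 0 T)
    (hr : ∀ j ∈ J, r j ∈ Icc 0 T) (hp : 0 ≤ p) (hq : 0 ≤ q)
    (hsum : ∑ i ∈ I, l i + ∑ j ∈ J, (T - r j) + p + q = 1)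
    (hcov : ∀ t ∈ Ioo 0 T, (∃ i ∈ I, t < l i) ∨ ∃ j ∈ J, r j ≤ t) :
    ∃ G ∈ positiveIntegerLaws T, ∀ φ : BoundedContinuousFunction (WithTop ℝ) ℝ,
      ∫ x, φ x ∂(G : Measure (WithTop ℝ)) =
        (∑ i ∈ I, ∫ t in (0 : ℝ)..l i, φ (t : WithTop ℝ)) +
          (∑ j ∈ J, ∫ t in r j..T, φ (t : WithTop ℝ)) +
          (p * φ ((0 : ℝ) : WithTop ℝ) + q * φ (T : WithTop ℝ)) := by
  have hm := WithTop.measurable_coe (ι := ℝ)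
  have : IsProbabilityMeasure (stepMeasure T I J l r p q) :=
    ⟨by rw [stepMeasure_univ (fun i hi => (hl i hi).1) (fun j hj => (hr j hj).2) hp hq, hsum,
      ENNReal.ofReal_one]⟩
  have hemb : MeasurableEmbedding (fun t : ℝ => (t : WithTop ℝ)) :=
    WithTop.isOpenEmbedding_coe.measurableEmbedding
  refine ⟨⟨(stepMeasure T I J l r p q).map (fun t : ℝ => (t : WithTop ℝ)),
    Measure.isProbabilityMeasure_map hm.aemeasurable⟩, ⟨?_, ?_,
    fun t => stepDensity I J l r t, isCadlagOn_stepDensity I J l r T, ?_, ?_, ?_⟩, ?_⟩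
  · change Measure.map _ _ _ = 0
    rw [hemb.map_apply]
    convert stepMeasure_compl_Icc (I := I) (J := J) (l := l) (r := r) (p := p) (q := q) hT
      (fun i hi => (hl i hi).2) (fun j hj => (hr j hj).1) using 2
    ext x
    simp
  · change Measure.map _ _ _ = 0
    rw [hemb.map_apply]
    simp
  · intro B hB hBT
    change Measure.map _ _ _ = _
    rw [hemb.map_apply, preimage_image_eq _ hemb.injective, stepMeasure_apply hB hBT]
  · intro t ht
    refine ⟨stepDensity I J l r t, ?_, rfl⟩
    rw [stepDensity]
    rcases hcov t ht with ⟨i, hi, h⟩ | ⟨j, hj, h⟩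
    · have : 0 < (I.filter fun i => t < l i).card :=
        Finset.card_pos.2 ⟨i, Finset.mem_filter.2 ⟨hi, h⟩⟩
      omega
    · have : 0 < (J.filter fun j => r j ≤ t).card :=
        Finset.card_pos.2 ⟨j, Finset.mem_filter.2 ⟨hj, h⟩⟩
      omega
  · have := variationConstraint_add (T := T)
      (u := fun t : ℝ => ((I.filter fun i => t < l i).card : ℝ))
      (v := fun t : ℝ => ((J.filter fun j => r j ≤ t).card : ℝ))
      (fun a b h => Nat.cast_le.2 (antitone_card_filter_lt I l h))
      (fun a b h => Nat.cast_le.2 (monotone_card_filter_le J r h))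
      (fun _ => Nat.cast_nonneg _) (fun _ => Nat.cast_nonneg _)
    convert this using 2
    simp [stepDensity]
  · intro φ
    change ∫ x, φ x ∂(Measure.map _ _) = _
    rw [hemb.integral_map]
    exact integral_stepMeasure (fun i hi => (hl i hi).1) (fun j hj => (hr j hj).2) hp hq
      (φ.continuous.comp WithTop.continuous_coe)

end StepLaws

/-! ### From discrete descents with jumps to integer densities. -/

section Descent

lemma abs_integral_sub_mul_le {ψ : ℝ → ℝ} (hψ : Continuous ψ) {a b z K : ℝ} (hab : a ≤ b)
    (h : ∀ x ∈ Icc a b, |ψ x - ψ z| ≤ K) :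
    |(∫ x in a..b, ψ x) - (b - a) * ψ z| ≤ (b - a) * K := by
  have e : (∫ x in a..b, ψ x) - (b - a) * ψ z = ∫ x in a..b, (ψ x - ψ z) := by
    rw [intervalIntegral.integral_sub (hψ.intervalIntegrable _ _) (by simp),
      intervalIntegral.integral_const, smul_eq_mul]
  rw [e, ← Real.norm_eq_abs, mul_comm]
  refine (intervalIntegral.norm_integral_le_of_norm_le_const fun x hx => ?_).trans_eq
    (by rw [abs_of_nonneg (sub_nonneg.2 hab)])
  rw [uIoc_of_le hab] at hx
  exact h x (Ioc_subset_Icc_self hx)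

/-- A discrete intermediate value property. It shows that the upward jumps cover every level, and it
finds the layer containing a given point. -/
lemma exists_crossing {q : ℕ → ℝ} {n : ℕ} {s : ℝ} (h0 : q 0 ≤ s) (hn : s < q n) :
    ∃ k < n, q k ≤ s ∧ s < q (k + 1) := by
  induction n with
  | zero => exact absurd hn h0.not_gt
  | succ n ih =>
    by_cases h : s < q n
    · obtain ⟨k, hk, h'⟩ := ih h
      exact ⟨k, by omega, h'⟩
    · exact ⟨n, by omega, not_lt.1 h, hn⟩

/-- A sequence in `[0, T]` that descends at unit speed, except that it may jump up from near `0`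
or to near `T`, is close in occupation measure to a law with positive integer density. -/
lemma exists_law_of_descent {T δ : ℝ} (hT : 0 < T) {n : ℕ} {t q : ℕ → ℝ}
    (ht : ∀ k < n, t k ≤ t (k + 1)) (hδ : ∀ k < n, t (k + 1) - t k ≤ δ)
    (hq : ∀ k ≤ n, q k ∈ Icc 0 T) (h0 : q 0 = 0) (hn : q n = T) (hsum : t n - t 0 = 1 - T)
    (hstep : ∀ k < n, q k ≤ t (k + 1) - t k ∨ T - q (k + 1) ≤ t (k + 1) - t k ∨
      q (k + 1) = q k - (t (k + 1) - t k)) :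
    ∃ G ∈ positiveIntegerLaws T, ∀ (φ : BoundedContinuousFunction (WithTop ℝ) ℝ) (ε C : ℝ),
      0 ≤ ε → 0 ≤ C → (∀ x ∈ Icc 0 T, ∀ y ∈ Icc 0 T,
        |φ (x : WithTop ℝ) - φ (y : WithTop ℝ)| ≤ ε + C * |x - y|) →
      |∫ x, φ x ∂(G : Measure (WithTop ℝ)) - ((∑ k ∈ Finset.range n,
        (t (k + 1) - t k) * φ (q k : WithTop ℝ)) + ∫ x in (0 : ℝ)..T, φ (x : WithTop ℝ))| ≤
        2 * ε + 3 * (C * δ) := by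
  classical
  set d : ℕ → ℝ := fun k => t (k + 1) - t k with hd
  have hd0 : ∀ k < n, 0 ≤ d k := fun k hk => sub_nonneg.2 (ht k hk)
  have hdδ : ∀ k < n, d k ≤ δ := hδ
  have hdsum : ∑ k ∈ Finset.range n, d k = 1 - T := by
    rw [← hsum]; exact Finset.sum_range_sub t n
  have hqsum : ∑ k ∈ Finset.range n, (q (k + 1) - q k) = T := by
    rw [Finset.sum_range_sub q n, h0, hn, sub_zero]
  -- `I` collects the jumps from near `0` and `J` the remaining jumps to near `T`. Steps in neither
  -- set are pure descents and contribute nothing to the law.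
  set I := (Finset.range n).filter fun k => q k ≤ d k with hI
  set J := (Finset.range n).filter fun k => ¬ q k ≤ d k ∧ T - q (k + 1) ≤ d k with hJ
  have hql : ∀ k < n, q k ∈ Icc 0 T ∧ q (k + 1) ∈ Icc 0 T := fun k hk =>
    ⟨hq k hk.le, hq (k + 1) hk⟩
  have hnn : ∀ k < n, 0 ≤ q (k + 1) - q k + d k := by
    intro k hk
    obtain ⟨⟨h1, h2⟩, h3, h4⟩ := hql k hk
    rcases hstep k hk with h | h | h
    · change q k ≤ d k at h; linarith
    · change T - q (k + 1) ≤ d k at h; linarith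
    · change q (k + 1) = q k - d k at h; linarith
  -- A jump in `I` gives the interval from `0` to `q (k + 1)`, one in `J` the interval from `q k` to
  -- `T`. The part of the time step `d k` not needed to slide from `q k` to `0`, or from `T` to `q
  -- (k + 1)`, goes into the atom at that end.
  obtain ⟨G, hG, hGφ⟩ := exists_mem_positiveIntegerLaws (T := T) (I := I) (J := J)
    (l := fun k => q (k + 1)) (r := q) (p := ∑ k ∈ I, (d k - q k))
    (q := ∑ k ∈ J, (d k - (T - q (k + 1)))) hT.le
    (fun k hk => (hql k (Finset.mem_range.1 (Finset.mem_filter.1 hk).1)).2)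
    (fun k hk => (hql k (Finset.mem_range.1 (Finset.mem_filter.1 hk).1)).1)
    (Finset.sum_nonneg fun k hk => sub_nonneg.2 (Finset.mem_filter.1 hk).2)
    (Finset.sum_nonneg fun k hk => sub_nonneg.2 (Finset.mem_filter.1 hk).2.2)
    (by
      have : ∑ k ∈ Finset.range n, (q (k + 1) - q k + d k) = 1 := by
        rw [Finset.sum_add_distrib, hqsum, hdsum]; ring
      rw [← this]
      simp only [hI, hJ, Finset.sum_filter, ← Finset.sum_add_distrib]
      refine Finset.sum_congr rfl fun k hk => ?_
      rcases hstep k (Finset.mem_range.1 hk) with h | h | h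
      · change q k ≤ d k at h
        simp only [h, if_true, not_true_eq_false, false_and, if_false]
        ring
      · change T - q (k + 1) ≤ d k at h
        split_ifs with h1 h2 h2 <;> first | tauto | ring
      · change q (k + 1) = q k - d k at h
        split_ifs with h1 h2 h2 <;> first | tauto | (rw [h]; ring))
    (by
      intro s hs
      obtain ⟨k, hk, h1, h2⟩ := exists_crossing (q := q) (n := n) (s := s) (h0.trans_le hs.1.le)
        (hn ▸ hs.2)
      by_cases h : q k ≤ d k
      · exact Or.inl ⟨k, Finset.mem_filter.2 ⟨Finset.mem_range.2 hk, h⟩, h2⟩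
      · refine Or.inr ⟨k, Finset.mem_filter.2 ⟨Finset.mem_range.2 hk, h, ?_⟩, h1⟩
        rcases hstep k hk with h' | h' | h'
        · exact absurd h' h
        · exact h'
        · change q (k + 1) = q k - d k at h'
          linarith [hd0 k hk])
  refine ⟨G, hG, fun φ ε C hε hC hφ => ?_⟩
  set ψ : ℝ → ℝ := fun x => φ (x : WithTop ℝ) with hψ
  have hψc : Continuous ψ := φ.continuous.comp WithTop.continuous_coe
  have hii : ∀ a b : ℝ, IntervalIntegrable ψ volume a b := fun a b => hψc.intervalIntegrable a b
  have hΨ : ∑ k ∈ Finset.range n, ((∫ x in (0 : ℝ)..q (k + 1), ψ x) - ∫ x in (0 : ℝ)..q k, ψ x) =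
      ∫ x in (0 : ℝ)..T, ψ x := by
    rw [Finset.sum_range_sub fun k => ∫ x in (0 : ℝ)..q k, ψ x, h0, hn,
      intervalIntegral.integral_same, sub_zero]
  -- Contribution of step `k` to the law, minus its occupation, minus the increment of the primitive
  -- of `ψ` along `q`. Those increments telescope to the integral over `[0, T]`. The error is
  -- proportional to `d k` or to `q (k + 1) - q k + d k`, and these sum to `1 - T` and `1`.
  have key : ∀ k < n, |((if q k ≤ d k then (∫ x in (0 : ℝ)..q (k + 1), ψ x) + (d k - q k) * ψ 0
        else 0) + (if ¬ q k ≤ d k ∧ T - q (k + 1) ≤ d k then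
          (∫ x in q k..T, ψ x) + (d k - (T - q (k + 1))) * ψ T else 0)) -
      d k * ψ (q k) - ((∫ x in (0 : ℝ)..q (k + 1), ψ x) - ∫ x in (0 : ℝ)..q k, ψ x)| ≤
      2 * (d k * (ε + C * δ)) + C * δ * (q (k + 1) - q k + d k) := by
    intro k hk
    obtain ⟨⟨h1, h2⟩, h3, h4⟩ := hql k hk
    have hdk := hd0 k hk
    have hδk := hdδ k hk
    have hδ0 : 0 ≤ δ := hdk.trans hδk
    have hCδ : 0 ≤ C * δ := mul_nonneg hC hδ0
    have hn0 : 0 ≤ C * δ * (q (k + 1) - q k + d k) := mul_nonneg hCδ (hnn k hk)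
    have hX : 0 ≤ d k * (ε + C * δ) := mul_nonneg hdk (add_nonneg hε hCδ)
    have near : ∀ x ∈ Icc 0 T, ∀ y ∈ Icc 0 T, |x - y| ≤ δ → |ψ x - ψ y| ≤ ε + C * δ :=
      fun x hx y hy hxy => (hφ x hx y hy).trans (by gcongr)
    by_cases hi : q k ≤ d k
    · simp only [hi, if_true, not_true_eq_false, false_and, if_false]
      have b1 := abs_integral_sub_mul_le hψc h1 (z := q k) (K := ε + C * δ) fun x hx =>
        near x ⟨hx.1, hx.2.trans h2⟩ _ ⟨h1, h2⟩
          (abs_le.2 ⟨by linarith [hx.1], by linarith [hx.2]⟩)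
      have b2 := near 0 ⟨le_rfl, hT.le⟩ (q k) ⟨h1, h2⟩
        (by rw [zero_sub, abs_neg, abs_of_nonneg h1]; linarith)
      have b3 : |(d k - q k) * (ψ 0 - ψ (q k))| ≤ (d k - q k) * (ε + C * δ) := by
        rw [abs_mul, abs_of_nonneg (sub_nonneg.2 hi)]
        exact mul_le_mul_of_nonneg_left b2 (sub_nonneg.2 hi)
      have e : ((∫ x in (0 : ℝ)..q (k + 1), ψ x) + (d k - q k) * ψ 0 + 0) - d k * ψ (q k) -
          ((∫ x in (0 : ℝ)..q (k + 1), ψ x) - ∫ x in (0 : ℝ)..q k, ψ x) =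
          ((∫ x in (0 : ℝ)..q k, ψ x) - (q k - 0) * ψ (q k)) +
            (d k - q k) * (ψ 0 - ψ (q k)) := by ring
      rw [e]
      refine (abs_add_le _ _).trans ((add_le_add b1 b3).trans ?_)
      linarith
    · simp only [hi, if_false, not_false_eq_true, true_and]
      by_cases hj : T - q (k + 1) ≤ d k
      · simp only [hj, if_true]
        have b1 := abs_integral_sub_mul_le hψc h4 (z := T) (K := ε + C * δ) fun x hx =>
          near x ⟨h3.trans hx.1, hx.2⟩ _ ⟨hT.le, le_rfl⟩
            (abs_le.2 ⟨by linarith [hx.1], by linarith [hx.2]⟩)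
        -- Here `q k` may be far from `T`, so `ψ` need not be nearly constant between them. The
        -- affine modulus makes the error proportional to `d k * (T - q k)`, which the size of the
        -- jump pays for.
        have b2 : |d k * (ψ T - ψ (q k))| ≤
            d k * ε + C * δ * (q (k + 1) - q k + d k) := by
          have := hφ T ⟨hT.le, le_rfl⟩ (q k) ⟨h1, h2⟩
          rw [abs_of_nonneg (sub_nonneg.2 h2)] at this
          rw [abs_mul, abs_of_nonneg hdk]
          calc d k * |ψ T - ψ (q k)| ≤ d k * (ε + C * (T - q k)) :=
                mul_le_mul_of_nonneg_left this hdk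
            _ = d k * ε + C * (d k * (T - q k)) := by ring
            _ ≤ d k * ε + C * (δ * (q (k + 1) - q k + d k)) := by
                gcongr
                linarith
            _ = _ := by ring
        have e0 : (∫ x in q k..T, ψ x) = (∫ x in q (k + 1)..T, ψ x) +
            ((∫ x in (0 : ℝ)..q (k + 1), ψ x) - ∫ x in (0 : ℝ)..q k, ψ x) := by
          rw [intervalIntegral.integral_interval_sub_left (hii _ _) (hii _ _), add_comm,
            intervalIntegral.integral_add_adjacent_intervals (hii _ _) (hii _ _)]
        have e : (0 + ((∫ x in q k..T, ψ x) + (d k - (T - q (k + 1))) * ψ T)) - d k * ψ (q k) -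
            ((∫ x in (0 : ℝ)..q (k + 1), ψ x) - ∫ x in (0 : ℝ)..q k, ψ x) =
            ((∫ x in q (k + 1)..T, ψ x) - (T - q (k + 1)) * ψ T) +
              d k * (ψ T - ψ (q k)) := by rw [e0]; ring
        rw [e]
        refine (abs_add_le _ _).trans ((add_le_add b1 b2).trans ?_)
        have : (T - q (k + 1)) * (ε + C * δ) ≤ d k * (ε + C * δ) := by gcongr
        have : d k * ε ≤ d k * (ε + C * δ) := by gcongr; linarith
        linarith
      · have hk3 : q (k + 1) = q k - d k := by
          rcases hstep k hk with h | h | h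
          · exact absurd h hi
          · exact absurd h hj
          · exact h
        simp only [hj, if_false]
        have b1 := abs_integral_sub_mul_le hψc (a := q (k + 1)) (b := q k) (z := q k)
          (K := ε + C * δ) (by linarith) fun x hx =>
          near x ⟨h3.trans hx.1, hx.2.trans h2⟩ _ ⟨h1, h2⟩
            (abs_le.2 ⟨by linarith [hx.1], by linarith [hx.2]⟩)
        have e0 := intervalIntegral.integral_interval_sub_left (hii 0 (q k)) (hii 0 (q (k + 1)))
        have e1 : q k - q (k + 1) = d k := by rw [hk3]; ring
        rw [e1] at b1
        have e : (0 + 0) - d k * ψ (q k) -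
            ((∫ x in (0 : ℝ)..q (k + 1), ψ x) - ∫ x in (0 : ℝ)..q k, ψ x) =
            (∫ x in q (k + 1)..q k, ψ x) - d k * ψ (q k) := by rw [← e0]; ring
        rw [e]
        linarith
  have tot : ∫ x, φ x ∂(G : Measure (WithTop ℝ)) - ((∑ k ∈ Finset.range n,
        d k * ψ (q k)) + ∫ x in (0 : ℝ)..T, ψ x) = ∑ k ∈ Finset.range n,
      (((if q k ≤ d k then (∫ x in (0 : ℝ)..q (k + 1), ψ x) + (d k - q k) * ψ 0
        else 0) + (if ¬ q k ≤ d k ∧ T - q (k + 1) ≤ d k then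
          (∫ x in q k..T, ψ x) + (d k - (T - q (k + 1))) * ψ T else 0)) -
      d k * ψ (q k) - ((∫ x in (0 : ℝ)..q (k + 1), ψ x) - ∫ x in (0 : ℝ)..q k, ψ x)) := by
    clear_value d
    conv_rhs =>
      rw [Finset.sum_sub_distrib, Finset.sum_sub_distrib, hΨ, Finset.sum_add_distrib,
        ← Finset.sum_filter, ← Finset.sum_filter, Finset.sum_add_distrib, Finset.sum_add_distrib,
        ← Finset.sum_mul, ← Finset.sum_mul]
    rw [hGφ φ]
    ring
  rw [tot]
  refine (Finset.abs_sum_le_sum_abs _ _).trans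
    ((Finset.sum_le_sum fun k hk => key k (Finset.mem_range.1 hk)).trans ?_)
  rw [Finset.sum_add_distrib, ← Finset.mul_sum, ← Finset.mul_sum, ← Finset.sum_mul,
    Finset.sum_add_distrib, hqsum, hdsum]
  have hn1 : 0 < n := by
    rcases Nat.eq_zero_or_pos n with h | h
    · subst h; rw [h0] at hn; exact absurd hn hT.ne
    · exact h
  have : 0 ≤ C * δ := mul_nonneg hC ((hd0 0 hn1).trans (hdδ 0 hn1))
  nlinarith [mul_nonneg hT.le hε, mul_nonneg hT.le this]

end Descent

/-! ### The position process sampled on a grid. -/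

section Empirical

lemma sum_range_add_int_of_periodic {h : ℤ → ℝ} {n : ℕ} (hh : ∀ k, h (k + n) = h k) (m : ℤ) :
    ∑ k ∈ Finset.range n, h (m + k) = ∑ k ∈ Finset.range n, h k := by
  have step : ∀ m : ℤ, ∑ k ∈ Finset.range n, h (m + 1 + k) = ∑ k ∈ Finset.range n, h (m + k) := by
    intro m
    have e1 := Finset.sum_range_succ (fun k : ℕ => h (m + k)) n
    have e2 := Finset.sum_range_succ' (fun k : ℕ => h (m + k)) n
    rw [e1] at e2
    simp only [Nat.cast_zero, add_zero, hh, add_left_inj] at e2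
    rw [e2]
    refine Finset.sum_congr rfl fun k _ => ?_
    congr 1
    push_cast
    ring
  induction m using Int.induction_on with
  | zero => simp
  | succ i ih => rw [step, ih]
  | pred i ih =>
    rw [← ih, ← step (-(i : ℤ) - 1)]
    simp

/-- The occupation measure of the position process along a fine grid is close to a law with
positive integer density. -/
lemma exists_law_near_empirical {T : ℝ} (hT : 0 < T) (hT1 : T ≤ 1) {p : ℝ → ℝ} {x₀ : ℝ}
    (hp : ∀ c, p c ∈ Icc 0 T) (hper : ∀ c, p (c + 1) = p c)
    (hstep : ∀ c c', c < c' → c' < c + T →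
      p c < c' - c ∨ T - (c' - c) < p c' ∨ p c' = p c - (c' - c))
    (hx : ∀ c, c < x₀ → x₀ < c + T → p c = x₀ - c) {n : ℕ} (hn : 0 < n) (hnT : 1 / (n : ℝ) < T) :
    ∃ G ∈ positiveIntegerLaws T, ∀ (φ : BoundedContinuousFunction (WithTop ℝ) ℝ) (ε C B : ℝ),
      0 ≤ ε → 0 ≤ C → (∀ x ∈ Icc 0 T, ∀ y ∈ Icc 0 T,
        |φ (x : WithTop ℝ) - φ (y : WithTop ℝ)| ≤ ε + C * |x - y|) →
      (∀ x ∈ Icc 0 T, |φ (x : WithTop ℝ)| ≤ B) →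
      |∫ x, φ x ∂(G : Measure (WithTop ℝ)) -
        1 / (n : ℝ) * ∑ k ∈ Finset.range n, φ (p (k * (1 / (n : ℝ))) : WithTop ℝ)| ≤
        3 * ε + (4 * C + 7 * B) * (1 / (n : ℝ)) := by
  have hn' : (0 : ℝ) < n := Nat.cast_pos.2 hn
  set δ : ℝ := 1 / (n : ℝ) with hδdef
  have hδ0 : 0 < δ := by positivity
  have hnδ : n * δ = 1 := by rw [hδdef]; field_simp
  -- The grid is restarted at its last point strictly before `x₀ - 1`, where the previous full run
  -- ends. By periodicity this does not change the empirical sum.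
  set m : ℤ := ⌈(x₀ - 1) * n⌉ - 1 with hm
  set e : ℕ → ℝ := fun k => ((m : ℝ) + k) * δ with he
  have he1 : ∀ k, e (k + 1) = e k + δ := fun k => by simp only [he]; push_cast; ring
  have hen : e n = e 0 + 1 := by simp only [he]; push_cast; linear_combination hnδ
  have hemono : Monotone e := monotone_nat_of_le_succ fun k => by rw [he1]; linarith
  have he0 : e 0 < x₀ - 1 := by
    have h := Int.ceil_lt_add_one ((x₀ - 1) * (n : ℝ))
    have h' : (m : ℝ) < (x₀ - 1) * n := by rw [hm]; push_cast; linarith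
    calc e 0 = m * δ := by simp [he]
      _ < (x₀ - 1) * n * δ := mul_lt_mul_of_pos_right h' hδ0
      _ = x₀ - 1 := by rw [mul_assoc, hnδ, mul_one]
  have he0' : x₀ - 1 ≤ e 0 + δ := by
    have h := Int.le_ceil ((x₀ - 1) * (n : ℝ))
    have h' : (x₀ - 1) * n ≤ (m : ℝ) + 1 := by rw [hm]; push_cast; linarith
    calc x₀ - 1 = (x₀ - 1) * n * δ := by rw [mul_assoc, hnδ, mul_one]
      _ ≤ (m + 1) * δ := by gcongr
      _ = e 0 + δ := by simp [he]; ring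
  clear_value e
  have helt : ∀ k ≤ n, e k < x₀ := fun k hk => (hemono hk).trans_lt (by linarith)
  -- The full run over `[x₀ - T, x₀]` is cut out by clamping time to `[x₀ - 1, x₀ - T]`, which has
  -- length `1 - T`; the position is set to `0` before and to `T` after it.
  set t : ℕ → ℝ := fun k => max (x₀ - 1) (min (e k) (x₀ - T)) with ht
  set q : ℕ → ℝ := fun k => if e k < x₀ - 1 then 0 else if e k ≤ x₀ - T then p (e k) else T with hq
  have htd : ∀ k, 0 ≤ t (k + 1) - t k ∧ t (k + 1) - t k ≤ δ := by
    intro k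
    simp only [ht, he1]
    constructor <;>
    · rcases max_cases (x₀ - 1) (min (e k + δ) (x₀ - T)) with h | h <;>
      rcases max_cases (x₀ - 1) (min (e k) (x₀ - T)) with h' | h' <;>
      rcases min_cases (e k + δ) (x₀ - T) with h2 | h2 <;>
      rcases min_cases (e k) (x₀ - T) with h3 | h3 <;> linarith
  have hqmem : ∀ k, q k ∈ Icc 0 T := by
    intro k
    simp only [hq]
    split_ifs
    exacts [⟨le_rfl, hT.le⟩, hp _, ⟨hT.le, le_rfl⟩]
  obtain ⟨G, hG, hGφ⟩ := exists_law_of_descent (T := T) (δ := δ) hT (n := n) (t := t) (q := q)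
    (fun k _ => sub_nonneg.1 (htd k).1) (fun k _ => (htd k).2) (fun k _ => hqmem k)
    (by simp [hq, he0])
    (by
      simp only [hq]
      rw [if_neg (by linarith), if_neg (by linarith)])
    (by
      simp only [ht]
      rw [min_eq_right (by linarith), max_eq_right (by linarith), min_eq_left (by linarith),
        max_eq_left he0.le]
      ring)
    (by
      intro k _
      have hd := htd k
      by_cases h1 : e k < x₀ - 1
      · left
        have : q k = 0 := by simp only [hq]; rw [if_pos h1]
        rw [this]
        exact hd.1
      by_cases h2 : e (k + 1) ≤ x₀ - T
      · have h3 : e k ≤ x₀ - T := (hemono k.le_succ).trans h2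
        have h4 : ¬ e (k + 1) < x₀ - 1 := fun h => h1 ((hemono k.le_succ).trans_lt h)
        have a1 : q k = p (e k) := by simp only [hq]; rw [if_neg h1, if_pos h3]
        have a2 : q (k + 1) = p (e (k + 1)) := by simp only [hq]; rw [if_neg h4, if_pos h2]
        have a3 : t (k + 1) - t k = e (k + 1) - e k := by
          simp only [ht]
          rw [min_eq_left h2, min_eq_left h3, max_eq_right (not_lt.1 h1),
            max_eq_right (not_lt.1 h4)]
        rw [a1, a2, a3]
        have h5 := he1 k
        rcases hstep (e k) (e (k + 1)) (by linarith) (by linarith) with h | h | h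
        · exact Or.inl h.le
        · exact Or.inr (Or.inl (by linarith))
        · exact Or.inr (Or.inr h)
      · right; left
        have : q (k + 1) = T := by
          simp only [hq]
          rw [if_neg (by linarith), if_neg h2]
        rw [this, sub_self]
        exact hd.1)
  refine ⟨G, hG, fun φ ε C B hε hC hφ hB => ?_⟩
  have h1 := hGφ φ ε C hε hC hφ
  set ψ : ℝ → ℝ := fun x => φ (x : WithTop ℝ) with hψ
  have hψc : Continuous ψ := φ.continuous.comp WithTop.continuous_coe
  have hB0 : 0 ≤ B := (abs_nonneg _).trans (hB 0 ⟨le_rfl, hT.le⟩)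
  have hCδ : 0 ≤ C * δ := mul_nonneg hC hδ0.le
  have hemp : ∑ k ∈ Finset.range n, ψ (p (k * δ)) = ∑ k ∈ Finset.range n, ψ (p (e k)) := by
    have := sum_range_add_int_of_periodic (h := fun k : ℤ => ψ (p (k * δ))) (n := n)
      (fun k => by
        have : ((k + n : ℤ) : ℝ) * δ = k * δ + 1 := by push_cast; linear_combination hnδ
        simp only [this, hper]) m
    simp only [Int.cast_natCast] at this
    rw [← this]
    refine Finset.sum_congr rfl fun k _ => ?_
    simp only [he]
    push_cast
    rfl
  set r : ℕ → ℝ := fun k => max (e k) (x₀ - T) with hr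
  have hψr : Continuous fun c => ψ (x₀ - c) := hψc.comp (continuous_const.sub continuous_id)
  -- The uniform measure on `[0, T]` is the occupation of the full run; it is split along the grid
  -- to be compared with the samples taken there.
  have hrun : (∫ x in (0 : ℝ)..T, ψ x) = (∑ k ∈ Finset.range n,
      ∫ c in r k..r (k + 1), ψ (x₀ - c)) + ∫ c in e n..x₀, ψ (x₀ - c) := by
    rw [intervalIntegral.sum_integral_adjacent_intervals fun k _ => hψr.intervalIntegrable _ _]
    have a1 : r 0 = x₀ - T := max_eq_right (by linarith)
    have a2 : r n = e n := max_eq_left (by linarith)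
    rw [a2, intervalIntegral.integral_add_adjacent_intervals (hψr.intervalIntegrable _ _)
      (hψr.intervalIntegrable _ _), a1, intervalIntegral.integral_comp_sub_left]
    simp
  -- `χ` grows by at least one in a step that crosses `x₀ - 1` or `x₀ - T`, where only the crude
  -- bound `3 * (δ * B)` is available. Its total growth is at most two; with the last piece from `e
  -- n` to `x₀` this yields the constant `7`.
  set χ : ℕ → ℝ := fun k => (if x₀ - T < e k then 1 else 0) + (if x₀ - 1 ≤ e k then 1 else 0)
    with hχ
  have hχd : ∀ k, 0 ≤ χ (k + 1) - χ k := by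
    intro k
    have := hemono k.le_succ
    simp only [hχ, Nat.succ_eq_add_one] at this ⊢
    split_ifs <;> linarith
  have hbd : ∀ a b, x₀ - T ≤ a → a ≤ b → b ≤ x₀ → b - a ≤ δ →
      |∫ c in a..b, ψ (x₀ - c)| ≤ δ * B := by
    intro a b ha hab hb hd
    rw [← Real.norm_eq_abs]
    refine (intervalIntegral.norm_integral_le_of_norm_le_const (C := B) fun x hx => ?_).trans ?_
    · rw [uIoc_of_le hab] at hx
      exact hB _ ⟨by linarith [hx.2], by linarith [hx.1]⟩
    · rw [abs_of_nonneg (sub_nonneg.2 hab), mul_comm]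
      gcongr
  have key : ∀ k < n, |((t (k + 1) - t k) * ψ (q k) + ∫ c in r k..r (k + 1), ψ (x₀ - c)) -
      δ * ψ (p (e k))| ≤ δ * (ε + C * δ) + 3 * (δ * B) * (χ (k + 1) - χ k) := by
    intro k hk
    have hd := htd k
    have hrk : x₀ - T ≤ r k ∧ r k ≤ r (k + 1) ∧ r (k + 1) - r k ≤ δ ∧ r (k + 1) ≤ x₀ := by
      have := he1 k
      refine ⟨le_max_right _ _, max_le_max_right _ (hemono k.le_succ), ?_,
        max_le (helt _ hk).le (by linarith)⟩
      have : r (k + 1) ≤ r k + δ := by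
        refine max_le ?_ ?_
        · rw [he1]; gcongr; exact le_max_left _ _
        · linarith [le_max_right (e k) (x₀ - T)]
      linarith
    have hpos : 0 ≤ δ * (ε + C * δ) := by positivity
    have hpos' : 0 ≤ 3 * (δ * B) * (χ (k + 1) - χ k) :=
      mul_nonneg (by positivity) (hχd k)
    have crude : 1 ≤ χ (k + 1) - χ k →
        |((t (k + 1) - t k) * ψ (q k) + ∫ c in r k..r (k + 1), ψ (x₀ - c)) -
          δ * ψ (p (e k))| ≤ δ * (ε + C * δ) + 3 * (δ * B) * (χ (k + 1) - χ k) := by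
      intro h
      have b1 : |(t (k + 1) - t k) * ψ (q k)| ≤ δ * B := by
        rw [abs_mul, abs_of_nonneg hd.1]
        exact mul_le_mul hd.2 (hB _ (hqmem k)) (abs_nonneg _) hδ0.le
      have b2 : |δ * ψ (p (e k))| ≤ δ * B := by
        rw [abs_mul, abs_of_nonneg hδ0.le]
        exact mul_le_mul_of_nonneg_left (hB _ (hp _)) hδ0.le
      have b3 := hbd _ _ hrk.1 hrk.2.1 hrk.2.2.2 hrk.2.2.1
      have b4 : 3 * (δ * B) * 1 ≤ 3 * (δ * B) * (χ (k + 1) - χ k) := by gcongr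
      refine (abs_sub _ _).trans ?_
      have := abs_add_le ((t (k + 1) - t k) * ψ (q k)) (∫ c in r k..r (k + 1), ψ (x₀ - c))
      linarith
    by_cases c1 : e k < x₀ - 1
    · refine crude ?_
      have : x₀ - 1 ≤ e (k + 1) := by
        rw [he1]; linarith [hemono k.zero_le]
      have c2 : ¬ x₀ - T < e k := by linarith
      simp only [hχ]
      rw [if_pos this, if_neg c2, if_neg c1.not_ge]
      split_ifs <;> norm_num
    have c1' := not_lt.1 c1
    have c1'' : x₀ - 1 ≤ e (k + 1) := c1'.trans (hemono k.le_succ)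
    by_cases c2 : x₀ - T < e k
    · have c3 : x₀ - T < e (k + 1) := c2.trans_le (hemono k.le_succ)
      have a1 : t (k + 1) - t k = 0 := by
        simp only [ht]
        rw [min_eq_right c2.le, min_eq_right c3.le, sub_self]
      have a2 : r k = e k := max_eq_left c2.le
      have a3 : r (k + 1) = e (k + 1) := max_eq_left c3.le
      have a4 : p (e k) = x₀ - e k := hx _ (helt k hk.le) (by linarith)
      rw [a1, a2, a3, a4, zero_mul, zero_add]
      have h5 := he1 k
      have := abs_integral_sub_mul_le hψr (a := e k) (b := e (k + 1)) (z := e k)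
        (K := ε + C * δ) (by linarith) fun x hx => by
          have h6 := helt (k + 1) hk
          refine (hφ _ ⟨by linarith [hx.2], by linarith [hx.1]⟩ _
            ⟨by linarith [hx.2, hx.1], by linarith⟩).trans ?_
          gcongr
          rw [abs_le]
          exact ⟨by linarith [hx.2], by linarith [hx.1]⟩
      have h7 : e (k + 1) - e k = δ := by linarith
      rw [h7] at this
      linarith
    by_cases c3 : x₀ - T < e (k + 1)
    · refine crude ?_
      simp only [hχ]
      rw [if_pos c3, if_neg c2, if_pos c1', if_pos c1'']
      norm_num
    · have c2' := not_lt.1 c2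
      have c3' := not_lt.1 c3
      have a1 : t (k + 1) - t k = δ := by
        simp only [ht]
        rw [min_eq_left c2', min_eq_left c3', max_eq_right c1', max_eq_right c1'']
        linarith [he1 k]
      have a2 : r k = x₀ - T := max_eq_right c2'
      have a3 : r (k + 1) = x₀ - T := max_eq_right c3'
      have a4 : q k = p (e k) := by simp only [hq]; rw [if_neg c1, if_pos c2']
      rw [a1, a2, a3, a4, intervalIntegral.integral_same, add_zero, sub_self, abs_zero]
      linarith
  have h2 : |((∑ k ∈ Finset.range n, (t (k + 1) - t k) * ψ (q k)) + ∫ x in (0 : ℝ)..T, ψ x) -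
      δ * ∑ k ∈ Finset.range n, ψ (p (k * δ))| ≤ (ε + C * δ) + 7 * (δ * B) := by
    rw [hemp, hrun, ← add_assoc, ← Finset.sum_add_distrib, add_sub_right_comm, Finset.mul_sum,
      ← Finset.sum_sub_distrib]
    have b1 := (Finset.abs_sum_le_sum_abs _ _).trans
      (Finset.sum_le_sum fun k hk => key k (Finset.mem_range.1 hk))
    rw [Finset.sum_add_distrib, Finset.sum_const, Finset.card_range, nsmul_eq_mul, ← mul_assoc,
      hnδ, one_mul, ← Finset.mul_sum, Finset.sum_range_sub χ] at b1
    have b2 := hbd (e n) x₀ (by linarith) (by linarith) le_rfl (by linarith)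
    have b3 : χ n - χ 0 ≤ 2 := by
      simp only [hχ]
      split_ifs <;> norm_num
    have b4 : 3 * (δ * B) * (χ n - χ 0) ≤ 3 * (δ * B) * 2 := by gcongr
    refine (abs_add_le _ _).trans ?_
    linarith
  calc _ ≤ _ + _ := abs_sub_le _ ((∑ k ∈ Finset.range n, (t (k + 1) - t k) * ψ (q k)) +
        ∫ x in (0 : ℝ)..T, ψ x) _
    _ ≤ _ := add_le_add h1 h2
    _ = _ := by ring

end Empirical

/-! ### Averages and closed convex hulls in the weak topology. -/

section Closure

/-- Finite sets of test functions with tolerances are a neighbourhood basis of the weak topology. -/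
lemma mem_closure_of_forall_integral {Ω : Type*} [MeasurableSpace Ω] [TopologicalSpace Ω]
    [OpensMeasurableSpace Ω] {S : Set (FiniteMeasure Ω)} {μ : FiniteMeasure Ω}
    (h : ∀ (s : Finset (Ω →ᵇ ℝ)) (ε : ℝ), 0 < ε → ∃ ν ∈ S, ∀ φ ∈ s,
      |∫ x, φ x ∂(ν : Measure Ω) - ∫ x, φ x ∂(μ : Measure Ω)| ≤ ε) : μ ∈ closure S := by
  classical
  -- The approximations form a net indexed by a finite set of test functions and a tolerance, both
  -- improving.
  choose ν hνS hν using fun i : Finset (Ω →ᵇ ℝ) × ℕ => h i.1 (1 / ((i.2 : ℝ) + 1)) (by positivity)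
  refine mem_closure_of_tendsto (f := ν) (b := atTop) ?_ (Eventually.of_forall hνS)
  rw [FiniteMeasure.tendsto_iff_forall_integral_tendsto]
  intro φ
  rw [tendsto_iff_norm_sub_tendsto_zero]
  have h0 : Tendsto (fun i : Finset (Ω →ᵇ ℝ) × ℕ => 1 / ((i.2 : ℝ) + 1)) atTop (𝓝 0) := by
    rw [← prod_atTop_atTop_eq]
    exact tendsto_one_div_add_atTop_nhds_zero_nat.comp tendsto_snd
  refine tendsto_of_tendsto_of_tendsto_of_le_of_le' tendsto_const_nhds h0
    (Eventually.of_forall fun _ => norm_nonneg _) ?_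
  filter_upwards [eventually_ge_atTop ({φ}, 0)] with i hi
  exact hν i φ (hi.1 (Finset.mem_singleton_self φ))

/-- A finite measure whose integrals are averages of approximate integrals against members of a
set of measures lies in the closed convex hull of this set. -/
lemma mem_closure_convexHull_of_average {Ω E : Type*} [MeasurableSpace Ω] {P : Measure Ω}
    [IsProbabilityMeasure P] [MeasurableSpace E] [TopologicalSpace E] [OpensMeasurableSpace E]
    {S : Set (FiniteMeasure E)} {μ : FiniteMeasure E}
    (h : ∀ (s : Finset (E →ᵇ ℝ)) (ε : ℝ), 0 < ε → ∃ v : Ω → (E →ᵇ ℝ) → ℝ,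
      (∀ φ, Integrable (fun ω => v ω φ) P) ∧
      (∀ φ, ∫ ω, v ω φ ∂P = ∫ x, φ x ∂(μ : Measure E)) ∧
      ∀ ω, ∃ ν ∈ S, ∀ φ ∈ s, |∫ x, φ x ∂(ν : Measure E) - v ω φ| ≤ ε) :
    μ ∈ closure (convexHull ℝ≥0 S) := by
  refine mem_closure_of_forall_integral fun s ε hε => ?_
  obtain ⟨v, hv, hvμ, hvS⟩ := h s (ε / 2) (by positivity)
  set Φ : FiniteMeasure E → s → ℝ := fun ν φ => ∫ x, φ.1 x ∂(ν : Measure E) with hΦ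
  have hint : ∀ (ν : FiniteMeasure E) (φ : E →ᵇ ℝ), Integrable φ (ν : Measure E) :=
    fun ν φ => φ.integrable _
  have hconv : Convex ℝ (Φ '' convexHull ℝ≥0 S) := by
    rintro _ ⟨ν₁, h₁, rfl⟩ _ ⟨ν₂, h₂, rfl⟩ a b ha hb hab
    lift a to ℝ≥0 using ha
    lift b to ℝ≥0 using hb
    refine ⟨a • ν₁ + b • ν₂, convex_convexHull ℝ≥0 S h₁ h₂ zero_le zero_le
      (by exact_mod_cast hab), ?_⟩
    ext φ
    simp only [hΦ, FiniteMeasure.toMeasure_add, FiniteMeasure.toMeasure_smul, Pi.add_apply,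
      Pi.smul_apply, smul_eq_mul]
    rw [integral_add_measure ((hint ν₁ φ.1).smul_measure_nnreal)
      ((hint ν₂ φ.1).smul_measure_nnreal), integral_smul_nnreal_measure,
      integral_smul_nnreal_measure]
    rfl
  -- For finitely many test functions the problem is finite-dimensional: the random vector stays in
  -- a closed convex thickening, hence so does its mean.
  have hmem : ∀ ω, (fun φ : s => v ω φ.1) ∈ Metric.cthickening (ε / 2) (Φ '' convexHull ℝ≥0 S) := by
    intro ω
    obtain ⟨ν, hνS, hν⟩ := hvS ω
    refine Metric.mem_cthickening_of_dist_le _ (Φ ν) _ _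
      (mem_image_of_mem _ (subset_convexHull _ _ hνS)) ?_
    rw [dist_comm]
    exact (dist_pi_le_iff (by positivity)).2 fun φ => hν φ.1 φ.2
  have hi : Integrable (fun ω => fun φ : s => v ω φ.1) P := Integrable.of_eval fun φ => hv φ.1
  have := Convex.integral_mem (hconv.cthickening _) Metric.isClosed_cthickening
    (ae_of_all P hmem) hi
  have e : ∫ ω, (fun φ : s => v ω φ.1) ∂P = Φ μ := by
    ext φ
    rw [eval_integral (f := fun ω => fun φ : s => v ω φ.1) (fun φ => hv φ.1), hvμ]
  rw [e] at this
  have := Metric.cthickening_subset_thickening' hε (half_lt_self hε) _ this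
  obtain ⟨_, ⟨ν, hν, rfl⟩, hd⟩ := Metric.mem_thickening_iff.1 this
  refine ⟨ν, hν, fun φ hφ => ?_⟩
  rw [dist_comm, dist_pi_lt_iff hε] at hd
  exact (hd ⟨φ, hφ⟩).le

end Closure

/-! ### Invariant location functionals: laws lie in the hull. -/

section LawsOfLocations

variable {H : PathClass} {L : H.Path → CompactInterval → WithTop ℝ} {T : ℝ}

lemma CompactInterval.shift_window (hT : 0 < T) (c : ℝ) :
    (⟨c, c + T, lt_add_of_pos_right c hT⟩ : CompactInterval).shift c =
      CompactInterval.zeroTo T hT := by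
  simp [CompactInterval.shift, CompactInterval.zeroTo]

/-- The position of the location within the window `[c, c + T]`. -/
noncomputable def locationPosition (L : H.Path → CompactInterval → WithTop ℝ) (hT : 0 < T)
    (g : H.Path) (c : ℝ) : ℝ :=
  (L (H.shift c g) (CompactInterval.zeroTo T hT)).untopD 0

lemma IsInvariantLocation.coe_locationPosition (hL : IsInvariantLocation H L) (hT : 0 < T)
    (g : H.Path) (c : ℝ) :
    L (H.shift c g) (CompactInterval.zeroTo T hT) = (locationPosition L hT g c : WithTop ℝ) := by
  obtain ⟨x, hx⟩ := WithTop.ne_top_iff_exists.1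
    (hL.ne_top (H.shift c g) (CompactInterval.zeroTo T hT))
  simp [locationPosition, ← hx]

lemma IsInvariantLocation.locationPosition_mem (hL : IsInvariantLocation H L) (hT : 0 < T)
    (g : H.Path) (c : ℝ) : locationPosition L hT g c ∈ Icc 0 T := by
  rcases hL.mem (H.shift c g) (CompactInterval.zeroTo T hT) with h | ⟨t, ht, h⟩
  · exact absurd h (hL.ne_top _ _)
  · rw [hL.coe_locationPosition hT g c, WithTop.coe_inj] at h
    rw [h]
    exact ht

lemma IsInvariantLocation.apply_window (hL : IsInvariantLocation H L) (hT : 0 < T)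
    (g : H.Path) (c : ℝ) :
    L g ⟨c, c + T, lt_add_of_pos_right c hT⟩ = ((locationPosition L hT g c + c : ℝ) : WithTop ℝ) := by
  rw [hL.shift_compat g _ c, CompactInterval.shift_window hT, hL.coe_locationPosition hT g c]
  rfl

lemma locationPosition_add_one (hT : 0 < T) (g : H.Path) (c : ℝ) :
    locationPosition L hT g (c + 1) = locationPosition L hT g c := by
  have : H.shift (c + 1) g = H.shift c g := by
    apply Subtype.ext
    funext x
    change g.1 (x + (c + 1)) = g.1 (x + c)
    rw [← add_assoc]
    exact H.periodic g.1 g.2 _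
  rw [locationPosition, this, locationPosition]

/-- If the locations of both windows lie in the overlap, stability identifies each with the location
of the overlap, so the position just shifts. Otherwise the old location was left behind on the left
or the new one entered on the right. -/
lemma IsInvariantLocation.locationPosition_step (hL : IsInvariantLocation H L) (hT : 0 < T)
    (g : H.Path) {c c' : ℝ} (h : c < c') (h' : c' < c + T) :
    locationPosition L hT g c < c' - c ∨ T - (c' - c) < locationPosition L hT g c' ∨
      locationPosition L hT g c' = locationPosition L hT g c - (c' - c) := by
  by_contra! hcon
  obtain ⟨h1, h2, h3⟩ := hcon
  have m1 := hL.locationPosition_mem hT g c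
  have m2 := hL.locationPosition_mem hT g c'
  have e1 := hL.stable g ⟨c, c + T, lt_add_of_pos_right c hT⟩ ⟨c', c + T, h'⟩
    (Icc_subset_Icc_left h.le) ⟨locationPosition L hT g c + c,
      ⟨by simp only; linarith, by simp only; linarith [m1.2]⟩, hL.apply_window hT g c⟩
  have e2 := hL.stable g ⟨c', c' + T, lt_add_of_pos_right c' hT⟩ ⟨c', c + T, h'⟩
    (Icc_subset_Icc_right (by simp only; linarith)) ⟨locationPosition L hT g c' + c',
      ⟨by simp only; linarith [m2.1], by simp only; linarith⟩, hL.apply_window hT g c'⟩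
  rw [e1, hL.apply_window hT, hL.apply_window hT, WithTop.coe_inj] at e2
  exact h3 (by linarith)

/-- The locations in `[c, c + 1]` and `[0, 1]` agree modulo one, and for `x₀` interior to `[c, c +
1]` this forces equality. Stability passes to the shorter window, as `T ≤ 1`. -/
lemma IsInvariantLocation.exists_global (hL : IsInvariantLocation H L) (hT : 0 < T) (hT1 : T ≤ 1)
    (g : H.Path) : ∃ x₀ : ℝ, ∀ c, c < x₀ → x₀ < c + T → locationPosition L hT g c = x₀ - c := by
  have huniq : ∀ a : ℝ, ∃ y ∈ Icc a (a + 1), L g (CompactInterval.unitFrom a) = (y : WithTop ℝ) := by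
    intro a
    rcases hL.mem g (CompactInterval.unitFrom a) with h | ⟨t, ht, h⟩
    · exact absurd h (hL.ne_top _ _)
    · exact ⟨t, ht, h⟩
  obtain ⟨x₀, -, hx₀⟩ := huniq 0
  refine ⟨x₀, fun c hc hc' => ?_⟩
  obtain ⟨y, hy, hya⟩ := huniq c
  obtain ⟨k, hk⟩ := hL.invariant g c
  rw [hx₀, hya, ← WithTop.coe_add, WithTop.coe_inj] at hk
  have hk0 : k = 0 := by
    have h1 : (k : ℝ) < 1 := by linarith [hy.1]
    have h2 : (-1 : ℝ) < k := by linarith [hy.2]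
    have h1' : k < 1 := by exact_mod_cast h1
    have h2' : -1 < k := by exact_mod_cast h2
    omega
  rw [hk0, Int.cast_zero, add_zero] at hk
  subst hk
  have := hL.stable g (CompactInterval.unitFrom c) ⟨c, c + T, lt_add_of_pos_right c hT⟩
    (Icc_subset_Icc_right (by simp only [CompactInterval.unitFrom]; linarith))
    ⟨x₀, ⟨hc.le, hc'.le⟩, hya⟩
  rw [hya, hL.apply_window hT, WithTop.coe_inj] at this
  linarith

/-- Stationarity is an identity of laws on all functions, while `L` lives on the possibly
non-measurable class `H`. This is harmless because measurable sets of the subtype are traces of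
measurable sets. -/
lemma map_eq_map_of_subtype {Ω β : Type*} [MeasurableSpace Ω] [MeasurableSpace β] {P : Measure Ω}
    {α : Type*} [MeasurableSpace α] {s : Set α} {Y Y' : Ω → α} (hY : Measurable Y)
    (hY' : Measurable Y') (hs : ∀ ω, Y ω ∈ s) (hs' : ∀ ω, Y' ω ∈ s) (h : P.map Y = P.map Y')
    {f : s → β} (hf : Measurable f) :
    P.map (fun ω => f ⟨Y ω, hs ω⟩) = P.map (fun ω => f ⟨Y' ω, hs' ω⟩) := by
  ext B hB
  obtain ⟨A, hA, hAB⟩ := hf hB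
  have m1 : Measurable fun ω => f ⟨Y ω, hs ω⟩ := hf.comp (hY.subtype_mk (h := hs))
  have m2 : Measurable fun ω => f ⟨Y' ω, hs' ω⟩ := hf.comp (hY'.subtype_mk (h := hs'))
  rw [Measure.map_apply m1 hB, Measure.map_apply m2 hB]
  have e : ∀ (Z : Ω → α) (hZ : ∀ ω, Z ω ∈ s), (fun ω => f ⟨Z ω, hZ ω⟩) ⁻¹' B = Z ⁻¹' A := by
    intro Z hZ
    ext ω
    have := Set.ext_iff.1 hAB ⟨Z ω, hZ ω⟩
    exact this.symm
  rw [e, e, ← Measure.map_apply hY hA, ← Measure.map_apply hY' hA, h]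

/-- An affine modulus, unlike plain uniform continuity, gives errors proportional to displacement,
which can be summed over jumps. Beyond the uniform continuity scale `η` the trivial bound `2 * B` is
at most `2 * B / η` times the distance. -/
lemma exists_modulus {ψ : ℝ → ℝ} (hψ : Continuous ψ) {B : ℝ} (hB : ∀ x, |ψ x| ≤ B) (T : ℝ) {ε : ℝ}
    (hε : 0 < ε) : ∃ C, 0 ≤ C ∧ ∀ x ∈ Icc 0 T, ∀ y ∈ Icc 0 T, |ψ x - ψ y| ≤ ε + C * |x - y| := by
  have huc := isCompact_Icc.uniformContinuousOn_of_continuous (hψ.continuousOn (s := Icc 0 T))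
  obtain ⟨η, hη, h⟩ := Metric.uniformContinuousOn_iff.1 huc ε hε
  have hB0 : 0 ≤ B := (abs_nonneg _).trans (hB 0)
  refine ⟨2 * B / η, by positivity, fun x hx y hy => ?_⟩
  by_cases hxy : |x - y| < η
  · have := h x hx y hy hxy
    rw [Real.dist_eq] at this
    have : 0 ≤ 2 * B / η * |x - y| := by positivity
    linarith
  · have h1 : 2 * B ≤ 2 * B / η * |x - y| := by
      rw [div_mul_eq_mul_div, le_div_iff₀ hη]
      exact mul_le_mul_of_nonneg_left (not_lt.1 hxy) (by positivity)
    have h2 := abs_sub (ψ x) (ψ y)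
    linarith [hB x, hB y]

/-- Laws of invariant intrinsic location functionals lie in the closed convex hull. -/
lemma IsInvariantLocation.locationLaws_subset (hL : IsInvariantLocation H L) (R : Set (ℝ → ℝ))
    (hT : 0 < T) (hT1 : T ≤ 1) :
    locationLaws H L R T hT ⊆ weakConvexHull (positiveIntegerLaws T) := by
  rintro F ⟨Ω, mΩ, P, hP, X, hX, hXs, -, hF⟩
  set Y : Ω → H.Path := fun ω => ⟨fun t => X t ω, hX ω⟩ with hY
  have hmeas : ∀ c, Measurable fun ω => (fun t : ℝ => X (t + c) ω) := fun c =>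
    measurable_pi_iff.2 fun t => hXs.measurable (t + c)
  have hmeas0 : Measurable fun ω => (fun t : ℝ => X t ω) :=
    measurable_pi_iff.2 fun t => hXs.measurable t
  have hlaw : ∀ c, P.map (fun ω => L (H.shift c (Y ω)) (CompactInterval.zeroTo T hT)) =
      (F : Measure (WithTop ℝ)) := by
    intro c
    rw [hF]
    exact map_eq_map_of_subtype (hmeas c) hmeas0 (fun ω => H.shift_mem _ (hX ω) c) hX
      (hXs.stationary c) (hL.measurable _)
  have hLm : ∀ c, Measurable fun ω => L (H.shift c (Y ω)) (CompactInterval.zeroTo T hT) := fun c =>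
    (hL.measurable (CompactInterval.zeroTo T hT)).comp
      ((hmeas c).subtype_mk (h := fun ω => H.shift_mem _ (hX ω) c))
  refine mem_closure_convexHull_of_average (P := P) fun s ε hε => ?_
  have hmod : ∀ φ : (WithTop ℝ) →ᵇ ℝ, ∃ C, 0 ≤ C ∧ ∀ x ∈ Icc 0 T, ∀ y ∈ Icc 0 T,
      |φ (x : WithTop ℝ) - φ (y : WithTop ℝ)| ≤ ε / 6 + C * |x - y| := fun φ =>
    exists_modulus (φ.continuous.comp WithTop.continuous_coe) (B := ‖φ‖)
      (fun x => φ.norm_coe_le_norm _) T (by positivity)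
  choose C hC0 hC using hmod
  have hev : ∀ᶠ n : ℕ in atTop, 0 < n ∧ 1 / (n : ℝ) < T ∧
      ∀ φ ∈ s, 3 * (ε / 6) + (4 * C φ + 7 * ‖φ‖) * (1 / (n : ℝ)) ≤ ε := by
    refine (eventually_gt_atTop 0).and (((tendsto_one_div_atTop_nhds_zero_nat (𝕜 := ℝ)).eventually
      (eventually_lt_nhds hT)).and ?_)
    rw [Finset.eventually_all]
    intro φ _
    have : Tendsto (fun n : ℕ => 3 * (ε / 6) + (4 * C φ + 7 * ‖φ‖) * (1 / (n : ℝ))) atTop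
        (𝓝 (3 * (ε / 6) + (4 * C φ + 7 * ‖φ‖) * 0)) :=
      ((tendsto_one_div_atTop_nhds_zero_nat (𝕜 := ℝ)).const_mul _).const_add _
    exact (this.eventually (eventually_lt_nhds (by linarith))).mono fun _ h => h.le
  obtain ⟨n, hn, hnT, hns⟩ := hev.exists
  -- The empirical integrals of one path: every summand has law `F` by stationarity, so the mean is
  -- exact, and for each `ω` they are close to the integrals of a single generator.
  refine ⟨fun ω φ => 1 / (n : ℝ) * ∑ k ∈ Finset.range n,
    φ (L (H.shift (k * (1 / (n : ℝ))) (Y ω)) (CompactInterval.zeroTo T hT)), ?_, ?_, ?_⟩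
  · intro φ
    refine (integrable_finsetSum _ fun k _ => ?_).const_mul _
    exact (φ.integrable _).comp_measurable (hLm _)
  · intro φ
    have hi : ∀ k : ℕ, Integrable (fun ω => φ (L (H.shift (k * (1 / (n : ℝ))) (Y ω))
        (CompactInterval.zeroTo T hT))) P := fun k => (φ.integrable _).comp_measurable (hLm _)
    have he : ∀ c : ℝ, ∫ ω, φ (L (H.shift c (Y ω)) (CompactInterval.zeroTo T hT)) ∂P =
        ∫ x, φ x ∂(F : Measure (WithTop ℝ)) := fun c => by
      rw [← hlaw c, integral_map (hLm c).aemeasurable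
        φ.continuous.measurable.aestronglyMeasurable]
    rw [integral_const_mul, integral_finsetSum _ fun k _ => hi k]
    simp only [he, Finset.sum_const, Finset.card_range, nsmul_eq_mul]
    rw [← mul_assoc, one_div_mul_cancel (Nat.cast_ne_zero.2 hn.ne'), one_mul]
    rfl
  · intro ω
    obtain ⟨x₀, hx₀⟩ := hL.exists_global hT hT1 (Y ω)
    obtain ⟨G, hG, hGφ⟩ := exists_law_near_empirical hT hT1
      (hL.locationPosition_mem hT (Y ω)) (locationPosition_add_one hT (Y ω))
      (fun c c' h h' => hL.locationPosition_step hT (Y ω) h h') hx₀ hn hnT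
    refine ⟨G.toFiniteMeasure, mem_image_of_mem _ hG, fun φ hφ => ?_⟩
    have := hGφ φ (ε / 6) (C φ) ‖φ‖ (by positivity) (hC0 φ) (hC φ)
      fun x _ => φ.norm_coe_le_norm _
    simp only [← hL.coe_locationPosition hT (Y ω)] at this
    exact this.trans (hns φ hφ)

end LawsOfLocations

/-! ### Jordan decomposition with natural values. -/

section MonotoneDecomposition

/-- `PositiveVariation f t n` says that `n` is the sum of the upward increments of `f` along a
finite increasing sequence of positive times ending at `t`. -/
inductive PositiveVariation (f : ℝ → ℕ) : ℝ → ℕ → Prop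
  | base (t : ℝ) (ht : 0 < t) : PositiveVariation f t 0
  | step (s t : ℝ) (n : ℕ) (h : PositiveVariation f s n) (hst : s ≤ t) :
      PositiveVariation f t (n + (f t - f s))

/-- Twice a positive part is the absolute value plus the signed value; truncated subtraction is
exactly the positive part. Summation gives twice the positive variation as at most the total
variation plus `f t - f s`. -/
lemma PositiveVariation.two_mul_le {f : ℝ → ℕ} {T t : ℝ} {n : ℕ} (h : PositiveVariation f t n)
    (hT : t < T) (hV : ∀ s t, 0 < s → s ≤ t → t < T →
      eVariationOn (fun x => (f x : ℝ)) (Icc s t) ≤ ENNReal.ofReal (f s + f t)) :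
    ∃ s, 0 < s ∧ s ≤ t ∧ ENNReal.ofReal (2 * n + f s) ≤
      eVariationOn (fun x => (f x : ℝ)) (Icc s t) + ENNReal.ofReal (f t) := by
  induction h with
  | base t ht => exact ⟨t, ht, le_rfl, by simp⟩
  | step s t n h hst ih =>
    obtain ⟨r, hr, hrs, ih⟩ := ih (hst.trans_lt hT)
    refine ⟨r, hr, hrs.trans hst, ?_⟩
    have hadd : eVariationOn (fun x => (f x : ℝ)) (Icc r s) +
        eVariationOn (fun x => (f x : ℝ)) (Icc s t) =
        eVariationOn (fun x => (f x : ℝ)) (Icc r t) := by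
      have := eVariationOn.Icc_add_Icc (fun x => (f x : ℝ)) (s := univ) hrs hst (mem_univ s)
      simpa using this
    have hed := eVariationOn.edist_le (fun x => (f x : ℝ)) (s := Icc s t) (x := t) (y := s)
      ⟨hst, le_rfl⟩ ⟨le_rfl, hst⟩
    have hfin : eVariationOn (fun x => (f x : ℝ)) (Icc r s) ≠ ⊤ :=
      ((hV r s hr hrs (hst.trans_lt hT)).trans_lt ENNReal.ofReal_lt_top).ne
    lift eVariationOn (fun x => (f x : ℝ)) (Icc r s) to ℝ≥0 using hfin with V
    rw [edist_dist, Real.dist_eq] at hed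
    rw [← hadd]
    refine le_trans ?_ (add_le_add (add_le_add le_rfl hed) le_rfl)
    have hs0 : (0 : ℝ) ≤ f s := Nat.cast_nonneg _
    have ht0 : (0 : ℝ) ≤ f t := Nat.cast_nonneg _
    rw [← ENNReal.ofReal_coe_nnreal, ← ENNReal.ofReal_add (by positivity) (by positivity),
      ENNReal.ofReal_le_ofReal_iff (by positivity)] at ih
    rw [← ENNReal.ofReal_coe_nnreal, ← ENNReal.ofReal_add (by positivity) (by positivity),
      ← ENNReal.ofReal_add (by positivity) (by positivity)]
    refine ENNReal.ofReal_le_ofReal ?_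
    have hsub : (((f t - f s : ℕ)) : ℝ) * 2 ≤ |(f t : ℝ) - f s| + (f t - f s) := by
      rcases le_total (f s) (f t) with h' | h'
      · rw [Nat.cast_sub h']
        have := le_abs_self ((f t : ℝ) - f s)
        linarith
      · rw [Nat.sub_eq_zero_of_le h', Nat.cast_zero, zero_mul]
        have := neg_abs_le ((f t : ℝ) - f s)
        linarith
    push_cast
    linarith

/-- The variation bound `f s + f t` cancels the `f s` in `two_mul_le`. It is this bound that keeps
the decreasing part `f - v` nonnegative. -/
lemma PositiveVariation.le {f : ℝ → ℕ} {T t : ℝ} {n : ℕ} (h : PositiveVariation f t n)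
    (hT : t < T) (hV : ∀ s t, 0 < s → s ≤ t → t < T →
      eVariationOn (fun x => (f x : ℝ)) (Icc s t) ≤ ENNReal.ofReal (f s + f t)) : n ≤ f t := by
  obtain ⟨s, hs, hst, h1⟩ := h.two_mul_le hT hV
  have h2 := h1.trans (add_le_add (hV s t hs hst hT) le_rfl)
  rw [← ENNReal.ofReal_add (by positivity) (by positivity),
    ENNReal.ofReal_le_ofReal_iff (by positivity)] at h2
  have h3 : (n : ℝ) ≤ f t := by linarith
  exact_mod_cast h3

/-- A function of the naturals whose variation over `[s, t]` is at most `f s + f t` is the sum of a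
decreasing and an increasing one. -/
lemma exists_antitoneOn_add_monotoneOn {f : ℝ → ℕ} {T : ℝ}
    (hV : ∀ s t, 0 < s → s ≤ t → t < T →
      eVariationOn (fun x => (f x : ℝ)) (Icc s t) ≤ ENNReal.ofReal (f s + f t)) :
    ∃ u v : ℝ → ℕ, AntitoneOn u (Ioo 0 T) ∧ MonotoneOn v (Ioo 0 T) ∧
      ∀ t ∈ Ioo 0 T, f t = u t + v t := by
  -- The increasing part is the largest positive variation up to `t`; it is attained since these
  -- naturals are bounded by `f t`.
  set v : ℝ → ℕ := fun t => sSup {n | PositiveVariation f t n} with hv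
  have hbdd : ∀ t ∈ Ioo 0 T, BddAbove {n | PositiveVariation f t n} := fun t ht =>
    ⟨f t, fun n hn => PositiveVariation.le hn ht.2 hV⟩
  have hmem : ∀ t ∈ Ioo 0 T, PositiveVariation f t (v t) := fun t ht =>
    Nat.sSup_mem ⟨0, .base t ht.1⟩ (hbdd t ht)
  have hle : ∀ t ∈ Ioo 0 T, v t ≤ f t := fun t ht => (hmem t ht).le ht.2 hV
  have hstep : ∀ s ∈ Ioo 0 T, ∀ t ∈ Ioo 0 T, s ≤ t → v s + (f t - f s) ≤ v t :=
    fun s hs t ht hst => le_csSup (hbdd t ht) (PositiveVariation.step s t _ (hmem s hs) hst)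
  refine ⟨fun t => f t - v t, v, fun s hs t ht hst => ?_, fun s hs t ht hst => ?_,
    fun t ht => ?_⟩
  · have := hstep s hs t ht hst
    have := hle s hs
    have := hle t ht
    simp only
    omega
  · exact le_of_add_le_left (hstep s hs t ht hst)
  · have := hle t ht
    simp only
    omega

/-- A right-continuous integer function is constant just to the right of each point. So `s` may be
moved to the right within the interval and `t` enlarged without changing values, which passes from
open to closed intervals. -/
lemma VariationConstraint.eVariationOn_Icc_le {f : ℝ → ℝ} {T : ℝ} (hc : IsCadlagOn f T)
    (hf : ∀ t ∈ Ioo 0 T, ∃ n : ℕ, 1 ≤ n ∧ f t = n) (hV : VariationConstraint f T) {s t : ℝ}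
    (hs : 0 < s) (hst : s ≤ t) (ht : t < T) :
    eVariationOn f (Icc s t) ≤ ENNReal.ofReal (f s + f t) := by
  have hright : ∀ x ∈ Ioo 0 T, ∀ y, x < y → ∃ z ∈ Ioo x y, z < T ∧ ∀ w ∈ Icc x z, f w = f x := by
    intro x hx y hxy
    have h1 := (hc x hx).1
    have h2 : ∀ᶠ w in 𝓝[≥] x, w ∈ Ioo 0 T ∧ w < y ∧ dist (f w) (f x) < 1 := by
      filter_upwards [nhdsWithin_le_nhds (Ioo_mem_nhds hx.1 hx.2),
        nhdsWithin_le_nhds (Iio_mem_nhds hxy), Metric.tendsto_nhds.1 h1 1 one_pos] with w a b c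
      exact ⟨a, b, c⟩
    obtain ⟨z, hz, hz'⟩ := mem_nhdsGE_iff_exists_Icc_subset.1 h2
    refine ⟨z, ⟨hz, (hz' ⟨hz.le, le_rfl⟩).2.1⟩, (hz' ⟨hz.le, le_rfl⟩).1.2, fun w hw => ?_⟩
    obtain ⟨hw1, -, hw2⟩ := hz' hw
    obtain ⟨n, -, hn⟩ := hf w hw1
    obtain ⟨m, -, hm⟩ := hf x hx
    rw [hn, hm, Real.dist_eq] at hw2
    have h3 : |((n : ℤ) - (m : ℤ) : ℤ)| < 1 := by
      have : |(((n : ℤ) - (m : ℤ) : ℤ) : ℝ)| < 1 := by push_cast; exact hw2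
      exact_mod_cast this
    rw [Int.abs_lt_one_iff] at h3
    rw [hn, hm]
    have : n = m := by omega
    rw [this]
  rcases hst.eq_or_lt with rfl | hlt
  · simp
  obtain ⟨z, hz, -, hzc⟩ := hright s ⟨hs, hlt.trans ht⟩ t hlt
  obtain ⟨t', ht', htT, htc⟩ := hright t ⟨hs.trans hlt, ht⟩ T ht
  have hadd := eVariationOn.Icc_add_Icc f (s := univ) hz.1.le hz.2.le (mem_univ z)
  simp only [univ_inter] at hadd
  have h0 : eVariationOn f (Icc s z) = 0 :=
    (eVariationOn.congr (g := fun _ => f s) fun w hw => hzc w hw).trans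
      (eVariationOn.constant_on (by
        rintro _ ⟨_, _, rfl⟩ _ ⟨_, _, rfl⟩
        rfl))
  rw [← hadd, h0, zero_add]
  have := hV s t' hs (hlt.trans ht'.1) htT
  rw [htc t' ⟨ht'.1.le, le_rfl⟩] at this
  have hsub : Icc z t ⊆ Ioo s t' := fun w hw => ⟨hz.1.trans_le hw.1, hw.2.trans_lt ht'.1⟩
  exact (eVariationOn.mono f hsub).trans this

end MonotoneDecomposition

/-! ### Horizontal layers of a law. -/

section Layers

/-- The length of the `i`-th layer of a decreasing function on `(0, T)`. -/
noncomputable def layerLength (u : ℝ → ℕ) (T : ℝ) (i : ℕ) : ℝ :=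
  sSup (insert 0 {t | t ∈ Ioo 0 T ∧ i + 1 ≤ u t})

lemma bddAbove_layer (u : ℝ → ℕ) {T : ℝ} (hT : 0 ≤ T) (i : ℕ) :
    BddAbove (insert 0 {t | t ∈ Ioo 0 T ∧ i + 1 ≤ u t}) := by
  refine ⟨T, ?_⟩
  rintro x (rfl | hx)
  exacts [hT, hx.1.2.le]

lemma layerLength_nonneg (u : ℝ → ℕ) {T : ℝ} (hT : 0 ≤ T) (i : ℕ) : 0 ≤ layerLength u T i :=
  le_csSup (bddAbove_layer u hT i) (mem_insert _ _)

lemma layerLength_le (u : ℝ → ℕ) {T : ℝ} (hT : 0 ≤ T) (i : ℕ) : layerLength u T i ≤ T := by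
  refine csSup_le (insert_nonempty _ _) ?_
  rintro x (rfl | hx)
  exacts [hT, hx.1.2.le]

lemma antitone_layerLength (u : ℝ → ℕ) {T : ℝ} (hT : 0 ≤ T) : Antitone (layerLength u T) := by
  intro i j hij
  refine csSup_le_csSup (bddAbove_layer u hT i) (insert_nonempty _ _) (insert_subset_insert ?_)
  rintro x ⟨hx, h⟩
  exact ⟨hx, by omega⟩

lemma le_layerLength {u : ℝ → ℕ} {T t : ℝ} {i : ℕ} (ht : t ∈ Ioo 0 T) (h : i + 1 ≤ u t) :
    t ≤ layerLength u T i :=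
  le_csSup (bddAbove_layer u (ht.1.trans ht.2).le i) (mem_insert_of_mem _ ⟨ht, h⟩)

lemma succ_le_of_lt_layerLength {u : ℝ → ℕ} {T t : ℝ} (hu : AntitoneOn u (Ioo 0 T)) {i : ℕ}
    (ht : t ∈ Ioo 0 T) (h : t < layerLength u T i) : i + 1 ≤ u t := by
  obtain ⟨x, hx, htx⟩ := exists_lt_of_lt_csSup (insert_nonempty _ _) h
  rcases hx with rfl | ⟨hx, h'⟩
  · exact absurd htx ht.1.not_gt
  · exact h'.trans (hu ht hx htx.le)

lemma ENNReal.tsum_ite_lt (n : ℕ) : ∑' i : ℕ, (if i + 1 ≤ n then (1 : ℝ≥0∞) else 0) = n := by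
  rw [tsum_eq_sum (s := Finset.range n)]
  · have : ∀ i ∈ Finset.range n, (if i + 1 ≤ n then (1 : ℝ≥0∞) else 0) = 1 := fun i hi =>
      if_pos (Finset.mem_range.1 hi)
    rw [Finset.sum_congr rfl this]
    simp
  · intro i hi
    rw [Finset.mem_range] at hi
    exact if_neg (by omega)

/-- Layer-cake formula: each superlevel set of `u` is an interval at `0` up to its endpoint, and the
countably many endpoints are null. -/
lemma setLIntegral_eq_tsum_layer {u : ℝ → ℕ} {T : ℝ} (hu : AntitoneOn u (Ioo 0 T)) {B : Set ℝ}
    (hBT : B ⊆ Ioo 0 T) (hB : MeasurableSet B) :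
    ∫⁻ t in B, (u t : ℝ≥0∞) = ∑' i, volume (B ∩ Ioo 0 (layerLength u T i)) := by
  have hae : ∀ᵐ t ∂(volume.restrict B), (u t : ℝ≥0∞) =
      ∑' i, (Ioo 0 (layerLength u T i)).indicator 1 t := by
    have h0 : ∀ᵐ t ∂(volume : Measure ℝ), t ∉ range (layerLength u T) :=
      measure_eq_zero_iff_ae_notMem.1 ((countable_range _).measure_zero _)
    rw [ae_restrict_iff' hB]
    filter_upwards [h0] with t ht htB
    rw [← ENNReal.tsum_ite_lt (u t)]
    refine tsum_congr fun i => ?_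
    have htT := hBT htB
    by_cases h : t < layerLength u T i
    · rw [if_pos (succ_le_of_lt_layerLength hu htT h), indicator_of_mem (show t ∈ Ioo 0 _ from ⟨htT.1, h⟩),
        Pi.one_apply]
    · rw [indicator_of_notMem fun h' => h h'.2, if_neg]
      exact fun h' => ht ⟨i, le_antisymm (not_lt.1 h) (le_layerLength htT h')⟩
  rw [lintegral_congr_ae hae,
    lintegral_tsum fun i => (measurable_one.indicator measurableSet_Ioo).aemeasurable]
  refine tsum_congr fun i => ?_
  rw [lintegral_indicator_one measurableSet_Ioo, Measure.restrict_apply measurableSet_Ioo,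
    inter_comm]

/-- The sum of the uniform measures on the intervals `(0, b i)`, completed by an atom at `0` to
total mass `d`. -/
noncomputable def layerMeasure (b : ℕ → ℝ) (d : ℝ) : Measure ℝ :=
  Measure.sum (fun i => volume.restrict (Ioo 0 (b i))) +
    ENNReal.ofReal (d - ∑' i, b i) • Measure.dirac 0

/-- The lengths of the layers: the left part of total mass `d` with the lengths `b` of the
decreasing layers, and the right part of total mass `1 - d` with the lengths `a` of the increasing
ones. -/
structure IsLayering (T : ℝ) (b a : ℕ → ℝ) (d : ℝ) : Prop where
  antitone_left : Antitone b
  antitone_right : Antitone a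
  left_nonneg : ∀ i, 0 ≤ b i
  right_nonneg : ∀ i, 0 ≤ a i
  left_le : b 0 ≤ T
  right_le : a 0 ≤ T
  le_add : T ≤ b 0 + a 0
  sum_left : ∀ n, ∑ i ∈ Finset.range n, b i ≤ d
  sum_right : ∀ n, ∑ i ∈ Finset.range n, a i ≤ 1 - d

/-- The decreasing part is sliced from the left and the increasing part, reflected by `T - t`, in
the same way. The point masses at `0` and `T` are what remains of the masses `d` and `1 - d`. -/
lemma exists_isLayering {T : ℝ} (hT : 0 < T) {F : ProbabilityMeasure (WithTop ℝ)}
    (hF : F ∈ positiveIntegerLaws T) : ∃ b a d, IsLayering T b a d ∧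
      (F : Measure (WithTop ℝ)) =
        (layerMeasure b d + (layerMeasure a (1 - d)).map (fun t => T - t)).map
          (fun t : ℝ => (t : WithTop ℝ)) := by
  obtain ⟨hF1, hF2, f, hfc, hfF, hfn, hfV⟩ := hF
  have hfl : ∀ t ∈ Ioo 0 T, ((⌊f t⌋₊ : ℕ) : ℝ) = f t ∧ 1 ≤ ⌊f t⌋₊ := by
    intro t ht
    obtain ⟨n, hn, h⟩ := hfn t ht
    rw [h, Nat.floor_natCast]
    exact ⟨rfl, hn⟩
  obtain ⟨u, v, hu, hv, huv⟩ := exists_antitoneOn_add_monotoneOn (f := fun t => ⌊f t⌋₊) (T := T)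
    (by
      intro s t hs hst ht
      have h1 := hfV.eVariationOn_Icc_le hfc hfn hs hst ht
      have h2 : EqOn (fun x => ((⌊f x⌋₊ : ℕ) : ℝ)) f (Icc s t) := fun x hx =>
        (hfl x ⟨hs.trans_le hx.1, hx.2.trans_lt ht⟩).1
      rw [eVariationOn.congr h2, (hfl s ⟨hs, hst.trans_lt ht⟩).1, (hfl t ⟨hs.trans_le hst, ht⟩).1]
      exact h1)
  have hv' : AntitoneOn (fun t => v (T - t)) (Ioo 0 T) := fun x hx y hy hxy =>
    hv ⟨by linarith [hy.2], by linarith [hy.1]⟩ ⟨by linarith [hx.2], by linarith [hx.1]⟩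
      (by linarith)
  set b := layerLength u T with hb
  set a := layerLength (fun t => v (T - t)) T with ha
  have hemb : MeasurableEmbedding (fun t : ℝ => (t : WithTop ℝ)) :=
    WithTop.isOpenEmbedding_coe.measurableEmbedding
  set ν := (F : Measure (WithTop ℝ)).comap (fun t : ℝ => (t : WithTop ℝ)) with hν
  have hνF : (F : Measure (WithTop ℝ)) = ν.map (fun t : ℝ => (t : WithTop ℝ)) := by
    rw [hν, hemb.map_comap]
    refine (Measure.restrict_eq_self_of_ae_mem ?_).symm
    have : ∀ᵐ x ∂(F : Measure (WithTop ℝ)), x ≠ ⊤ := by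
      rw [ae_iff]
      simpa using hF2
    filter_upwards [this] with x hx
    obtain ⟨y, rfl⟩ := WithTop.ne_top_iff_exists.1 hx
    exact mem_range_self y
  have hνa : ∀ A, ν A = (F : Measure (WithTop ℝ)) ((fun t : ℝ => (t : WithTop ℝ)) '' A) := fun A =>
    hemb.comap_apply _ _
  have hν1 : ν (Icc 0 T)ᶜ = 0 := by
    rw [hνa]
    refine measure_mono_null ?_ hF1
    rintro _ ⟨x, hx, rfl⟩ (⟨y, hy, hxy⟩ | h)
    · rw [WithTop.coe_inj] at hxy
      exact hx (hxy ▸ hy)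
    · exact WithTop.coe_ne_top h
  have hνuniv : ν univ = 1 := by
    have := measure_univ (μ := (F : Measure (WithTop ℝ)))
    rw [hνF, hemb.map_apply, preimage_univ] at this
    exact this
  have hνfin : IsFiniteMeasure ν := ⟨by rw [hνuniv]; exact ENNReal.one_lt_top⟩
  have hfB : ∀ B, MeasurableSet B → B ⊆ Ioo 0 T → ν B =
      (Measure.sum fun i => volume.restrict (Ioo 0 (b i))) B +
        ((Measure.sum fun i => volume.restrict (Ioo 0 (a i))).map fun t => T - t) B := by
    intro B hB hBT
    have hm : Measurable fun t : ℝ => T - t := measurable_const.sub measurable_id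
    have e1 : ∫⁻ t in B, ENNReal.ofReal (f t) = ∫⁻ t in B, ((u t : ℝ≥0∞) + (v t : ℝ≥0∞)) := by
      refine setLIntegral_congr_fun hB fun t ht => ?_
      rw [← (hfl t (hBT ht)).1, ENNReal.ofReal_natCast, huv t (hBT ht), Nat.cast_add]
    have hum : AEMeasurable (fun t => (u t : ℝ≥0∞)) (volume.restrict B) := by
      have : AEMeasurable u (volume.restrict (Ioo 0 T)) :=
        aemeasurable_restrict_of_antitoneOn measurableSet_Ioo hu
      exact ((measurable_from_top (f := fun n : ℕ => (n : ℝ≥0∞))).comp_aemeasurable this).mono_measure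
        (Measure.restrict_mono_set _ hBT)
    rw [hνa, hfF B hB hBT, e1, lintegral_add_left' hum, setLIntegral_eq_tsum_layer hu hBT hB,
      Measure.sum_apply _ hB]
    congr 1
    · refine tsum_congr fun i => ?_
      rw [Measure.restrict_apply hB]
    · have hB' : MeasurableSet ((fun t => T - t) ⁻¹' B) := hm hB
      have hsub : (fun t => T - t) ⁻¹' B ⊆ Ioo 0 T := fun t ht => by
        have := hBT ht
        exact ⟨by linarith [this.2], by linarith [this.1]⟩
      have e2 := setLIntegral_eq_tsum_layer hv' hsub hB'
      rw [Measure.map_apply hm hB, Measure.sum_apply _ hB']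
      have e3 : ∫⁻ t in B, (v t : ℝ≥0∞) = ∫⁻ t in (fun t => T - t) ⁻¹' B, (v (T - t) : ℝ≥0∞) := by
        rw [← lintegral_indicator hB, ← lintegral_indicator hB',
          ← lintegral_sub_left_eq_self _ T]
        rfl
      rw [e3, e2]
      refine tsum_congr fun i => ?_
      rw [Measure.restrict_apply hB']
  have hoff : ∀ (c : ℕ → ℝ), (∀ i, c i ≤ T) → (∀ i, 0 ≤ c i) →
      (Measure.sum fun i => volume.restrict (Ioo 0 (c i))) (Ioo 0 T) =
        ∑' i, ENNReal.ofReal (c i) := by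
    intro c hc _
    rw [Measure.sum_apply _ measurableSet_Ioo]
    refine tsum_congr fun i => ?_
    rw [Measure.restrict_apply measurableSet_Ioo,
      inter_eq_self_of_subset_right (Ioo_subset_Ioo_right (hc i)), Real.volume_Ioo, sub_zero]
  have hb0 : ∀ i, 0 ≤ b i := fun i => layerLength_nonneg u hT.le i
  have ha0 : ∀ i, 0 ≤ a i := fun i => layerLength_nonneg (fun t => v (T - t)) hT.le i
  have hbT : ∀ i, b i ≤ T := fun i => layerLength_le u hT.le i
  have haT : ∀ i, a i ≤ T := fun i => layerLength_le (fun t => v (T - t)) hT.le i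
  have hm : Measurable fun t : ℝ => T - t := measurable_const.sub measurable_id
  have hpre : (fun t : ℝ => T - t) ⁻¹' Ioo 0 T = Ioo 0 T := by
    ext t
    constructor <;> rintro ⟨h1, h2⟩ <;> constructor <;> simp only at * <;> linarith
  have htot : ν (Ioo 0 T) = (∑' i, ENNReal.ofReal (b i)) + ∑' i, ENNReal.ofReal (a i) := by
    rw [hfB _ measurableSet_Ioo subset_rfl, hoff b hbT hb0, Measure.map_apply hm measurableSet_Ioo,
      hpre, hoff a haT ha0]
  have hfinb : ∑' i, ENNReal.ofReal (b i) ≠ ⊤ :=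
    ((le_self_add.trans htot.ge).trans_lt (measure_lt_top ν _)).ne
  have hfina : ∑' i, ENNReal.ofReal (a i) ≠ ⊤ :=
    ((le_add_self.trans htot.ge).trans_lt (measure_lt_top ν _)).ne
  have hsumb : Summable b := by
    have := ENNReal.summable_toReal hfinb
    simpa only [ENNReal.toReal_ofReal (hb0 _)] using this
  have hsuma : Summable a := by
    have := ENNReal.summable_toReal hfina
    simpa only [ENNReal.toReal_ofReal (ha0 _)] using this
  have hIcc : Icc 0 T = ({0} ∪ {T}) ∪ Ioo 0 T := by
    ext t
    simp only [mem_Icc, mem_union, mem_singleton_iff, mem_Ioo]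
    constructor
    · rintro ⟨h1, h2⟩
      rcases h1.eq_or_lt with h | h
      · exact Or.inl (Or.inl h.symm)
      · rcases h2.eq_or_lt with h' | h'
        · exact Or.inl (Or.inr h')
        · exact Or.inr ⟨h, h'⟩
    · rintro ((rfl | rfl) | ⟨h1, h2⟩)
      exacts [⟨le_rfl, hT.le⟩, ⟨hT.le, le_rfl⟩, ⟨h1.le, h2.le⟩]
  have hd1 : Disjoint ({0} ∪ {T}) (Ioo 0 T) := by
    rw [disjoint_left]
    rintro t (rfl | rfl) ⟨h1, h2⟩
    exacts [h1.false, h2.false]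
  have hd2 : Disjoint ({0} : Set ℝ) {T} := disjoint_singleton.2 hT.ne
  have hνr : ν = ν {0} • Measure.dirac 0 + ν {T} • Measure.dirac T + ν.restrict (Ioo 0 T) := by
    conv_lhs => rw [← Measure.restrict_eq_self_of_ae_mem (μ := ν) (s := Icc 0 T)
      (measure_eq_zero_iff_ae_notMem.1 hν1 |>.mono fun _ h => not_not.1 h)]
    rw [hIcc, Measure.restrict_union hd1 measurableSet_Ioo,
      Measure.restrict_union hd2 (measurableSet_singleton T), Measure.restrict_singleton,
      Measure.restrict_singleton]
  have hνI : ν.restrict (Ioo 0 T) = (Measure.sum fun i => volume.restrict (Ioo 0 (b i))) +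
        (Measure.sum fun i => volume.restrict (Ioo 0 (a i))).map fun t => T - t := by
    ext B hB
    rw [Measure.restrict_apply hB, hfB _ (hB.inter measurableSet_Ioo) inter_subset_right,
      Measure.add_apply, Measure.map_apply hm (hB.inter measurableSet_Ioo), Measure.map_apply hm hB,
      preimage_inter, hpre, Measure.sum_apply _ (hB.inter measurableSet_Ioo),
      Measure.sum_apply _ hB, Measure.sum_apply _ ((hm hB).inter measurableSet_Ioo),
      Measure.sum_apply _ (hm hB)]
    congr 1 <;> refine tsum_congr fun i => ?_
    · rw [Measure.restrict_apply hB, Measure.restrict_apply (hB.inter measurableSet_Ioo),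
        inter_assoc, inter_eq_self_of_subset_right (Ioo_subset_Ioo_right (hbT i))]
    · rw [Measure.restrict_apply (hm hB), Measure.restrict_apply ((hm hB).inter measurableSet_Ioo),
        inter_assoc, inter_eq_self_of_subset_right (Ioo_subset_Ioo_right (haT i))]
  have hmass : (ν {0}).toReal + (ν {T}).toReal + ((∑' i, b i) + ∑' i, a i) = 1 := by
    have h := hνuniv
    rw [hνr] at h
    simp only [Measure.add_apply, Measure.smul_apply, measure_univ, smul_eq_mul, mul_one,
      Measure.restrict_apply_univ, htot] at h
    have h' := congrArg ENNReal.toReal h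
    rw [ENNReal.toReal_add (by finiteness) (by finiteness), ENNReal.toReal_add (by finiteness)
      (by finiteness), ENNReal.toReal_add hfinb hfina, ENNReal.tsum_toReal_eq (by finiteness),
      ENNReal.tsum_toReal_eq (by finiteness)] at h'
    simpa only [ENNReal.toReal_ofReal (hb0 _), ENNReal.toReal_ofReal (ha0 _),
      ENNReal.toReal_one] using h'
  -- The parameter `d` is the atom at `0` plus the mass of all left layers.
  refine ⟨b, a, (ν {0}).toReal + ∑' i, b i, ⟨antitone_layerLength u hT.le,
    antitone_layerLength _ hT.le, hb0, ha0, hbT 0, haT 0, ?_, fun n => ?_, fun n => ?_⟩, ?_⟩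
  · by_contra! hlt
    -- If the longest layers from the two sides did not meet, both `u` and `v` would vanish at this
    -- midpoint, contradicting positivity of the density.
    have ht : (b 0 + (T - a 0)) / 2 ∈ Ioo 0 T :=
      ⟨by linarith [hb0 0, haT 0], by linarith [hbT 0, ha0 0]⟩
    have h1 := huv _ ht
    have h2 := (hfl _ ht).2
    rcases Nat.eq_zero_or_pos (u ((b 0 + (T - a 0)) / 2)) with h | h
    · have h3 : 0 + 1 ≤ v (T - (T - (b 0 + (T - a 0)) / 2)) := by
        rw [sub_sub_cancel]
        omega
      have := le_layerLength (u := fun t => v (T - t)) (T := T)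
        (t := T - (b 0 + (T - a 0)) / 2) (i := 0)
        ⟨by linarith [ht.2], by linarith [ht.1]⟩ h3
      change _ ≤ a 0 at this
      linarith
    · have := le_layerLength (i := 0) ht h
      change _ ≤ b 0 at this
      linarith
  · have := hsumb.sum_le_tsum (Finset.range n) fun i _ => hb0 i
    have h0 : 0 ≤ (ν {0}).toReal := ENNReal.toReal_nonneg
    linarith
  · have := hsuma.sum_le_tsum (Finset.range n) fun i _ => ha0 i
    have h0 : 0 ≤ (ν {T}).toReal := ENNReal.toReal_nonneg
    linarith
  · rw [hνF]
    congr 1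
    have e1 : (ν {0}).toReal + ∑' i, b i - ∑' i, b i = (ν {0}).toReal := by ring
    have e2 : 1 - ((ν {0}).toReal + ∑' i, b i) - ∑' i, a i = (ν {T}).toReal := by linarith
    rw [layerMeasure, layerMeasure, e1, e2, Measure.map_add _ _ hm, Measure.map_smul,
      Measure.map_dirac' hm, sub_zero, ENNReal.ofReal_toReal (by finiteness),
      ENNReal.ofReal_toReal (by finiteness)]
    conv_lhs => rw [hνr, hνI]
    abel

end Layers

/-! ### Layer measures as images of Lebesgue measure. -/

section LayerOffset

/-- The partial sums of the lengths of the layers. -/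
noncomputable def layerSum (b : ℕ → ℝ) (n : ℕ) : ℝ := ∑ i ∈ Finset.range n, b i

open Classical in
/-- The distance of `s` to the last partial sum before `s`, or `0` if `s` is beyond all the partial
sums. -/
noncomputable def layerOffset (b : ℕ → ℝ) (s : ℝ) : ℝ :=
  if h : ∃ i, layerSum b i ≤ s ∧ s < layerSum b (i + 1) then s - layerSum b h.choose else 0

variable {b : ℕ → ℝ} {s : ℝ}

@[simp] lemma layerSum_zero (b : ℕ → ℝ) : layerSum b 0 = 0 := by simp [layerSum]

lemma layerSum_succ (b : ℕ → ℝ) (n : ℕ) : layerSum b (n + 1) = layerSum b n + b n :=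
  Finset.sum_range_succ _ _

lemma monotone_layerSum (hb : ∀ i, 0 ≤ b i) : Monotone (layerSum b) :=
  monotone_nat_of_le_succ fun n => by rw [layerSum_succ]; linarith [hb n]

lemma layerOffset_eq (hb : ∀ i, 0 ≤ b i) {i : ℕ} (h1 : layerSum b i ≤ s)
    (h2 : s < layerSum b (i + 1)) : layerOffset b s = s - layerSum b i := by
  have h : ∃ i, layerSum b i ≤ s ∧ s < layerSum b (i + 1) := ⟨i, h1, h2⟩
  rw [layerOffset, dif_pos h]
  have key : ∀ i j, layerSum b i ≤ s → s < layerSum b (j + 1) → i ≤ j := by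
    intro i j hi hj
    by_contra! hlt
    exact (hi.trans_lt hj).not_ge (monotone_layerSum hb hlt)
  have : h.choose = i := le_antisymm (key _ _ h.choose_spec.1 h2) (key _ _ h1 h.choose_spec.2)
  rw [this]

lemma layerOffset_eq_zero (h : ∀ i, layerSum b i ≤ s) : layerOffset b s = 0 := by
  rw [layerOffset, dif_neg]
  rintro ⟨i, -, hi⟩
  exact hi.not_ge (h _)

lemma exists_layer_or_forall_le (b : ℕ → ℝ) (hs : 0 ≤ s) :
    (∃ i, layerSum b i ≤ s ∧ s < layerSum b (i + 1)) ∨ ∀ i, layerSum b i ≤ s := by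
  by_contra! h
  obtain ⟨h1, i, hi⟩ := h
  obtain ⟨k, -, hk⟩ := exists_crossing (q := layerSum b) (n := i) (s := s) (by simpa using hs) hi
  exact (h1 k hk.1).not_gt hk.2

lemma measurable_layerOffset (hb : ∀ i, 0 ≤ b i) : Measurable (layerOffset b) := by
  set g : ℕ → ℝ → ℝ := fun n s => ∑ i ∈ Finset.range n,
    (Ico (layerSum b i) (layerSum b (i + 1))).indicator (fun s => s - layerSum b i) s with hg
  refine measurable_of_tendsto_metrizable (f := g) (fun n => ?_) ?_
  · exact Finset.measurable_fun_sum _ fun i _ =>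
      (measurable_id.sub_const _).indicator measurableSet_Ico
  · rw [tendsto_pi_nhds]
    intro s
    by_cases h : ∃ i, layerSum b i ≤ s ∧ s < layerSum b (i + 1)
    · obtain ⟨i, h1, h2⟩ := h
      refine tendsto_const_nhds.congr' ?_
      filter_upwards [eventually_gt_atTop i] with n hn
      simp only [hg]
      rw [Finset.sum_eq_single i, indicator_of_mem (show s ∈ Ico _ _ from ⟨h1, h2⟩),
        layerOffset_eq hb h1 h2]
      · intro j _ hji
        refine indicator_of_notMem (fun hj => ?_) _
        rcases lt_or_gt_of_ne hji with h | h
        · exact (h1.trans_lt hj.2).not_ge (monotone_layerSum hb h)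
        · exact (hj.1.trans_lt h2).not_ge (monotone_layerSum hb h)
      · intro h
        exact absurd (Finset.mem_range.2 hn) h
    · have : layerOffset b s = 0 := by rw [layerOffset, dif_neg h]
      rw [this]
      refine tendsto_const_nhds.congr fun n => ?_
      refine (Finset.sum_eq_zero fun i _ => indicator_of_notMem (fun hi => h ⟨i, hi.1, hi.2⟩) _).symm

/-- The offset translates the block between consecutive partial sums onto the interval from `0` to
`b i`, and collapses everything beyond the sum of the series onto the atom at `0`. -/
lemma map_layerOffset (hb : ∀ i, 0 ≤ b i) {d : ℝ} (hd : ∀ n, layerSum b n ≤ d) :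
    (volume.restrict (Ioo 0 d)).map (layerOffset b) = layerMeasure b d := by
  have hm := measurable_layerOffset hb
  have hsum : Summable b := summable_of_sum_range_le hb hd
  have htend : Tendsto (layerSum b) atTop (𝓝 (∑' i, b i)) := hsum.hasSum.tendsto_sum_nat
  have hle : ∀ n, layerSum b n ≤ ∑' i, b i := fun n => hsum.sum_le_tsum _ fun i _ => hb i
  have hled : ∑' i, b i ≤ d := le_of_tendsto' htend hd
  have hU : Ico 0 d = (⋃ i, Ico (layerSum b i) (layerSum b (i + 1))) ∪ Ico (∑' i, b i) d := by
    ext s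
    simp only [mem_union, mem_iUnion, mem_Ico]
    constructor
    · rintro ⟨h0, h1⟩
      rcases exists_layer_or_forall_le b h0 with h | h
      · exact Or.inl h
      · exact Or.inr ⟨le_of_tendsto' htend h, h1⟩
    · rintro (⟨i, h1, h2⟩ | ⟨h1, h2⟩)
      · refine ⟨le_trans ?_ h1, h2.trans_le (hd _)⟩
        simpa using monotone_layerSum hb i.zero_le
      · exact ⟨(tsum_nonneg hb).trans h1, h2⟩
  have hdisj : Disjoint (⋃ i, Ico (layerSum b i) (layerSum b (i + 1))) (Ico (∑' i, b i) d) := by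
    rw [disjoint_left]
    intro s hs hs'
    obtain ⟨i, hi⟩ := mem_iUnion.1 hs
    exact (hi.2.trans_le (hle _)).not_ge hs'.1
  have hpw : Pairwise (Function.onFun Disjoint fun i => Ico (layerSum b i) (layerSum b (i + 1))) :=
    (monotone_layerSum hb).pairwise_disjoint_on_Ico_succ
  rw [Measure.restrict_congr_set Ioo_ae_eq_Ico, hU, Measure.restrict_union hdisj measurableSet_Ico,
    Measure.restrict_iUnion hpw fun i => measurableSet_Ico, Measure.map_add _ _ hm,
    Measure.map_sum hm.aemeasurable, layerMeasure]
  congr 1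
  · congr 1
    funext i
    have e1 : (volume.restrict (Ico (layerSum b i) (layerSum b (i + 1)))).map (layerOffset b) =
        (volume.restrict (Ico (layerSum b i) (layerSum b (i + 1)))).map
          (fun s => s - layerSum b i) := by
      refine Measure.map_congr ?_
      filter_upwards [ae_restrict_mem measurableSet_Ico] with s hs
      exact layerOffset_eq hb hs.1 hs.2
    have e2 : Ico (layerSum b i) (layerSum b (i + 1)) =
        (fun s => s - layerSum b i) ⁻¹' Ico 0 (b i) := by
      ext s
      simp only [mem_preimage, mem_Ico, layerSum_succ]
      constructor <;> rintro ⟨h1, h2⟩ <;> constructor <;> linarith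
    rw [e1, e2, ((measurePreserving_sub_right volume (layerSum b i)).restrict_preimage
      measurableSet_Ico).map_eq]
    exact (Measure.restrict_congr_set Ioo_ae_eq_Ico).symm
  · have e1 : (volume.restrict (Ico (∑' i, b i) d)).map (layerOffset b) =
        (volume.restrict (Ico (∑' i, b i) d)).map (fun _ => 0) := by
      refine Measure.map_congr ?_
      filter_upwards [ae_restrict_mem measurableSet_Ico] with s hs
      exact layerOffset_eq_zero fun i => (hle i).trans hs.1
    rw [e1, Measure.map_const, Measure.restrict_apply_univ, Real.volume_Ico]

/-- Inside a layer only two partial sums matter. Beyond all of them the limit offset is `0`; for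
nearby parameters `s` may lie in a layer, but only one of high index, which is short because the
lengths decrease and sum to at most one. -/
lemma continuousAt_layerOffset {X : Type*} [TopologicalSpace X] {b : X → ℕ → ℝ}
    (hb : Continuous b) (hanti : ∀ x, Antitone (b x)) (hb0 : ∀ x i, 0 ≤ b x i)
    (hb1 : ∀ x n, layerSum (b x) n ≤ 1) {s : ℝ} (hs : 0 ≤ s) {x₀ : X}
    (hsr : s ∉ range (layerSum (b x₀))) : ContinuousAt (fun x => layerOffset (b x) s) x₀ := by
  have hcs : ∀ n, Continuous fun x => layerSum (b x) n := fun n =>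
    continuous_finsetSum _ fun i _ => (continuous_apply i).comp hb
  rcases exists_layer_or_forall_le (b x₀) hs with ⟨i, h1, h2⟩ | h
  · have h1' : layerSum (b x₀) i < s := lt_of_le_of_ne h1 fun h => hsr ⟨i, h⟩
    have hev : ∀ᶠ x in 𝓝 x₀, layerOffset (b x) s = s - layerSum (b x) i := by
      filter_upwards [(hcs i).continuousAt.eventually (eventually_lt_nhds h1'),
        (hcs (i + 1)).continuousAt.eventually (eventually_gt_nhds h2)] with x hx1 hx2
      exact layerOffset_eq (hb0 x) hx1.le hx2
    exact (continuousAt_const.sub (hcs i).continuousAt).congr (hev.mono fun x hx => hx.symm)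
  · rw [ContinuousAt, layerOffset_eq_zero h, Metric.tendsto_nhds]
    intro ε hε
    obtain ⟨N, hN⟩ := exists_nat_one_div_lt hε
    have hNs : layerSum (b x₀) N < s := lt_of_le_of_ne (h N) fun h => hsr ⟨N, h⟩
    filter_upwards [(hcs N).continuousAt.eventually (eventually_lt_nhds hNs)] with x hx
    rcases exists_layer_or_forall_le (b x) hs with ⟨j, h1, h2⟩ | h'
    · have hNj : N ≤ j := by
        by_contra! hlt
        exact (hx.trans h2).not_ge (monotone_layerSum (hb0 x) hlt)
      have hbN : b x N ≤ 1 / ((N : ℝ) + 1) := by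
        rw [le_div_iff₀ (by positivity)]
        have e1 : ∑ i ∈ Finset.range (N + 1), b x N ≤ layerSum (b x) (N + 1) :=
          Finset.sum_le_sum fun i hi => hanti x (Nat.lt_succ_iff.1 (Finset.mem_range.1 hi))
        rw [Finset.sum_const, Finset.card_range, nsmul_eq_mul] at e1
        push_cast at e1
        linarith [hb1 x (N + 1)]
      rw [layerOffset_eq (hb0 x) h1 h2, Real.dist_eq, sub_zero, abs_of_nonneg (sub_nonneg.2 h1)]
      rw [layerSum_succ] at h2
      linarith [hanti x hNj]
    · rw [layerOffset_eq_zero h', dist_self]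
      exact hε

/-- The layer measures depend continuously on the lengths of the layers. -/
lemma continuous_integral_layerMeasure {X : Type*} [TopologicalSpace X] [FirstCountableTopology X]
    {b : X → ℕ → ℝ} {d : X → ℝ} (hb : Continuous b) (hd : Continuous d)
    (hanti : ∀ x, Antitone (b x)) (hb0 : ∀ x i, 0 ≤ b x i) (hbd : ∀ x n, layerSum (b x) n ≤ d x)
    (hd1 : ∀ x, d x ≤ 1) (ψ : ℝ →ᵇ ℝ) :
    Continuous fun x => ∫ t, ψ t ∂(layerMeasure (b x) (d x)) := by
  -- Written over the fixed interval `(0, 1)`, the parameter enters only through the integrand, so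
  -- dominated convergence applies.
  have e : ∀ x, ∫ t, ψ t ∂(layerMeasure (b x) (d x)) =
      ∫ s in Ioo 0 1, (Iio (d x)).indicator (fun s => ψ (layerOffset (b x) s)) s := by
    intro x
    rw [← map_layerOffset (hb0 x) (hbd x),
      integral_map (measurable_layerOffset (hb0 x)).aemeasurable
        ψ.continuous.measurable.aestronglyMeasurable, integral_indicator measurableSet_Iio,
      Measure.restrict_restrict measurableSet_Iio]
    congr 2
    ext s
    simp only [mem_Ioo, mem_inter_iff, mem_Iio]
    constructor
    · rintro ⟨h1, h2⟩
      exact ⟨h2, h1, h2.trans_le (hd1 x)⟩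
    · rintro ⟨h1, h2, -⟩
      exact ⟨h2, h1⟩
  simp only [e]
  rw [continuous_iff_continuousAt]
  intro x₀
  refine continuousAt_of_dominated (bound := fun _ => ‖ψ‖) (Eventually.of_forall fun x => ?_)
    (Eventually.of_forall fun x => ae_of_all _ fun s => ?_) (integrable_const _) ?_
  · exact ((ψ.continuous.measurable.comp (measurable_layerOffset (hb0 x))).indicator
      measurableSet_Iio).aestronglyMeasurable
  · exact (norm_indicator_le_norm_self _ _).trans (ψ.norm_coe_le_norm _)
  · have h0 : ∀ᵐ s ∂(volume : Measure ℝ), s ∉ insert (d x₀) (range (layerSum (b x₀))) :=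
      measure_eq_zero_iff_ae_notMem.1 (((countable_range _).insert _).measure_zero _)
    filter_upwards [ae_restrict_of_ae h0, ae_restrict_mem measurableSet_Ioo] with s hs hs'
    have hs1 : s ≠ d x₀ := fun h => hs (Or.inl h)
    have hs2 : s ∉ range (layerSum (b x₀)) := fun h => hs (Or.inr h)
    rcases lt_or_gt_of_ne hs1 with h | h
    · have hev : ∀ᶠ x in 𝓝 x₀, (Iio (d x)).indicator (fun s => ψ (layerOffset (b x) s)) s =
          ψ (layerOffset (b x) s) :=
        (hd.continuousAt.eventually (eventually_gt_nhds h)).mono fun x hx =>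
          indicator_of_mem (show s ∈ Iio (d x) from hx) _
      exact (ψ.continuous.continuousAt.comp (continuousAt_layerOffset hb hanti hb0
        (fun x n => (hbd x n).trans (hd1 x)) hs'.1.le hs2)).congr (hev.mono fun x hx => hx.symm)
    · have hev : ∀ᶠ x in 𝓝 x₀, (Iio (d x)).indicator (fun s => ψ (layerOffset (b x) s)) s = 0 :=
        (hd.continuousAt.eventually (eventually_lt_nhds h)).mono fun x hx =>
          indicator_of_notMem (show s ∉ Iio (d x) from hx.not_gt) _
      exact continuousAt_const.congr (hev.mono fun x hx => hx.symm)

end LayerOffset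

/-! ### The location of the supremum for upper semicontinuous paths. -/

section SupLocation

/-- The points of `I` at which `g` attains its supremum over `I`. -/
def maximizers (g : ℝ → ℝ) (I : CompactInterval) : Set ℝ :=
  {t | t ∈ I.toSet ∧ ∀ s ∈ I.toSet, g s ≤ g t}

lemma exists_isLeast_maximizers {g : ℝ → ℝ} (hg : UpperSemicontinuous g) (I : CompactInterval) :
    ∃ t, IsLeast (maximizers g I) t := by
  have hne : I.toSet.Nonempty := nonempty_Icc.2 I.lt.le
  refine IsCompact.exists_isLeast ?_ ?_
  · have e : maximizers g I = I.toSet ∩ ⋂ s ∈ I.toSet, {t | g s ≤ g t} := by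
      ext t
      simp [maximizers]
    rw [e]
    exact isCompact_Icc.inter_right (isClosed_biInter fun s _ => hg.isClosed_preimage (g s))
  · obtain ⟨t, ht, h⟩ := (hg.upperSemicontinuousOn I.toSet).exists_isMaxOn hne isCompact_Icc
    exact ⟨t, ht, fun _ hs => h hs⟩

lemma supLocation_eq {H : PathClass} {g : H.Path} {I : CompactInterval} {t : ℝ}
    (h : IsLeast (maximizers g.1 I) t) : supLocation H g I = (t : WithTop ℝ) := by
  change sInf ((fun t : ℝ => (t : WithTop ℝ)) '' maximizers g.1 I) = _
  rw [← WithTop.coe_sInf' h.nonempty ⟨t, h.2⟩, h.csInf_eq]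

lemma IsLeast.maximizers_of_subset {g : ℝ → ℝ} {I₁ I₂ : CompactInterval} {t : ℝ}
    (h : IsLeast (maximizers g I₁) t) (hI : I₂.toSet ⊆ I₁.toSet) (ht : t ∈ I₂.toSet) :
    IsLeast (maximizers g I₂) t :=
  ⟨⟨ht, fun _ hs => h.1.2 _ (hI hs)⟩, fun _ hs =>
    h.2 ⟨hI hs.1, fun r hr => (h.1.2 r hr).trans (hs.2 t ht)⟩⟩

lemma IsLeast.maximizers_shift {g : ℝ → ℝ} {I : CompactInterval} {t : ℝ}
    (h : IsLeast (maximizers g I) t) (c : ℝ) :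
    IsLeast (maximizers (pathShift c g) (I.shift c)) (t - c) := by
  have hmem : ∀ s, s ∈ (I.shift c).toSet ↔ s + c ∈ I.toSet := fun s => by
    simp only [CompactInterval.toSet, CompactInterval.shift, mem_Icc]
    constructor <;> rintro ⟨h1, h2⟩ <;> constructor <;> linarith
  refine ⟨⟨(hmem _).2 (by simpa using h.1.1), fun s hs => ?_⟩, fun s hs => ?_⟩
  · have := h.1.2 _ ((hmem s).1 hs)
    simpa [pathShift] using this
  · have : t ≤ s + c := h.2 ⟨(hmem s).1 hs.1, fun r hr => by
      have := hs.2 (r - c) ((hmem _).2 (by simpa using hr))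
      simpa [pathShift] using this⟩
    linarith

lemma le_of_mem_maximizers_unitFrom {g : ℝ → ℝ} (hg : Function.Periodic g 1) {a t : ℝ}
    (h : t ∈ maximizers g (CompactInterval.unitFrom a)) (s : ℝ) : g s ≤ g t := by
  obtain ⟨r, hr, hrs⟩ := hg.exists_mem_Ico one_pos s a
  rw [hrs]
  exact h.2 r ⟨hr.1, hr.2.le⟩

/-- The location of the path supremum is an invariant intrinsic location functional on a class of
upper semicontinuous paths with a unique maximizer over a period, as soon as it is measurable. -/
lemma isInvariantLocation_supLocation {H : PathClass}
    (husc : ∀ g ∈ H.carrier, UpperSemicontinuous g)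
    (huniq : ∀ g ∈ H.carrier, ∃! t : ℝ, t ∈ Set.Ico (0 : ℝ) 1 ∧ ∀ s : ℝ, g s ≤ g t)
    (hmeas : ∀ I, Measurable fun g : H.Path => supLocation H g I) :
    IsInvariantLocation H (supLocation H) where
  measurable := hmeas
  mem g I := by
    obtain ⟨t, ht⟩ := exists_isLeast_maximizers (husc g.1 g.2) I
    exact Or.inr ⟨t, ht.1.1, supLocation_eq ht⟩
  shift_compat g I c := by
    obtain ⟨t, ht⟩ := exists_isLeast_maximizers (husc g.1 g.2) I
    rw [supLocation_eq ht, supLocation_eq (g := H.shift c g) (ht.maximizers_shift c),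
      ← WithTop.coe_add, sub_add_cancel]
  stable g I₁ I₂ hI := by
    rintro ⟨t, ht, h⟩
    obtain ⟨t', ht'⟩ := exists_isLeast_maximizers (husc g.1 g.2) I₁
    rw [supLocation_eq ht', WithTop.coe_inj] at h
    subst h
    rw [supLocation_eq ht', supLocation_eq (ht'.maximizers_of_subset hI ht)]
  exists_mono g I₁ I₂ _ _ := by
    obtain ⟨t, ht⟩ := exists_isLeast_maximizers (husc g.1 g.2) I₁
    rw [supLocation_eq ht]
    exact WithTop.coe_ne_top
  ne_top g I := by
    obtain ⟨t, ht⟩ := exists_isLeast_maximizers (husc g.1 g.2) I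
    rw [supLocation_eq ht]
    exact WithTop.coe_ne_top
  invariant g a := by
    obtain ⟨t, ht⟩ := exists_isLeast_maximizers (husc g.1 g.2) (CompactInterval.unitFrom 0)
    obtain ⟨t', ht'⟩ := exists_isLeast_maximizers (husc g.1 g.2) (CompactInterval.unitFrom a)
    have hper := H.periodic g.1 g.2
    have hfr : ∀ x, (∀ s, g.1 s ≤ g.1 x) →
        Int.fract x ∈ Set.Ico (0 : ℝ) 1 ∧ ∀ s, g.1 s ≤ g.1 (Int.fract x) := fun x hx => by
      refine ⟨⟨Int.fract_nonneg x, Int.fract_lt_one x⟩, fun s => ?_⟩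
      have : g.1 (Int.fract x) = g.1 x := by
        have := hper.sub_int_mul_eq ⌊x⌋ (x := x)
        rwa [mul_one] at this
      rw [this]
      exact hx s
    have he : Int.fract t = Int.fract t' := (huniq g.1 g.2).unique
      (hfr t (le_of_mem_maximizers_unitFrom hper ht.1))
      (hfr t' (le_of_mem_maximizers_unitFrom hper ht'.1))
    refine ⟨⌊t⌋ - ⌊t'⌋, ?_⟩
    rw [supLocation_eq ht, supLocation_eq ht', ← WithTop.coe_add, WithTop.coe_inj]
    have h1 := Int.floor_add_fract t
    have h2 := Int.floor_add_fract t'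
    push_cast
    linarith

/-- The first maximizer of a jointly upper semicontinuous family depends measurably on the
parameter. -/
lemma measurable_sInf_maximizers {W : Type*} [TopologicalSpace W] [MeasurableSpace W]
    [OpensMeasurableSpace W] {G : W → ℝ → ℝ}
    (hG : UpperSemicontinuous fun p : W × ℝ => G p.1 p.2) (I : CompactInterval) :
    Measurable fun w => sInf (maximizers (G w) I) := by
  have hGw : ∀ w, UpperSemicontinuous (G w) := fun w =>
    fun y q hq => (show Continuous fun y : ℝ => (w, y) by fun_prop).continuousAt.eventually
      (hG (w, y) q hq)
  have hopen : ∀ (K : Set ℝ), IsCompact K → ∀ q : ℝ, IsOpen {w | ∀ y ∈ K, G w y < q} := by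
    intro K hK q
    rw [isOpen_iff_eventually]
    intro w hw
    exact hK.eventually_forall_of_forall_eventually fun y hy => hG (w, y) q (hw y hy)
  -- The first maximizer is beyond `t` exactly when a rational separates the maximum up to `t` from
  -- the maximum over `I`. By compactness and joint semicontinuity, the sets where a maximum stays
  -- below `q` are open.
  have hset : ∀ t : ℝ, {w | t < sInf (maximizers (G w) I)} = ⋃ q : ℚ,
      {w | ∀ y ∈ Icc I.lo (min t I.hi), G w y < q} ∩ {w | ∀ y ∈ I.toSet, G w y < q}ᶜ := by
    intro t
    ext w
    obtain ⟨r, hr⟩ := exists_isLeast_maximizers (hGw w) I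
    simp only [mem_ofPred_eq, mem_iUnion, mem_inter_iff, mem_compl_iff]
    rw [hr.csInf_eq]
    constructor
    · intro htr
      have key : ∃ m : ℝ, m < G w r ∧ ∀ y ∈ Icc I.lo (min t I.hi), G w y ≤ m := by
        rcases (Icc I.lo (min t I.hi)).eq_empty_or_nonempty with he | hne
        · exact ⟨G w r - 1, by linarith, by simp [he]⟩
        · obtain ⟨y, hy, hmax⟩ := ((hGw w).upperSemicontinuousOn _).exists_isMaxOn hne
            isCompact_Icc
          refine ⟨G w y, lt_of_not_ge fun hge => ?_, fun z hz => hmax hz⟩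
          have hyI : y ∈ I.toSet := ⟨hy.1, hy.2.trans (min_le_right _ _)⟩
          have := hr.2 ⟨hyI, fun s hs => (hr.1.2 s hs).trans hge⟩
          exact (htr.trans_le this).not_ge (hy.2.trans (min_le_left _ _))
      obtain ⟨m, hm, hmy⟩ := key
      obtain ⟨q, hq1, hq2⟩ := exists_rat_btwn hm
      exact ⟨q, fun y hy => (hmy y hy).trans_lt hq1, fun h => (h r hr.1.1).not_gt hq2⟩
    · rintro ⟨q, h1, h2⟩
      by_contra! hrt
      have h3 := h1 r ⟨hr.1.1.1, le_min hrt hr.1.1.2⟩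
      exact h2 fun y hy => (hr.1.2 y hy).trans_lt h3
  refine measurable_of_Ioi fun t => ?_
  change MeasurableSet {w | t < sInf (maximizers (G w) I)}
  rw [hset]
  exact MeasurableSet.iUnion fun q => (hopen _ isCompact_Icc q).measurableSet.inter
    (hopen _ isCompact_Icc q).measurableSet.compl

end SupLocation

/-! ### The path of a layering and the space of layerings. -/

section LayerPath

/-- The points strictly between consecutive peaks, seen from the valley at `0`. -/
def IsGap (b a : ℕ → ℝ) (s : ℝ) : Prop :=
  (∃ i, layerSum b i < -s ∧ -s < layerSum b (i + 1)) ∨ ∃ i, layerSum a i < s ∧ s < layerSum a (i + 1)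

open Classical in
/-- The path with peaks at the points that are not in a gap; in the gaps it is negative and
carries the label `r` and the phase. -/
noncomputable def layerPath (r : ℝ) (b a : ℕ → ℝ) (d : ℝ) (y : ℝ) : ℝ :=
  if Int.fract y = 0 then 1
  else if IsGap b a (Int.fract y - d) then Real.arctan r - 4 + Real.cos (2 * Real.pi * y)
  else |Int.fract y - d|

variable {T : ℝ} {b a : ℕ → ℝ} {d : ℝ}

lemma IsLayering.nonneg_param (h : IsLayering T b a d) : 0 ≤ d := by simpa using h.sum_left 0

lemma IsLayering.param_le_one (h : IsLayering T b a d) : d ≤ 1 := by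
  have := h.sum_right 0
  simp at this
  exact this

lemma periodic_layerPath (r : ℝ) (b a : ℕ → ℝ) (d : ℝ) :
    Function.Periodic (layerPath r b a d) 1 := by
  intro y
  have : Real.cos (2 * Real.pi * (y + 1)) = Real.cos (2 * Real.pi * y) := by
    rw [mul_add, mul_one, Real.cos_add_two_pi]
  have hf : Int.fract (y + 1) = Int.fract y := Int.fract_add_one y
  rw [layerPath, layerPath, hf, this]

lemma background_neg (r y : ℝ) : Real.arctan r - 4 + Real.cos (2 * Real.pi * y) < 0 := by
  have h1 := Real.arctan_lt_pi_div_two r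
  have h2 := Real.cos_le_one (2 * Real.pi * y)
  have h3 := Real.pi_lt_d2
  linarith

lemma layerPath_of_fract_eq_zero (r : ℝ) (b a : ℕ → ℝ) (d : ℝ) {y : ℝ} (h : Int.fract y = 0) :
    layerPath r b a d y = 1 := by rw [layerPath, if_pos h]

lemma layerPath_of_isGap (r : ℝ) {y : ℝ} (h : Int.fract y ≠ 0) (h' : IsGap b a (Int.fract y - d)) :
    layerPath r b a d y = Real.arctan r - 4 + Real.cos (2 * Real.pi * y) := by
  rw [layerPath, if_neg h, if_pos h']

lemma layerPath_of_not_isGap (r : ℝ) {y : ℝ} (h : Int.fract y ≠ 0)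
    (h' : ¬ IsGap b a (Int.fract y - d)) : layerPath r b a d y = |Int.fract y - d| := by
  rw [layerPath, if_neg h, if_neg h']

lemma layerPath_lt_one (r : ℝ) (hd0 : 0 ≤ d) (hd1 : d ≤ 1) {y : ℝ} (h : Int.fract y ≠ 0) :
    layerPath r b a d y < 1 := by
  by_cases h' : IsGap b a (Int.fract y - d)
  · rw [layerPath_of_isGap r h h']
    exact (background_neg r y).trans one_pos
  · rw [layerPath_of_not_isGap r h h', abs_lt]
    have h1 := (Int.fract_nonneg y).lt_of_ne' h
    have h2 := Int.fract_lt_one y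
    constructor <;> linarith

lemma layerPath_le_one (r : ℝ) (hd0 : 0 ≤ d) (hd1 : d ≤ 1) (y : ℝ) : layerPath r b a d y ≤ 1 := by
  by_cases h : Int.fract y = 0
  · rw [layerPath_of_fract_eq_zero r b a d h]
  · exact (layerPath_lt_one r hd0 hd1 h).le

/-- The lengths of layers, as a space. -/
def layerings (T : ℝ) : Set ((ℕ → ℝ) × (ℕ → ℝ) × ℝ) := {k | IsLayering T k.1 k.2.1 k.2.2}

lemma layerings_eq (T : ℝ) : layerings T = {k | (∀ i j, i ≤ j → k.1 j ≤ k.1 i) ∧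
    (∀ i j, i ≤ j → k.2.1 j ≤ k.2.1 i) ∧ (∀ i, 0 ≤ k.1 i) ∧ (∀ i, 0 ≤ k.2.1 i) ∧ k.1 0 ≤ T ∧
    k.2.1 0 ≤ T ∧ T ≤ k.1 0 + k.2.1 0 ∧ (∀ n, ∑ i ∈ Finset.range n, k.1 i ≤ k.2.2) ∧
    ∀ n, ∑ i ∈ Finset.range n, k.2.1 i ≤ 1 - k.2.2} := by
  ext k
  constructor
  · rintro ⟨h1, h2, h3, h4, h5, h6, h7, h8, h9⟩
    exact ⟨fun _ _ h => h1 h, fun _ _ h => h2 h, h3, h4, h5, h6, h7, h8, h9⟩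
  · rintro ⟨h1, h2, h3, h4, h5, h6, h7, h8, h9⟩
    exact ⟨fun _ _ h => h1 _ _ h, fun _ _ h => h2 _ _ h, h3, h4, h5, h6, h7, h8, h9⟩

lemma isClosed_layerings (T : ℝ) : IsClosed (layerings T) := by
  rw [layerings_eq]
  simp only [Set.ofPred_and, Set.ofPred_forall]
  refine IsClosed.inter ?_ <| IsClosed.inter ?_ <| IsClosed.inter ?_ <| IsClosed.inter ?_ <|
    IsClosed.inter ?_ <| IsClosed.inter ?_ <| IsClosed.inter ?_ <| IsClosed.inter ?_ ?_
  · exact isClosed_iInter fun i => isClosed_iInter fun j => isClosed_iInter fun _ =>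
      isClosed_le (by fun_prop) (by fun_prop)
  · exact isClosed_iInter fun i => isClosed_iInter fun j => isClosed_iInter fun _ =>
      isClosed_le (by fun_prop) (by fun_prop)
  · exact isClosed_iInter fun i => isClosed_le (by fun_prop) (by fun_prop)
  · exact isClosed_iInter fun i => isClosed_le (by fun_prop) (by fun_prop)
  · exact isClosed_le (by fun_prop) (by fun_prop)
  · exact isClosed_le (by fun_prop) (by fun_prop)
  · exact isClosed_le (by fun_prop) (by fun_prop)
  · exact isClosed_iInter fun i => isClosed_le (by fun_prop) (by fun_prop)
  · exact isClosed_iInter fun i => isClosed_le (by fun_prop) (by fun_prop)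

/-- The mass conditions are inequalities on finite partial sums, so they survive coordinatewise
limits: mass lost from the layers becomes part of the atom. -/
lemma isCompact_layerings (T : ℝ) : IsCompact (layerings T) := by
  have hK : IsCompact ((univ.pi fun _ : ℕ => Icc (0 : ℝ) T) ×ˢ
      ((univ.pi fun _ : ℕ => Icc (0 : ℝ) T) ×ˢ Icc (0 : ℝ) 1)) :=
    (isCompact_univ_pi fun _ => isCompact_Icc).prod
      ((isCompact_univ_pi fun _ => isCompact_Icc).prod isCompact_Icc)
  refine hK.of_isClosed_subset (isClosed_layerings T) fun k hk => ?_
  exact ⟨fun i _ => ⟨hk.left_nonneg i, (hk.antitone_left i.zero_le).trans hk.left_le⟩,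
    fun i _ => ⟨hk.right_nonneg i, (hk.antitone_right i.zero_le).trans hk.right_le⟩,
    hk.nonneg_param, hk.param_le_one⟩

instance (T : ℝ) : CompactSpace (layerings T) := isCompact_iff_compactSpace.1 (isCompact_layerings T)

instance (T : ℝ) : PolishSpace (layerings T) := (isClosed_layerings T).polishSpace

/-- The labelled paths, with a phase. -/
noncomputable def shiftedLayerPath (T : ℝ) (w : ℝ × layerings T × ℝ) (y : ℝ) : ℝ :=
  layerPath w.1 w.2.1.1.1 w.2.1.1.2.1 w.2.1.1.2.2 (y + w.2.2)

lemma continuous_layerSum_fst (T : ℝ) (n : ℕ) :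
    Continuous fun k : layerings T => layerSum k.1.1 n :=
  continuous_finsetSum _ fun i _ => by fun_prop

lemma continuous_layerSum_snd (T : ℝ) (n : ℕ) :
    Continuous fun k : layerings T => layerSum k.1.2.1 n :=
  continuous_finsetSum _ fun i _ => by fun_prop

lemma isOpen_isGap (T : ℝ) :
    IsOpen {p : layerings T × ℝ | IsGap p.1.1.1 p.1.1.2.1 p.2} := by
  have h1 := fun n => (continuous_layerSum_fst T n).comp (continuous_fst (Y := ℝ))
  have h2 := fun n => (continuous_layerSum_snd T n).comp (continuous_fst (Y := ℝ))
  simp only [IsGap, Set.ofPred_or, Set.ofPred_exists, Set.ofPred_and]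
  refine IsOpen.union (isOpen_iUnion fun i => IsOpen.inter ?_ ?_)
    (isOpen_iUnion fun i => IsOpen.inter ?_ ?_)
  · exact isOpen_lt (h1 i) (by fun_prop)
  · exact isOpen_lt (by fun_prop) (h1 (i + 1))
  · exact isOpen_lt (h2 i) (by fun_prop)
  · exact isOpen_lt (by fun_prop) (h2 (i + 1))

/-- The value `1` at the integers is a global upper bound. Elsewhere the gaps are jointly open and
carry continuous negative values, while the values off the gaps are continuous and nonnegative. -/
lemma upperSemicontinuous_shiftedLayerPath (T : ℝ) :
    UpperSemicontinuous fun p : (ℝ × layerings T × ℝ) × ℝ => shiftedLayerPath T p.1 p.2 := by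
  rintro ⟨⟨r, k, u⟩, y⟩ q hq
  have hk := k.2
  by_cases h : Int.fract (y + u) = 0
  · have h1 : (1 : ℝ) < q := by
      simpa only [shiftedLayerPath, layerPath_of_fract_eq_zero _ _ _ _ h] using hq
    refine Eventually.of_forall fun p => lt_of_le_of_lt ?_ h1
    exact layerPath_le_one _ (IsLayering.nonneg_param p.1.2.1.2)
      (IsLayering.param_le_one p.1.2.1.2) _
  have hcy : Continuous fun p : (ℝ × layerings T × ℝ) × ℝ => p.2 + p.1.2.2 := by fun_prop
  have hfl : ∀ᶠ p : (ℝ × layerings T × ℝ) × ℝ in 𝓝 ((r, k, u), y),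
      Int.fract (p.2 + p.1.2.2) = p.2 + p.1.2.2 - ⌊y + u⌋ ∧ Int.fract (p.2 + p.1.2.2) ≠ 0 := by
    have hlt : ((⌊y + u⌋ : ℤ) : ℝ) < y + u := by
      have h1 := Int.floor_add_fract (y + u)
      have h2 := (Int.fract_nonneg (y + u)).lt_of_ne' h
      linarith
    filter_upwards [hcy.continuousAt.eventually (eventually_gt_nhds hlt),
      hcy.continuousAt.eventually (eventually_lt_nhds (Int.lt_floor_add_one (y + u)))] with p h1 h2
    have : ⌊p.2 + p.1.2.2⌋ = ⌊y + u⌋ := Int.floor_eq_iff.2 ⟨h1.le, h2⟩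
    rw [Int.fract, this]
    exact ⟨rfl, (sub_pos.2 h1).ne'⟩
  have hs : Continuous fun p : (ℝ × layerings T × ℝ) × ℝ =>
      p.2 + p.1.2.2 - ⌊y + u⌋ - p.1.2.1.1.2.2 := by fun_prop
  have hfr : Int.fract (y + u) = y + u - ⌊y + u⌋ := rfl
  by_cases hg : IsGap k.1.1 k.1.2.1 (Int.fract (y + u) - k.1.2.2)
  · have hq' : Real.arctan r - 4 + Real.cos (2 * Real.pi * (y + u)) < q := by
      simpa only [shiftedLayerPath, layerPath_of_isGap _ h hg] using hq
    have hcb : Continuous fun p : (ℝ × layerings T × ℝ) × ℝ =>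
        Real.arctan p.1.1 - 4 + Real.cos (2 * Real.pi * (p.2 + p.1.2.2)) := by
      have := Real.continuous_arctan.comp
        (continuous_fst.comp (continuous_fst (X := ℝ × layerings T × ℝ) (Y := ℝ)))
      exact (this.sub continuous_const).add (Real.continuous_cos.comp (by fun_prop))
    have hgo : ∀ᶠ p : (ℝ × layerings T × ℝ) × ℝ in 𝓝 ((r, k, u), y),
        IsGap p.1.2.1.1.1 p.1.2.1.1.2.1 (p.2 + p.1.2.2 - ⌊y + u⌋ - p.1.2.1.1.2.2) := by
      have hc : Continuous fun p : (ℝ × layerings T × ℝ) × ℝ =>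
        (p.1.2.1, p.2 + p.1.2.2 - ⌊y + u⌋ - p.1.2.1.1.2.2) := by fun_prop
      have hU : {p : layerings T × ℝ | IsGap p.1.1.1 p.1.1.2.1 p.2} ∈
          𝓝 (k, y + u - ⌊y + u⌋ - k.1.2.2) := (isOpen_isGap T).mem_nhds hg
      exact (hc.tendsto ((r, k, u), y)).eventually hU
    filter_upwards [hfl, hgo, hcb.continuousAt.eventually (eventually_lt_nhds hq')] with p h1 h2 h3
    rw [shiftedLayerPath, layerPath_of_isGap _ h1.2 (by rw [h1.1]; exact h2)]
    exact h3
  · have hq' : |Int.fract (y + u) - k.1.2.2| < q := by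
      simpa only [shiftedLayerPath, layerPath_of_not_isGap _ h hg] using hq
    filter_upwards [hfl, hs.abs.continuousAt.eventually (eventually_lt_nhds hq')] with p h1 h2
    rw [shiftedLayerPath]
    by_cases hg' : IsGap p.1.2.1.1.1 p.1.2.1.1.2.1 (Int.fract (p.2 + p.1.2.2) - p.1.2.1.1.2.2)
    · rw [layerPath_of_isGap _ h1.2 hg']
      exact (background_neg _ _).trans ((abs_nonneg _).trans_lt hq')
    · rw [layerPath_of_not_isGap _ h1.2 hg', h1.1]
      exact h2

lemma measurable_shiftedLayerPath (T y : ℝ) : Measurable fun w => shiftedLayerPath T w y := by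
  have h := (upperSemicontinuous_shiftedLayerPath T).measurable
  exact h.comp (measurable_id.prodMk measurable_const)

lemma upperSemicontinuous_shiftedLayerPath_right (T : ℝ) (w : ℝ × layerings T × ℝ) :
    UpperSemicontinuous (shiftedLayerPath T w) := fun y q hq =>
  (show Continuous fun y : ℝ => (w, y) by fun_prop).continuousAt.eventually
    (upperSemicontinuous_shiftedLayerPath T (w, y) q hq)

lemma existsUnique_maximizer_shiftedLayerPath (T : ℝ) (w : ℝ × layerings T × ℝ) :
    ∃! t : ℝ, t ∈ Set.Ico (0 : ℝ) 1 ∧ ∀ s, shiftedLayerPath T w s ≤ shiftedLayerPath T w t := by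
  have hk := w.2.1.2
  have h0 := IsLayering.nonneg_param hk
  have h1 := IsLayering.param_le_one hk
  have hone : ∀ y, Int.fract (y + w.2.2) = 0 → shiftedLayerPath T w y = 1 := fun y hy =>
    layerPath_of_fract_eq_zero _ _ _ _ hy
  have hz : Int.fract (Int.fract (-w.2.2) + w.2.2) = 0 := by
    have : Int.fract (-w.2.2) + w.2.2 = ((-⌊-w.2.2⌋ : ℤ) : ℝ) := by
      rw [Int.fract]
      push_cast
      ring
    rw [this, Int.fract_intCast]
  refine ⟨Int.fract (-w.2.2), ⟨⟨Int.fract_nonneg _, Int.fract_lt_one _⟩, fun s => ?_⟩, ?_⟩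
  · rw [hone _ hz]
    exact layerPath_le_one _ h0 h1 _
  · rintro t ⟨ht, hmax⟩
    have hft : Int.fract (t + w.2.2) = 0 := by
      by_contra hne
      have := hmax (Int.fract (-w.2.2))
      rw [hone _ hz] at this
      exact this.not_gt (layerPath_lt_one _ h0 h1 hne)
    obtain ⟨m, hm⟩ := Int.fract_eq_zero_iff.1 hft
    have : -w.2.2 = t - m := by linarith
    rw [this, Int.fract_sub_intCast]
    exact (Int.fract_eq_self.2 ht).symm

end LayerPath

/-! ### Which peak a window selects, and the resulting law. -/

section LayerPathMaximizer

variable {T : ℝ} {b a : ℕ → ℝ} {d : ℝ}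

lemma layerOffset_nonneg (hb : ∀ i, 0 ≤ b i) {s : ℝ} (hs : 0 ≤ s) : 0 ≤ layerOffset b s := by
  rcases exists_layer_or_forall_le b hs with ⟨i, h1, h2⟩ | h
  · rw [layerOffset_eq hb h1 h2]
    linarith
  · rw [layerOffset_eq_zero h]

lemma layerOffset_le (hb : ∀ i, 0 ≤ b i) {s : ℝ} (hs : 0 ≤ s) : layerOffset b s ≤ s := by
  rcases exists_layer_or_forall_le b hs with ⟨i, h1, h2⟩ | h
  · rw [layerOffset_eq hb h1 h2]
    have := monotone_layerSum hb i.zero_le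
    rw [layerSum_zero] at this
    linarith
  · rw [layerOffset_eq_zero h]
    exact hs

lemma layerOffset_le_of_antitone (hb : ∀ i, 0 ≤ b i) (hanti : Antitone b) {s : ℝ} (hs : 0 ≤ s) :
    layerOffset b s ≤ b 0 := by
  rcases exists_layer_or_forall_le b hs with ⟨i, h1, h2⟩ | h
  · rw [layerOffset_eq hb h1 h2]
    rw [layerSum_succ] at h2
    linarith [hanti i.zero_le]
  · rw [layerOffset_eq_zero h]
    exact hb 0

lemma layerOffset_eq_self (hb : ∀ i, 0 ≤ b i) {s : ℝ} (hs : 0 ≤ s) (h : s < b 0) :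
    layerOffset b s = s := by
  rw [layerOffset_eq hb (i := 0) (by simpa using hs) (by simpa [layerSum_succ] using h)]
  simp

lemma not_gap_sub_layerOffset (hb : ∀ i, 0 ≤ b i) {s : ℝ} (hs : 0 ≤ s) (i : ℕ) :
    ¬ (layerSum b i < s - layerOffset b s ∧ s - layerOffset b s < layerSum b (i + 1)) := by
  rintro ⟨h1, h2⟩
  rcases exists_layer_or_forall_le b hs with ⟨j, h3, h4⟩ | h
  · rw [layerOffset_eq hb h3 h4, sub_sub_cancel] at h1 h2
    have h5 : i < j := (monotone_layerSum hb).reflect_lt h1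
    have h6 : j < i + 1 := (monotone_layerSum hb).reflect_lt h2
    omega
  · rw [layerOffset_eq_zero h, sub_zero] at h2
    exact h2.not_ge (h _)

/-- With `not_gap_sub_layerOffset`, this makes `s - layerOffset b s` the first peak met when moving
from distance `s` towards the valley. -/
lemma exists_gap_of_sub_layerOffset_lt (hb : ∀ i, 0 ≤ b i) {s x : ℝ} (hs : 0 ≤ s)
    (h1 : s - layerOffset b s < x) (h2 : x ≤ s) :
    ∃ i, layerSum b i < x ∧ x < layerSum b (i + 1) := by
  rcases exists_layer_or_forall_le b hs with ⟨j, h3, h4⟩ | h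
  · rw [layerOffset_eq hb h3 h4, sub_sub_cancel] at h1
    exact ⟨j, h1, h2.trans_lt h4⟩
  · rw [layerOffset_eq_zero h, sub_zero] at h1
    exact absurd h2 h1.not_ge

lemma layerSum_nonneg (hb : ∀ i, 0 ≤ b i) (i : ℕ) : 0 ≤ layerSum b i := by
  simpa using monotone_layerSum hb i.zero_le

lemma layerPath_neg_of_isGap (r : ℝ) {y : ℝ} (h : Int.fract y ≠ 0)
    (h' : IsGap b a (Int.fract y - d)) : layerPath r b a d y < 0 := by
  rw [layerPath_of_isGap r h h']
  exact background_neg r y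

/-- The window ends before the first right peak `d + a 0`, so nonnegative values occur only at or
before the valley, where height decreases in `y`. The leftmost visible peak wins. -/
lemma isLeast_maximizers_layerPath_left (h : IsLayering T b a d) (r : ℝ) (hT : 0 < T) {v : ℝ}
    (hv : 0 < v) (hvd : v < d - T + a 0) :
    IsLeast (maximizers (fun y => layerPath r b a d (y + v)) (CompactInterval.zeroTo T hT))
      (layerOffset b (d - v)) := by
  have hb := h.left_nonneg
  have ha := h.right_nonneg
  have ha0 : a 0 ≤ 1 - d := by simpa using h.sum_right 1
  have hs : 0 ≤ d - v := by linarith [h.right_le]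
  have ho := layerOffset_nonneg hb hs
  have ho' := layerOffset_le hb hs
  have hoT := (layerOffset_le_of_antitone hb h.antitone_left hs).trans h.left_le
  set o := layerOffset b (d - v) with ho_def
  have hfr : ∀ y ∈ Icc 0 T, Int.fract (y + v) = y + v ∧ Int.fract (y + v) ≠ 0 := by
    intro y hy
    have : Int.fract (y + v) = y + v :=
      Int.fract_eq_self.2 ⟨by linarith [hy.1], by linarith [hy.2]⟩
    exact ⟨this, by rw [this]; linarith [hy.1]⟩
  have hpeak : layerPath r b a d (o + v) = d - v - o := by
    obtain ⟨h1, h2⟩ := hfr o ⟨ho, hoT⟩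
    rw [layerPath_of_not_isGap r h2, h1, abs_of_nonpos (by linarith)]
    · ring
    · rw [h1]
      rintro (⟨i, h3, h4⟩ | ⟨i, h3, h4⟩)
      · exact not_gap_sub_layerOffset hb hs i ⟨by linarith, by linarith⟩
      · linarith [layerSum_nonneg ha i]
  have hbefore : ∀ y ∈ Icc 0 T, y < o → layerPath r b a d (y + v) < 0 := by
    intro y hy hyo
    obtain ⟨h1, h2⟩ := hfr y hy
    refine layerPath_neg_of_isGap r h2 ?_
    rw [h1]
    obtain ⟨i, h3, h4⟩ := exists_gap_of_sub_layerOffset_lt hb hs (x := d - v - y)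
      (by linarith) (by linarith [hy.1])
    exact Or.inl ⟨i, by linarith, by linarith⟩
  refine ⟨⟨⟨ho, hoT⟩, fun y hy => ?_⟩, fun y hy => ?_⟩
  · simp only [hpeak]
    rcases lt_or_ge y o with hyo | hyo
    · exact (hbefore y hy hyo).le.trans (by linarith)
    obtain ⟨h1, h2⟩ := hfr y hy
    by_cases hg : IsGap b a (Int.fract (y + v) - d)
    · exact (layerPath_neg_of_isGap r h2 hg).le.trans (by linarith)
    · rw [layerPath_of_not_isGap r h2 hg, h1]
      rcases le_or_gt (y + v - d) 0 with h3 | h3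
      · rw [abs_of_nonpos h3]
        linarith
      · refine absurd (Or.inr ⟨0, ?_, ?_⟩) hg
        · rw [h1]
          simpa using h3
        · have : y ≤ T := hy.2
          rw [h1, layerSum_succ, layerSum_zero]
          linarith
  · by_contra! hyo
    have h1 := hbefore y hy.1 hyo
    have h2 := hy.2 o ⟨ho, hoT⟩
    simp only [hpeak] at h2
    linarith

/-- Since `T ≤ b 0 + a 0`, the window starts after the first left peak `d - b 0`. Only the
increasing side is visible and its rightmost peak wins. -/
lemma isLeast_maximizers_layerPath_right (h : IsLayering T b a d) (r : ℝ) (hT : 0 < T) {v : ℝ}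
    (hv : v < 1 - T) (hvd : d - T + a 0 < v) :
    IsLeast (maximizers (fun y => layerPath r b a d (y + v)) (CompactInterval.zeroTo T hT))
      (T - layerOffset a (v + T - d)) := by
  have hb := h.left_nonneg
  have ha := h.right_nonneg
  have hb0 : b 0 ≤ d := by simpa using h.sum_left 1
  have hTa := h.le_add
  have ha0 := ha 0
  have hs : 0 ≤ v + T - d := by linarith
  have ho := layerOffset_nonneg ha hs
  have ho' := layerOffset_le ha hs
  have hoT := (layerOffset_le_of_antitone ha h.antitone_right hs).trans h.right_le
  set o := layerOffset a (v + T - d) with ho_def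
  have hfr : ∀ y ∈ Icc 0 T, Int.fract (y + v) = y + v ∧ Int.fract (y + v) ≠ 0 := by
    intro y hy
    have hpos : 0 < y + v := by linarith [hy.1]
    have : Int.fract (y + v) = y + v :=
      Int.fract_eq_self.2 ⟨hpos.le, by linarith [hy.2]⟩
    exact ⟨this, by rw [this]; exact hpos.ne'⟩
  have hmem : T - o ∈ Icc 0 T := ⟨by linarith, by linarith⟩
  have hpeak : layerPath r b a d (T - o + v) = v + T - d - o := by
    obtain ⟨h1, h2⟩ := hfr _ hmem
    rw [layerPath_of_not_isGap r h2, h1, abs_of_nonneg (by linarith)]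
    · ring
    · rw [h1]
      rintro (⟨i, h3, h4⟩ | ⟨i, h3, h4⟩)
      · linarith [layerSum_nonneg hb i]
      · exact not_gap_sub_layerOffset ha hs i ⟨by linarith, by linarith⟩
  have hle : ∀ y ∈ Icc 0 T, layerPath r b a d (y + v) < 0 ∨
      (y ≤ T - o ∧ layerPath r b a d (y + v) = y + v - d) := by
    intro y hy
    obtain ⟨h1, h2⟩ := hfr y hy
    by_cases hg : IsGap b a (Int.fract (y + v) - d)
    · exact Or.inl (layerPath_neg_of_isGap r h2 hg)
    rw [h1] at hg
    have h3 : 0 ≤ y + v - d := by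
      by_contra! hlt
      refine hg (Or.inl ⟨0, ?_, ?_⟩)
      · simpa using hlt
      · rw [layerSum_succ, layerSum_zero]
        linarith [hy.1]
    refine Or.inr ⟨?_, by rw [layerPath_of_not_isGap r h2 (by rwa [h1]), h1, abs_of_nonneg h3]⟩
    by_contra! hlt
    obtain ⟨i, h4⟩ := exists_gap_of_sub_layerOffset_lt ha hs (x := y + v - d)
      (by linarith) (by linarith [hy.2])
    exact hg (Or.inr ⟨i, h4⟩)
  refine ⟨⟨hmem, fun y hy => ?_⟩, fun y hy => ?_⟩
  · simp only [hpeak]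
    rcases hle y hy with h1 | ⟨h1, h2⟩
    · linarith
    · linarith
  · have h3 := hy.2 _ hmem
    simp only [hpeak] at h3
    rcases hle y hy.1 with h1 | ⟨h1, h2⟩
    · linarith
    · linarith

lemma isLeast_maximizers_layerPath_top (h : IsLayering T b a d) (r : ℝ) (hT : 0 < T) (hT1 : T ≤ 1)
    {v : ℝ} (hv : 1 - T < v) (hv1 : v < 1) :
    IsLeast (maximizers (fun y => layerPath r b a d (y + v)) (CompactInterval.zeroTo T hT))
      (1 - v) := by
  have hmem : 1 - v ∈ Icc 0 T := ⟨by linarith, by linarith⟩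
  have hpeak : layerPath r b a d (1 - v + v) = 1 :=
    layerPath_of_fract_eq_zero r b a d (by simp)
  refine ⟨⟨hmem, fun y _ => ?_⟩, fun y hy => ?_⟩
  · simp only [hpeak]
    exact layerPath_le_one r h.nonneg_param h.param_le_one _
  · by_contra! hlt
    have h3 := hy.2 _ hmem
    simp only [hpeak] at h3
    have h0 : (0 : ℝ) ≤ y := hy.1.1
    have hfr : Int.fract (y + v) = y + v := Int.fract_eq_self.2 ⟨by linarith, by linarith⟩
    refine h3.not_gt (layerPath_lt_one r h.nonneg_param h.param_le_one ?_)
    rw [hfr]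
    linarith

lemma volume_restrict_Ioo_add {x y z : ℝ} (hxy : x ≤ y) (hyz : y ≤ z) :
    (volume.restrict (Ioo x z) : Measure ℝ) =
      volume.restrict (Ioo x y) + volume.restrict (Ioo y z) := by
  rw [Measure.restrict_congr_set Ioo_ae_eq_Ioc, Measure.restrict_congr_set (Ioo_ae_eq_Ioc (a := x)),
    Measure.restrict_congr_set (Ioo_ae_eq_Ioc (a := y)), ← Ioc_union_Ioc_eq_Ioc hxy hyz,
    Measure.restrict_union (Ioc_disjoint_Ioc_of_le le_rfl) measurableSet_Ioc]

lemma map_const_sub_volume_restrict_Ioo (c x y : ℝ) :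
    (volume.restrict (Ioo x y) : Measure ℝ).map (fun v => c - v) =
      volume.restrict (Ioo (c - y) (c - x)) := by
  have h := (Measure.measurePreserving_sub_left (volume : Measure ℝ) c).restrict_preimage
    (s := Ioo (c - y) (c - x)) measurableSet_Ioo
  have e : (fun v => c - v) ⁻¹' Ioo (c - y) (c - x) = Ioo x y := by simp
  rw [e] at h
  exact h.map_eq

lemma map_add_const_volume_restrict_Ioo (c x y : ℝ) :
    (volume.restrict (Ioo x y) : Measure ℝ).map (fun v => v + c) =
      volume.restrict (Ioo (x + c) (y + c)) := by
  have h := (measurePreserving_add_right (volume : Measure ℝ) c).restrict_preimage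
    (s := Ioo (x + c) (y + c)) measurableSet_Ioo
  have e : (fun v => v + c) ⁻¹' Ioo (x + c) (y + c) = Ioo x y := by simp
  rw [e] at h
  exact h.map_eq

/-- The law of the location of the supremum of a layer path with a uniform phase. -/
lemma map_sInf_maximizers_layerPath (h : IsLayering T b a d) (r : ℝ) (hT : 0 < T) (hT1 : T ≤ 1) :
    (volume.restrict (Ioo (0 : ℝ) 1)).map (fun v => sInf (maximizers
      (fun y => layerPath r b a d (y + v)) (CompactInterval.zeroTo T hT))) =
      layerMeasure b d + (layerMeasure a (1 - d)).map (fun t => T - t) := by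
  have hb := h.left_nonneg
  have ha := h.right_nonneg
  have hab := h.le_add
  have hbT := h.left_le
  have haT := h.right_le
  have hb0 : b 0 ≤ d := by simpa using h.sum_left 1
  have ha0 : a 0 ≤ 1 - d := by simpa using h.sum_right 1
  have h0a := ha 0
  have hmb := measurable_layerOffset hb
  have hma := (measurable_layerOffset ha).const_sub T
  have hm : Measurable fun v => sInf (maximizers (fun y => layerPath r b a d (y + v))
      (CompactInterval.zeroTo T hT)) :=
    (measurable_sInf_maximizers (upperSemicontinuous_shiftedLayerPath T)
      (CompactInterval.zeroTo T hT)).comp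
      (f := fun v : ℝ => (r, (⟨(b, a, d), h⟩ : layerings T), v)) (by fun_prop)
  set f : ℝ → ℝ := fun v => sInf (maximizers (fun y => layerPath r b a d (y + v))
      (CompactInterval.zeroTo T hT))
  have hcongr : ∀ {x y : ℝ} {p q : ℝ → ℝ}, (∀ v ∈ Ioo x y, p v = q v) →
      (volume.restrict (Ioo x y)).map p = (volume.restrict (Ioo x y)).map q := fun hpq =>
    Measure.map_congr ((ae_restrict_iff' measurableSet_Ioo).2 (Eventually.of_forall hpq))
  -- The left windows miss the distances below `T - a 0` and the right ones those below `a 0`. By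
  -- `e4` and `e5` the missing pieces have images `(0, T - a 0)` and `(T - a 0, T)`, together the
  -- uniform measure produced in `e3` by the windows containing the top.
  have e1 : (volume.restrict (Ioo 0 (d - T + a 0))).map f =
      (volume.restrict (Ioo (T - a 0) d)).map (layerOffset b) := by
    rw [hcongr (q := fun v => layerOffset b (d - v)) fun v hv =>
      (isLeast_maximizers_layerPath_left h r hT hv.1 hv.2).csInf_eq]
    rw [← Function.comp_def (layerOffset b), ← Measure.map_map hmb (by fun_prop),
      map_const_sub_volume_restrict_Ioo, sub_zero, show d - (d - T + a 0) = T - a 0 by ring]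
  have e2 : (volume.restrict (Ioo (d - T + a 0) (1 - T))).map f =
      (volume.restrict (Ioo (a 0) (1 - d))).map (fun s => T - layerOffset a s) := by
    rw [hcongr (q := fun v => T - layerOffset a (v + (T - d))) fun v hv => by
      rw [← add_sub_assoc]
      exact (isLeast_maximizers_layerPath_right h r hT hv.2 hv.1).csInf_eq]
    rw [← Function.comp_def (fun s => T - layerOffset a s), ← Measure.map_map hma (by fun_prop),
      map_add_const_volume_restrict_Ioo, show d - T + a 0 + (T - d) = a 0 by ring,
      show 1 - T + (T - d) = 1 - d by ring]
  have e3 : (volume.restrict (Ioo (1 - T) 1)).map f = volume.restrict (Ioo 0 T) := by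
    rw [hcongr (q := fun v => 1 - v) fun v hv =>
      (isLeast_maximizers_layerPath_top h r hT hT1 hv.1 hv.2).csInf_eq,
      map_const_sub_volume_restrict_Ioo, sub_self, sub_sub_cancel]
  have e4 : (volume.restrict (Ioo 0 (T - a 0))).map (layerOffset b) =
      volume.restrict (Ioo 0 (T - a 0)) := by
    rw [hcongr (p := layerOffset b) (q := fun v => v) fun v hv => layerOffset_eq_self hb hv.1.le (by linarith [hv.2]),
      Measure.map_id']
  have e5 : (volume.restrict (Ioo 0 (a 0))).map (fun s => T - layerOffset a s) =
      volume.restrict (Ioo (T - a 0) T) := by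
    rw [hcongr (q := fun v => T - v) fun v hv => by rw [layerOffset_eq_self ha hv.1.le hv.2],
      map_const_sub_volume_restrict_Ioo, sub_zero]
  rw [← map_layerOffset hb h.sum_left, ← map_layerOffset ha h.sum_right,
    Measure.map_map (by fun_prop) (measurable_layerOffset ha), Function.comp_def,
    volume_restrict_Ioo_add (x := 0) (y := T - a 0) (z := d) (by linarith) (by linarith),
    volume_restrict_Ioo_add (x := 0) (y := a 0) (z := 1 - d) h0a ha0,
    volume_restrict_Ioo_add (x := 0) (y := 1 - T) (z := 1) (by linarith) (by linarith),
    volume_restrict_Ioo_add (x := 0) (y := d - T + a 0) (z := 1 - T) (by linarith) (by linarith),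
    Measure.map_add _ _ hm, Measure.map_add _ _ hm, Measure.map_add _ _ hmb,
    Measure.map_add _ _ hma, e1, e2, e3, e4, e5,
    volume_restrict_Ioo_add (x := 0) (y := T - a 0) (z := T) (by linarith) (by linarith)]
  abel

end LayerPathMaximizer

/-! ### Paths with a uniform phase on the circle. -/

section CirclePath

instance : IsProbabilityMeasure (volume : Measure UnitAddCircle) := ⟨UnitAddCircle.measure_univ⟩

/-- The representative in `[0, 1)` of a point of the circle. -/
noncomputable def circleRep (x : UnitAddCircle) : ℝ := (AddCircle.equivIco 1 0 x : ℝ)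

lemma coe_circleRep (x : UnitAddCircle) : (circleRep x : UnitAddCircle) = x :=
  (AddCircle.equivIco 1 0).symm_apply_apply x

lemma measurable_circleRep : Measurable circleRep :=
  measurable_subtype_coe.comp (AddCircle.measurableEquivIco 1 0).measurable

lemma circleRep_coe (u : ℝ) : circleRep (u : UnitAddCircle) = Int.fract u := by
  rw [circleRep, AddCircle.coe_equivIco_mk_apply]
  simp

lemma map_circleRep : (volume : Measure UnitAddCircle).map circleRep = volume.restrict (Ioo 0 1) := by
  have h := UnitAddCircle.measurePreserving_mk 0
  rw [← h.map_eq, Measure.map_map measurable_circleRep h.measurable, zero_add,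
    ← Measure.restrict_congr_set Ioo_ae_eq_Ioc]
  have : (volume.restrict (Ioo (0 : ℝ) 1)).map (circleRep ∘ ((↑) : ℝ → UnitAddCircle)) =
      (volume.restrict (Ioo (0 : ℝ) 1)).map (fun u => u) :=
    Measure.map_congr ((ae_restrict_iff' measurableSet_Ioo).2 (Eventually.of_forall fun u hu => by
      rw [Function.comp_apply, circleRep_coe, Int.fract_eq_self.2 ⟨hu.1.le, hu.2⟩]))
  rw [this, Measure.map_id']

variable {K : Type} (G : K → ℝ → ℝ)

/-- The path of a periodic family with a phase on the circle. -/
noncomputable def circlePath (z : K × UnitAddCircle) (y : ℝ) : ℝ := G z.1 (y + circleRep z.2)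

variable {G}

lemma circlePath_coe (hG : ∀ k, Function.Periodic (G k) 1) (k : K) (u y : ℝ) :
    circlePath G (k, (u : UnitAddCircle)) y = G k (y + u) := by
  have := (hG k).sub_int_mul_eq ⌊u⌋ (x := y + u)
  rw [mul_one] at this
  rw [circlePath, circleRep_coe, ← this, Int.fract, add_sub_assoc]

lemma periodic_circlePath (hG : ∀ k, Function.Periodic (G k) 1) (z : K × UnitAddCircle) :
    Function.Periodic (circlePath G z) 1 := fun y => by
  rw [circlePath, circlePath, add_right_comm, hG]

lemma pathShift_circlePath (hG : ∀ k, Function.Periodic (G k) 1) (c : ℝ) (z : K × UnitAddCircle) :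
    pathShift c (circlePath G z) = circlePath G (z.1, z.2 + (c : UnitAddCircle)) := by
  ext y
  have : z.2 + (c : UnitAddCircle) = ((c + circleRep z.2 : ℝ) : UnitAddCircle) := by
    rw [AddCircle.coe_add, coe_circleRep, add_comm]
  rw [this, circlePath_coe hG, pathShift, circlePath, add_assoc]

variable (G) in
/-- The class of all shifts of a family of periodic paths. -/
def circleClass (hG : ∀ k, Function.Periodic (G k) 1) : PathClass where
  carrier := range (circlePath G)
  periodic := by
    rintro _ ⟨z, rfl⟩
    exact periodic_circlePath hG z
  shift_mem := by
    rintro _ ⟨z, rfl⟩ c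
    rw [pathShift_circlePath hG]
    exact mem_range_self _

/-- A point of the parameter space as a path. -/
noncomputable def toCirclePath (hG : ∀ k, Function.Periodic (G k) 1) (z : K × UnitAddCircle) :
    (circleClass G hG).Path := ⟨circlePath G z, mem_range_self z⟩

variable [MeasurableSpace K]

lemma measurable_circlePath (hm : Measurable (Function.uncurry G)) (y : ℝ) :
    Measurable fun z => circlePath G z y :=
  hm.comp (measurable_fst.prodMk ((measurable_circleRep.comp measurable_snd).const_add y))

/-- If the rational coordinates separate the parameters, measurability on the cylindrical σ-field
can be tested on the parameters. -/
lemma measurable_of_comp_toCirclePath [StandardBorelSpace K]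
    (hG : ∀ k, Function.Periodic (G k) 1) (hm : Measurable (Function.uncurry G))
    (hinj : ∀ z z', (∀ q : ℚ, circlePath G z q = circlePath G z' q) → z = z')
    {β : Type*} [MeasurableSpace β] {F : (circleClass G hG).Path → β}
    (hF : Measurable fun z => F (toCirclePath hG z)) : Measurable F := by
  -- Lusin–Souslin: an injective measurable map on a standard Borel space has measurable images, so
  -- the parameter is a measurable function of the rational values of the path.
  have he : MeasurableEmbedding fun (z : K × UnitAddCircle) (q : ℚ) => circlePath G z q :=
    Measurable.measurableEmbedding (measurable_pi_lambda _ fun q => measurable_circlePath hm q)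
      fun z z' h => hinj z z' fun q => congrFun h q
  intro S hS
  have hr : Measurable fun (g : (circleClass G hG).Path) (q : ℚ) => g.1 q :=
    measurable_pi_lambda _ fun q => (measurable_pi_apply (q : ℝ)).comp measurable_subtype_coe
  have : F ⁻¹' S = (fun (g : (circleClass G hG).Path) (q : ℚ) => g.1 q) ⁻¹'
      ((fun (z : K × UnitAddCircle) (q : ℚ) => circlePath G z q) ''
        ((fun z => F (toCirclePath hG z)) ⁻¹' S)) := by
    ext ⟨g, z, rfl⟩
    constructor
    · exact fun h => ⟨z, h, rfl⟩
    · rintro ⟨z', h, hz⟩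
      obtain rfl := hinj z' z fun q => congrFun hz q
      exact h
  rw [this]
  exact hr (he.measurableSet_image.2 (hF hS))

/-- With an independent uniform phase, the process is stationary. -/
lemma isStationaryProcess_circlePath (hG : ∀ k, Function.Periodic (G k) 1)
    (hm : Measurable (Function.uncurry G)) (m : Measure K) [SFinite m] :
    IsStationaryProcess (m.prod volume) fun t z => circlePath G z t where
  measurable t := measurable_circlePath hm t
  stationary c := by
    have hmp : MeasurePreserving (fun z : K × UnitAddCircle => (z.1, z.2 + (c : UnitAddCircle)))
        (m.prod volume) (m.prod volume) :=
      (MeasurePreserving.id m).prod (measurePreserving_add_right volume (c : UnitAddCircle))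
    have hme : Measurable fun (z : K × UnitAddCircle) (t : ℝ) => circlePath G z t :=
      measurable_pi_lambda _ fun t => measurable_circlePath hm t
    conv_rhs => rw [← hmp.map_eq, Measure.map_map hme hmp.measurable]
    congr 1
    ext z t
    exact congrFun (pathShift_circlePath hG c z) t

lemma mem_locationLaws_circleClass (hG : ∀ k, Function.Periodic (G k) 1)
    (hm : Measurable (Function.uncurry G)) {L : (circleClass G hG).Path → CompactInterval → WithTop ℝ}
    {R : Set (ℝ → ℝ)} (hR : ∀ z, circlePath G z ∈ R) {T : ℝ} (hT : 0 < T)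
    {F : ProbabilityMeasure (WithTop ℝ)} (m : Measure K) [IsProbabilityMeasure m]
    (hF : (F : Measure (WithTop ℝ)) = (m.prod volume).map
      fun z => L (toCirclePath hG z) (CompactInterval.zeroTo T hT)) :
    F ∈ locationLaws (circleClass G hG) L R T hT :=
  ⟨K × UnitAddCircle, inferInstance, m.prod volume, inferInstance, fun t z => circlePath G z t,
    fun z => mem_range_self z, isStationaryProcess_circlePath hG hm m, hR, hF⟩

end CirclePath

/-- Invariant intrinsic location functionals can be pulled back along equivariant maps. -/
lemma IsInvariantLocation.comp {H H' : PathClass} {L : H.Path → CompactInterval → WithTop ℝ}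
    (hL : IsInvariantLocation H L) (j : H'.Path → H.Path)
    (hj : ∀ c g, j (H'.shift c g) = H.shift c (j g))
    (hm : ∀ I, Measurable fun g => L (j g) I) : IsInvariantLocation H' fun g => L (j g) where
  measurable := hm
  mem g := hL.mem (j g)
  shift_compat g I c := by rw [hj, ← hL.shift_compat]
  stable g := hL.stable (j g)
  exists_mono g := hL.exists_mono (j g)
  ne_top g := hL.ne_top (j g)
  invariant g := hL.invariant (j g)

/-! ### Recovering level and phase from a cosine. -/

section Wave

/-- A cosine of period `1` determines its mean and its phase. -/
lemma eq_and_phase_eq_of_eventually {α α' u u' y₀ : ℝ}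
    (h : ∀ᶠ y in 𝓝 y₀, α + Real.cos (2 * Real.pi * (y + u)) =
      α' + Real.cos (2 * Real.pi * (y + u'))) :
    α = α' ∧ (u : UnitAddCircle) = (u' : UnitAddCircle) := by
  -- By analyticity local agreement is global; comparing the maxima then gives equal levels and
  -- phases equal modulo one.
  have han : ∀ α u : ℝ, AnalyticOnNhd ℝ (fun y => α + Real.cos (2 * Real.pi * (y + u))) univ :=
    fun α u y _ => by fun_prop
  have heq := (han α u).eq_of_eventuallyEq (han α' u') h
  have h1 := congrFun heq (-u)
  have h2 := congrFun heq (-u')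
  simp only [neg_add_cancel, mul_zero, Real.cos_zero] at h1 h2
  have h3 := Real.cos_le_one (2 * Real.pi * (-u + u'))
  have h4 := Real.cos_le_one (2 * Real.pi * (-u' + u))
  have hα : α = α' := by linarith
  refine ⟨hα, ?_⟩
  have h5 : Real.cos (2 * Real.pi * (-u + u')) = 1 := by linarith
  obtain ⟨n, hn⟩ := (Real.cos_eq_one_iff _).1 h5
  have h6 : u' = u + n := by
    have := Real.pi_pos
    have : (n : ℝ) = -u + u' := by
      apply mul_right_cancel₀ (mul_pos two_pos this).ne'
      linarith
    linarith
  rw [h6, AddCircle.coe_add, (AddCircle.coe_eq_zero_iff (1 : ℝ) (x := (n : ℝ))).2 ⟨n, by simp⟩, add_zero]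

end Wave

/-! ### Coded layer paths and their continuous counterparts. -/

section LayerFamily

variable {T : ℝ}

/-- The layer paths, labelled by their parameters. -/
noncomputable def layerFamily (e : layerings T → ℝ) (k : layerings T) : ℝ → ℝ :=
  layerPath (e k) k.1.1 k.1.2.1 k.1.2.2

/-- Continuous paths with the same labels. -/
noncomputable def waveFamily (e : layerings T → ℝ) (k : layerings T) (y : ℝ) : ℝ :=
  Real.arctan (e k) + Real.cos (2 * Real.pi * y)

variable {e : layerings T → ℝ}

lemma periodic_layerFamily (e : layerings T → ℝ) (k : layerings T) :
    Function.Periodic (layerFamily e k) 1 := periodic_layerPath _ _ _ _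

lemma periodic_waveFamily (e : layerings T → ℝ) (k : layerings T) :
    Function.Periodic (waveFamily e k) 1 := fun y => by
  rw [waveFamily, waveFamily, mul_add, mul_one, Real.cos_add_two_pi]

lemma measurable_uncurry_layerFamily (he : Measurable e) :
    Measurable (Function.uncurry (layerFamily e)) := by
  have h := (measurable_shiftedLayerPath T 0).comp
    (f := fun p : layerings T × ℝ => (e p.1, p.1, p.2)) (by fun_prop)
  have e0 : Function.uncurry (layerFamily e) =
      (fun w => shiftedLayerPath T w 0) ∘ fun p : layerings T × ℝ => (e p.1, p.1, p.2) := by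
    ext p
    simp only [Function.comp_apply, shiftedLayerPath, zero_add]
    rfl
  rw [e0]
  exact h

lemma measurable_uncurry_waveFamily (he : Measurable e) :
    Measurable (Function.uncurry (waveFamily e)) := by
  have h1 : Measurable fun p : layerings T × ℝ => Real.arctan (e p.1) :=
    Real.measurable_arctan.comp (he.comp measurable_fst)
  have h2 : Measurable fun p : layerings T × ℝ => Real.cos (2 * Real.pi * p.2) := by fun_prop
  exact h1.add h2

lemma continuous_circlePath_waveFamily (e : layerings T → ℝ) (z : layerings T × UnitAddCircle) :
    Continuous (circlePath (waveFamily e) z) := by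
  unfold circlePath waveFamily
  fun_prop

lemma eq_of_eventually_wave_eq (he : Function.Injective e) {z z' : layerings T × UnitAddCircle}
    {y₀ : ℝ} (h : ∀ᶠ y in 𝓝 y₀, circlePath (waveFamily e) z y = circlePath (waveFamily e) z' y) :
    z = z' := by
  obtain ⟨h1, h2⟩ := eq_and_phase_eq_of_eventually h
  rw [coe_circleRep, coe_circleRep] at h2
  exact Prod.ext (he (Real.arctan_injective h1)) h2

lemma injective_circlePath_waveFamily (he : Function.Injective e)
    (z z' : layerings T × UnitAddCircle)
    (h : ∀ q : ℚ, circlePath (waveFamily e) z q = circlePath (waveFamily e) z' q) : z = z' := by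
  have := Rat.isDenseEmbedding_coe_real.dense.equalizer (continuous_circlePath_waveFamily e z)
    (continuous_circlePath_waveFamily e z') (funext h)
  exact eq_of_eventually_wave_eq he (y₀ := 0) (Eventually.of_forall (congrFun this))

/-- On some open interval a layer path is the wave. -/
lemma exists_interval_layerFamily (hT : 0 < T) (k : layerings T) : ∃ x y, x < y ∧
    ∀ s ∈ Ioo x y, layerFamily e k s = waveFamily e k s - 4 := by
  obtain ⟨⟨b, a, d⟩, h⟩ := k
  change IsLayering T b a d at h
  have hb0 : b 0 ≤ d := by simpa using h.sum_left 1
  have ha0 : a 0 ≤ 1 - d := by simpa using h.sum_right 1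
  have hab := h.le_add
  have hd0 := h.nonneg_param
  have hd1 := h.param_le_one
  have key : ∀ s, s ∈ Ioo 0 1 → IsGap b a (s - d) →
      layerFamily e ⟨(b, a, d), h⟩ s = waveFamily e ⟨(b, a, d), h⟩ s - 4 := by
    intro s hs hg
    have hf : Int.fract s = s := Int.fract_eq_self.2 ⟨hs.1.le, hs.2⟩
    rw [layerFamily, layerPath_of_isGap _ (by rw [hf]; exact hs.1.ne') (by rwa [hf]), waveFamily]
    ring
  -- From `0 < T ≤ b 0 + a 0`, at least one of the two gaps next to the valley is non-degenerate.
  rcases (h.left_nonneg 0).eq_or_lt with h0 | h0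
  · refine ⟨d, d + a 0, by linarith, fun s hs => key s ⟨?_, ?_⟩ (Or.inr ⟨0, ?_, ?_⟩)⟩
    · exact hd0.trans_lt hs.1
    · linarith [hs.2]
    · rw [layerSum_zero]
      linarith [hs.1]
    · rw [layerSum_succ, layerSum_zero]
      linarith [hs.2]
  · refine ⟨d - b 0, d, by linarith, fun s hs => key s ⟨?_, ?_⟩ (Or.inl ⟨0, ?_, ?_⟩)⟩
    · linarith [hs.1]
    · exact hs.2.trans_le hd1
    · rw [layerSum_zero]
      linarith [hs.2]
    · rw [layerSum_succ, layerSum_zero]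
      linarith [hs.1]

lemma layerFamily_eq_of_neg {k : layerings T} {s : ℝ} (h : layerFamily e k s < 0) :
    layerFamily e k s = waveFamily e k s - 4 := by
  rw [layerFamily] at h ⊢
  by_cases h1 : Int.fract s = 0
  · rw [layerPath_of_fract_eq_zero _ _ _ _ h1] at h
    exact absurd h (by norm_num)
  by_cases h2 : IsGap k.1.1 k.1.2.1 (Int.fract s - k.1.2.2)
  · rw [layerPath_of_isGap _ h1 h2, waveFamily]
    ring
  · rw [layerPath_of_not_isGap _ h1 h2] at h
    exact absurd h (abs_nonneg _).not_gt

lemma waveFamily_sub_neg (k : layerings T) (s : ℝ) : waveFamily e k s - 4 < 0 := by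
  have := background_neg (e k) s
  rw [waveFamily]
  linarith

/-- Negative values occur only in gaps, where the path is a wave lowered by `4`. On an interval
inside a gap of the first path, the second path is negative at every rational too, so both waves
agree there, and a wave determines code and phase. -/
lemma injective_circlePath_layerFamily (hT : 0 < T) (he : Function.Injective e)
    (z z' : layerings T × UnitAddCircle)
    (h : ∀ q : ℚ, circlePath (layerFamily e) z q = circlePath (layerFamily e) z' q) : z = z' := by
  obtain ⟨x, y, hxy, hw⟩ := exists_interval_layerFamily (e := e) hT z.1
  set U := Ioo (x - circleRep z.2) (y - circleRep z.2) with hU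
  have hq : ∀ s ∈ U ∩ range ((↑) : ℚ → ℝ),
      circlePath (waveFamily e) z s = circlePath (waveFamily e) z' s := by
    rintro _ ⟨hs, q, rfl⟩
    have h1 : layerFamily e z.1 (q + circleRep z.2) = waveFamily e z.1 (q + circleRep z.2) - 4 :=
      hw _ ⟨by linarith [hs.1], by linarith [hs.2]⟩
    have h2 := h q
    have h3 := waveFamily_sub_neg (e := e) z.1 (q + circleRep z.2)
    simp only [circlePath] at h2 ⊢
    have h4 := layerFamily_eq_of_neg (e := e) (k := z'.1) (s := q + circleRep z'.2) (by
      rw [← h2, h1]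
      exact h3)
    linarith
  have hcl : IsClosed {s | circlePath (waveFamily e) z s = circlePath (waveFamily e) z' s} :=
    isClosed_eq (continuous_circlePath_waveFamily e z) (continuous_circlePath_waveFamily e z')
  have hd : Dense (range ((↑) : ℚ → ℝ)) := Rat.isDenseEmbedding_coe_real.dense
  have hUo : IsOpen U := isOpen_Ioo
  have hsub : U ⊆ {s | circlePath (waveFamily e) z s = circlePath (waveFamily e) z' s} :=
    (hd.open_subset_closure_inter hUo).trans (closure_minimal hq hcl)
  have hmem : (x + y) / 2 - circleRep z.2 ∈ U := ⟨by linarith, by linarith⟩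
  exact eq_of_eventually_wave_eq he (mem_of_superset (hUo.mem_nhds hmem) hsub)

/-- The location of the supremum over `[0, T]` of a layer path. -/
noncomputable def layerLocation (e : layerings T → ℝ) (I : CompactInterval)
    (z : layerings T × UnitAddCircle) : ℝ := sInf (maximizers (circlePath (layerFamily e) z) I)

lemma measurable_layerLocation (he : Measurable e) (I : CompactInterval) :
    Measurable (layerLocation e I) :=
  (measurable_sInf_maximizers (upperSemicontinuous_shiftedLayerPath T) I).comp
    (f := fun z : layerings T × UnitAddCircle => (e z.1, z.1, circleRep z.2))
    ((he.comp measurable_fst).prodMk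
      (measurable_fst.prodMk (measurable_circleRep.comp measurable_snd)))

lemma upperSemicontinuous_of_mem_circleClass {g : ℝ → ℝ}
    (hg : g ∈ (circleClass (layerFamily e) (periodic_layerFamily e)).carrier) :
    UpperSemicontinuous g := by
  obtain ⟨z, rfl⟩ := hg
  exact upperSemicontinuous_shiftedLayerPath_right T (e z.1, z.1, circleRep z.2)

lemma existsUnique_of_mem_circleClass {g : ℝ → ℝ}
    (hg : g ∈ (circleClass (layerFamily e) (periodic_layerFamily e)).carrier) :
    ∃! t : ℝ, t ∈ Set.Ico (0 : ℝ) 1 ∧ ∀ s : ℝ, g s ≤ g t := by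
  obtain ⟨z, rfl⟩ := hg
  exact existsUnique_maximizer_shiftedLayerPath T (e z.1, z.1, circleRep z.2)

lemma supLocation_toCirclePath (z : layerings T × UnitAddCircle) (I : CompactInterval) :
    supLocation _ (toCirclePath (periodic_layerFamily e) z) I =
      (layerLocation e I z : WithTop ℝ) := by
  obtain ⟨t, ht⟩ := exists_isLeast_maximizers
    (upperSemicontinuous_of_mem_circleClass (toCirclePath (periodic_layerFamily e) z).2) I
  rw [supLocation_eq ht, layerLocation]
  exact congrArg _ ht.csInf_eq.symm

lemma measurable_coe_withTop : Measurable fun t : ℝ => (t : WithTop ℝ) :=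
  WithTop.continuous_coe.measurable

lemma isInvariantLocation_supLocation_layerFamily (hT : 0 < T) (he : MeasurableEmbedding e) :
    IsInvariantLocation (circleClass (layerFamily e) (periodic_layerFamily e)) (supLocation _) := by
  refine isInvariantLocation_supLocation (fun _ => upperSemicontinuous_of_mem_circleClass)
    (fun _ => existsUnique_of_mem_circleClass) fun I => ?_
  refine measurable_of_comp_toCirclePath _ (measurable_uncurry_layerFamily he.measurable)
    (injective_circlePath_layerFamily hT he.injective) ?_
  simp only [supLocation_toCirclePath]
  exact measurable_coe_withTop.comp (measurable_layerLocation he.measurable I)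

/-- The layer path with the same parameter and phase as a wave. -/
noncomputable def waveToLayer (g : (circleClass (waveFamily e) (periodic_waveFamily e)).Path) :
    (circleClass (layerFamily e) (periodic_layerFamily e)).Path :=
  toCirclePath (periodic_layerFamily e) g.2.choose

lemma waveToLayer_toCirclePath (he : Function.Injective e) (z : layerings T × UnitAddCircle) :
    waveToLayer (toCirclePath (periodic_waveFamily e) z) =
      toCirclePath (periodic_layerFamily e) z := by
  have h := (toCirclePath (periodic_waveFamily e) z).2.choose_spec
  rw [waveToLayer]
  congr 1
  exact injective_circlePath_waveFamily he _ _ fun q => congrFun h q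

lemma shift_toCirclePath {K : Type} {G : K → ℝ → ℝ} (hG : ∀ k, Function.Periodic (G k) 1) (c : ℝ)
    (z : K × UnitAddCircle) : (circleClass G hG).shift c (toCirclePath hG z) =
      toCirclePath hG (z.1, z.2 + (c : UnitAddCircle)) :=
  Subtype.ext (pathShift_circlePath hG c z)

/-- Decoding commutes with shifts, since both families move the phase in the same way; the axioms
therefore pull back. -/
lemma isInvariantLocation_waveToLayer (hT : 0 < T) (he : MeasurableEmbedding e) :
    IsInvariantLocation (circleClass (waveFamily e) (periodic_waveFamily e))
      fun g => supLocation _ (waveToLayer g) := by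
  refine (isInvariantLocation_supLocation_layerFamily hT he).comp waveToLayer ?_ fun I => ?_
  · rintro c ⟨_, z, rfl⟩
    change waveToLayer ((circleClass (waveFamily e) (periodic_waveFamily e)).shift c
      (toCirclePath (periodic_waveFamily e) z)) = (circleClass _ _).shift c
        (waveToLayer (toCirclePath (periodic_waveFamily e) z))
    rw [shift_toCirclePath, waveToLayer_toCirclePath he.injective,
      waveToLayer_toCirclePath he.injective, shift_toCirclePath]
  · refine measurable_of_comp_toCirclePath _ (measurable_uncurry_waveFamily he.measurable)
      (injective_circlePath_waveFamily he.injective) ?_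
    simp only [waveToLayer_toCirclePath he.injective, supLocation_toCirclePath]
    exact measurable_coe_withTop.comp (measurable_layerLocation he.measurable I)

end LayerFamily

/-! ### Compactness, and the hull as the set of laws. -/

section Hull

variable {T : ℝ} {e : layerings T → ℝ}

/-- The code `e k` does not affect the law, so the law can depend continuously on the layering
although `e` is only measurable. -/
lemma map_layerLocation (e : layerings T → ℝ) (hT : 0 < T) (hT1 : T ≤ 1) (k : layerings T) :
    (volume : Measure UnitAddCircle).map
      (fun x => layerLocation e (CompactInterval.zeroTo T hT) (k, x)) =
      layerMeasure k.1.1 k.1.2.2 + (layerMeasure k.1.2.1 (1 - k.1.2.2)).map (fun t => T - t) := by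
  rw [← map_sInf_maximizers_layerPath k.2 (e k) hT hT1, ← map_circleRep]
  have hm : Measurable fun v => sInf (maximizers (fun y => layerPath (e k) k.1.1 k.1.2.1 k.1.2.2
      (y + v)) (CompactInterval.zeroTo T hT)) :=
    (measurable_sInf_maximizers (upperSemicontinuous_shiftedLayerPath T)
      (CompactInterval.zeroTo T hT)).comp (f := fun v : ℝ => (e k, k, v)) (by fun_prop)
  rw [Measure.map_map hm measurable_circleRep]
  rfl

lemma measurable_coe_layerLocation (he : Measurable e) (I : CompactInterval) :
    Measurable fun z => (layerLocation e I z : WithTop ℝ) :=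
  measurable_coe_withTop.comp (measurable_layerLocation he I)

/-- The law of the location of the supremum, when the parameter of the layer path has the law `m`
and the phase is uniform. -/
noncomputable def layerLaw (he : Measurable e) (hT : 0 < T) (m : ProbabilityMeasure (layerings T)) :
    ProbabilityMeasure (WithTop ℝ) :=
  ⟨((m : Measure (layerings T)).prod volume).map
    fun z => (layerLocation e (CompactInterval.zeroTo T hT) z : WithTop ℝ),
    Measure.isProbabilityMeasure_map (measurable_coe_layerLocation he _).aemeasurable⟩

lemma coe_layerLaw (he : Measurable e) (hT : 0 < T) (m : ProbabilityMeasure (layerings T)) :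
    (layerLaw he hT m : Measure (WithTop ℝ)) = ((m : Measure (layerings T)).prod volume).map
      fun z => (layerLocation e (CompactInterval.zeroTo T hT) z : WithTop ℝ) := rfl

lemma integral_layerLaw (he : Measurable e) (hT : 0 < T) (hT1 : T ≤ 1)
    (m : ProbabilityMeasure (layerings T)) (φ : WithTop ℝ →ᵇ ℝ) :
    ∫ t, φ t ∂(layerLaw he hT m : Measure (WithTop ℝ)) =
      ∫ k, ((∫ t : ℝ, φ t ∂layerMeasure k.1.1 k.1.2.2) +
        ∫ t : ℝ, φ ((T - t : ℝ) : WithTop ℝ) ∂layerMeasure k.1.2.1 (1 - k.1.2.2))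
          ∂(m : Measure (layerings T)) := by
  have hm := measurable_layerLocation he (CompactInterval.zeroTo T hT)
  have hmc := measurable_coe_layerLocation he (CompactInterval.zeroTo T hT)
  have hφ : Continuous fun t : ℝ => φ t := φ.continuous.comp WithTop.continuous_coe
  rw [coe_layerLaw, integral_map hmc.aemeasurable φ.continuous.aestronglyMeasurable,
    integral_prod]
  · congr 1
    ext k
    have hmk : Measurable fun x => layerLocation e (CompactInterval.zeroTo T hT) (k, x) :=
      hm.comp measurable_prodMk_left
    have hl : layerMeasure k.1.1 k.1.2.2 + (layerMeasure k.1.2.1 (1 - k.1.2.2)).map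
        (fun t => T - t) ≤ _ := (map_layerLocation e hT hT1 k).ge
    have hp : IsProbabilityMeasure ((volume : Measure UnitAddCircle).map
      (fun x => layerLocation e (CompactInterval.zeroTo T hT) (k, x))) :=
      Measure.isProbabilityMeasure_map hmk.aemeasurable
    have hint : ∀ ν : Measure ℝ, ν ≤ (volume : Measure UnitAddCircle).map
        (fun x => layerLocation e (CompactInterval.zeroTo T hT) (k, x)) →
        Integrable (fun t : ℝ => φ t) ν := fun ν hν =>
      Integrable.mono_measure ((φ.compContinuous ⟨_, WithTop.continuous_coe⟩).integrable _) hν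
    rw [← integral_map (φ := fun x => layerLocation e (CompactInterval.zeroTo T hT) (k, x))
      (f := fun t : ℝ => φ t) hmk.aemeasurable hφ.aestronglyMeasurable, map_layerLocation e hT hT1,
      integral_add_measure (hint _ ((Measure.le_add_right le_rfl).trans hl))
        (hint _ ((Measure.le_add_left le_rfl).trans hl)),
      integral_map (by fun_prop) hφ.aestronglyMeasurable]
  · exact Integrable.of_bound (φ.continuous.measurable.comp hmc).aestronglyMeasurable ‖φ‖
      (Eventually.of_forall fun z => φ.norm_coe_le_norm _)

/-- The integral of a test function against the law is the `m`-integral of a continuous function of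
the layering, bounded by compactness. -/
lemma continuous_layerLaw (he : Measurable e) (hT : 0 < T) (hT1 : T ≤ 1) :
    Continuous fun m => (layerLaw he hT m).toFiniteMeasure := by
  refine continuous_iff_continuousAt.2 fun m₀ => ?_
  refine FiniteMeasure.tendsto_iff_forall_integral_tendsto.2 fun φ => ?_
  set ψ : ℝ →ᵇ ℝ := φ.compContinuous ⟨_, WithTop.continuous_coe⟩
  set ψ' : ℝ →ᵇ ℝ := ψ.compContinuous ⟨fun t => T - t, by fun_prop⟩
  have hc : Continuous fun k : layerings T => (∫ t, ψ t ∂layerMeasure k.1.1 k.1.2.2) +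
      ∫ t, ψ' t ∂layerMeasure k.1.2.1 (1 - k.1.2.2) := by
    refine Continuous.add ?_ ?_
    · exact continuous_integral_layerMeasure (by fun_prop) (by fun_prop)
        (fun k => k.2.antitone_left) (fun k => k.2.left_nonneg) (fun k => k.2.sum_left)
        (fun k => IsLayering.param_le_one k.2) ψ
    · exact continuous_integral_layerMeasure (by fun_prop) (by fun_prop)
        (fun k => k.2.antitone_right) (fun k => k.2.right_nonneg) (fun k => k.2.sum_right)
        (fun k => by linarith [IsLayering.nonneg_param k.2]) ψ'
  have h := ProbabilityMeasure.tendsto_iff_forall_integral_tendsto.1 (tendsto_id (x := 𝓝 m₀))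
    (BoundedContinuousFunction.mkOfCompact ⟨_, hc⟩)
  have e1 : ∀ m, ∫ t, φ t ∂((layerLaw he hT m).toFiniteMeasure : Measure (WithTop ℝ)) = _ :=
    fun m => integral_layerLaw he hT hT1 m φ
  simp only [e1]
  exact h

lemma convex_range_layerLaw (he : Measurable e) (hT : 0 < T) :
    Convex ℝ≥0 (range fun m => (layerLaw he hT m).toFiniteMeasure) := by
  rintro _ ⟨m₁, rfl⟩ _ ⟨m₂, rfl⟩ x y - - hxy
  have hp : IsProbabilityMeasure (x • (m₁ : Measure (layerings T)) +
      y • (m₂ : Measure (layerings T))) := ⟨by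
    simp only [Measure.add_apply, Measure.smul_apply, measure_univ]
    rw [ENNReal.smul_def, ENNReal.smul_def, smul_eq_mul, smul_eq_mul, mul_one, mul_one]
    exact_mod_cast hxy⟩
  refine ⟨⟨_, hp⟩, Subtype.ext ?_⟩
  change (((x • (m₁ : Measure (layerings T)) + y • (m₂ : Measure (layerings T)))).prod volume).map _
    = x • (((m₁ : Measure (layerings T)).prod volume).map _) +
      y • (((m₂ : Measure (layerings T)).prod volume).map _)
  rw [Measure.add_prod, Measure.map_add _ _ (measurable_coe_layerLocation he _), ← Measure.map_smul,
    ← Measure.map_smul]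
  congr 2
  · exact Measure.prod_smul_left _
  · exact Measure.prod_smul_left _

lemma positiveIntegerLaws_subset_range_layerLaw (he : Measurable e) (hT : 0 < T) (hT1 : T ≤ 1) :
    positiveIntegerLaws T ⊆ range (layerLaw he hT) := by
  intro F hF
  obtain ⟨b, a, d, h, hlaw⟩ := exists_isLayering hT hF
  obtain ⟨k, rfl, rfl, rfl⟩ : ∃ k : layerings T, k.1.1 = b ∧ k.1.2.1 = a ∧ k.1.2.2 = d :=
    ⟨⟨(b, a, d), h⟩, rfl, rfl, rfl⟩
  refine ⟨⟨Measure.dirac k, inferInstance⟩, Subtype.ext ?_⟩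
  change ((Measure.dirac k).prod volume).map _ = (F : Measure (WithTop ℝ))
  have hm := measurable_layerLocation he (CompactInterval.zeroTo T hT)
  rw [hlaw, ← map_layerLocation e hT hT1 k, Measure.dirac_prod,
    Measure.map_map (measurable_coe_layerLocation he _) measurable_prodMk_left,
    Measure.map_map measurable_coe_withTop
      (show Measurable fun x => layerLocation e (CompactInterval.zeroTo T hT) (k, x) from
        hm.comp measurable_prodMk_left)]
  rfl

/-- Probability measures on the compact space of layerings form a compact space, so their image is
closed; it is convex by mixing and contains the generators as images of Dirac masses. -/
lemma weakConvexHull_subset_range_layerLaw (he : Measurable e) (hT : 0 < T) (hT1 : T ≤ 1) :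
    weakConvexHull (positiveIntegerLaws T) ⊆ range (layerLaw he hT) := by
  intro F hF
  have hcl : IsClosed (range fun m => (layerLaw he hT m).toFiniteMeasure) :=
    (isCompact_range (continuous_layerLaw he hT hT1)).isClosed
  have hsub : (fun G : ProbabilityMeasure (WithTop ℝ) => G.toFiniteMeasure) ''
      positiveIntegerLaws T ⊆ range fun m => (layerLaw he hT m).toFiniteMeasure := by
    rintro _ ⟨G, hG, rfl⟩
    obtain ⟨m, rfl⟩ := positiveIntegerLaws_subset_range_layerLaw he hT hT1 hG
    exact ⟨m, rfl⟩
  obtain ⟨m, hm⟩ := closure_minimal (convexHull_min hsub (convex_range_layerLaw he hT)) hcl hF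
  exact ⟨m, Subtype.ext
    (congrArg (fun ν : FiniteMeasure (WithTop ℝ) => (ν : Measure (WithTop ℝ))) hm)⟩

end Hull

/-- The three parts: the set of all laws of invariant intrinsic location functionals is the hull;
processes with continuous paths already give every law in it; and so does the location of the
path supremum alone, on one class of upper semicontinuous paths whose supremum over a period is
attained at a unique point. -/
theorem theorem4p2 (T : ℝ) (hT : 0 < T) (hT1 : T ≤ 1) :
    invariantLaws Set.univ T hT = weakConvexHull (positiveIntegerLaws T) ∧
    invariantLaws {g | Continuous g} T hT = weakConvexHull (positiveIntegerLaws T) ∧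
    ∃ H : PathClass,
      (∀ g ∈ H.carrier, UpperSemicontinuous g) ∧
      (∀ g ∈ H.carrier, ∃! t : ℝ, t ∈ Set.Ico (0 : ℝ) 1 ∧ ∀ s : ℝ, g s ≤ g t) ∧
      IsInvariantLocation H (supLocation H) ∧
      locationLaws H (supLocation H) Set.univ T hT =
        weakConvexHull (positiveIntegerLaws T) := by
  -- The real code of a layering exists because the space of layerings is Polish.
  obtain ⟨e, he⟩ := exists_measurableEmbedding_real (layerings T)
  have hsub : ∀ R, invariantLaws R T hT ⊆ weakConvexHull (positiveIntegerLaws T) := by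
    rintro R F ⟨H, L, hL, hF⟩
    exact hL.locationLaws_subset R hT hT1 hF
  have hcont : ∀ R, {g : ℝ → ℝ | Continuous g} ⊆ R →
      weakConvexHull (positiveIntegerLaws T) ⊆ invariantLaws R T hT := by
    intro R hR F hF
    obtain ⟨m, rfl⟩ := weakConvexHull_subset_range_layerLaw he.measurable hT hT1 hF
    refine ⟨_, _, isInvariantLocation_waveToLayer hT he,
      mem_locationLaws_circleClass _ (measurable_uncurry_waveFamily he.measurable)
        (fun z => hR (continuous_circlePath_waveFamily e z)) hT m ?_⟩
    simp only [waveToLayer_toCirclePath he.injective, supLocation_toCirclePath]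
    exact coe_layerLaw he.measurable hT m
  refine ⟨(hsub _).antisymm (hcont _ (subset_univ _)), (hsub _).antisymm (hcont _ subset_rfl),
    circleClass (layerFamily e) (periodic_layerFamily e),
    fun _ => upperSemicontinuous_of_mem_circleClass, fun _ => existsUnique_of_mem_circleClass,
    isInvariantLocation_supLocation_layerFamily hT he, Subset.antisymm ?_ fun F hF => ?_⟩
  · exact (isInvariantLocation_supLocation_layerFamily hT he).locationLaws_subset _ hT hT1
  · obtain ⟨m, rfl⟩ := weakConvexHull_subset_range_layerLaw he.measurable hT hT1 hF
    refine mem_locationLaws_circleClass _ (measurable_uncurry_layerFamily he.measurable)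
      (fun _ => mem_univ _) hT m ?_
    simp only [supLocation_toCirclePath]
    exact coe_layerLaw he.measurable hT m
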